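/- Let $K$ be a one-dimensional global field, i.e. a number field or a finite separable extension of $\mathbb F_p(t)$ for some prime $p$. Let $K_v$ be the completion of $K$ at a place $v$, with ring of integers $O_v$ if $v$ is non-archimedean, and let $\mathbb A_K$ be the adele ring, the restricted product of the $K_v$ with respect to the $O_v$. Let $|\cdot|_v$ be the normalised absolute value (for $v$ non-archimedean $|x|_v=(\#k(v))^{-v(x)}$, with $k(v)$ the residue field; for $v$ real the usual absolute value; for $v$ complex the square of the usual one), and $|\alpha|=\prod_v|\alpha_v|_v$ the idele norm of $\alpha\in\mathbb A_K^\times$. Put $e_v=1$ for $v$ real and $e_v=2$ for $v$ complex. For an idele $\alpha$ define $f_\alpha:\mathbb A_K\to\mathbb R$ by $f_\alpha(u)=\prod_v f_v(\alpha_v^{-1}u_v)$, where $f_v=\mathrm{char}_{O_v}$ if $v$ is non-archimedean and $f_v(x)=\exp(-e_v\pi|x|_v^{2/e_v})$ if $v$ is archimedean. Let $d_K=|\mathrm{disc}(K)|$ if $K$ is a number field, and $d_K=q^{2g-2}$ if $K$ is a function field with field of constants of cardinality $q$ and genus $g$. Let $\psi$ be a nontrivial continuous additive character of $\mathbb A_K$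 that is trivial on $K$, and let $\mu$ be the Haar measure on $\mathbb A_K$ that is self-dual for $\psi$: with $\hat f(y)=\int f(x)\psi(-xy)\,d\mu(x)$, one has $\hat{\hat f}(x)=f(-x)$ for all continuous integrable $f$ with $\hat f$ integrable. Then for every idele $\alpha$ the function $f_\alpha$ is integrable with $\int f_\alpha\,d\mu>0$, the numbers $|\alpha|$ and $d_K$ are positive, and the Euler characteristic $\chi_K(D_\alpha):=\log\int_{\mathbb A_K}f_\alpha\,d\mu$ satisfies $$\chi_K(D_\alpha)=\log|\alpha|-\tfrac12\log d_K .$$ Equivalently, $\chi_K(D_\alpha)=\log|\alpha|+\log|\kappa_K|$ for every idele $\kappa_K$ with $|\kappa_K|=d_K^{-1/2}$. If instead $\kappa$ is a canonical idele, meaning that $\hat f_1=c\,f_\kappa$ for some constant $c$, then $|\kappa|=d_K$, and $\chi_K(D_\alpha)=\log|\alpha|-\tfrac12\log|\kappa|$. In particular $$\chi_K(D_\alpha)-\chi_K(D_1)=\log|\alpha| .$$ -/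

import Mathlib

open IsDedekindDomain MeasureTheory
open scoped RestrictedProduct WithZero

noncomputable section

namespace GlobalField

/-- A one-dimensional global field: a number field, or a finite separable extension of the
rational function field `𝔽_p(t)` for some prime `p` and some choice of `t`. -/
def IsGlobalField (K : Type*) [Field K] : Prop :=
  NumberField K ∨
    ∃ (p : ℕ) (_ : Fact p.Prime) (_ : Algebra (RatFunc (ZMod p)) K),
      FiniteDimensional (RatFunc (ZMod p)) K ∧ Algebra.IsSeparable (RatFunc (ZMod p)) K

/-! ### Non-archimedean places -/

/-- The non-archimedean places of a global field `K`, given by their valuation rings: the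
subrings `A` of `K` that are discrete valuation rings with fraction field `K`.
(The archimedean places are `NumberField.InfinitePlace K`; there are none in positive
characteristic.) -/
def NonarchPlace (K : Type*) [Field K] : Type _ :=
  {A : ValuationSubring K // IsDiscreteValuationRing A}

namespace NonarchPlace

variable {K : Type*} [Field K]

/-- The valuation ring of `v` inside `K`. -/
abbrev ring (v : NonarchPlace K) : ValuationSubring K := v.1

instance (v : NonarchPlace K) : IsDiscreteValuationRing v.ring := v.2

/-- The maximal ideal of the valuation ring of `v`, as a height one prime. -/
abbrev prime (v : NonarchPlace K) : HeightOneSpectrum v.ring :=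
  IsDiscreteValuationRing.maximalIdeal v.ring

/-- The completion `K_v`. -/
abbrev Completion (v : NonarchPlace K) : Type _ := v.prime.adicCompletion K

/-- The ring of integers `O_v` of `K_v`. -/
abbrev integers (v : NonarchPlace K) : ValuationSubring v.Completion :=
  v.prime.adicCompletionIntegers K

/-- The residue field of `v`. -/
abbrev ResidueField (v : NonarchPlace K) : Type _ := IsLocalRing.ResidueField v.ring

/-- The normalised absolute value `|x|_v = (#k(v)) ^ (-v(x))` on `K_v`; the `ℤᵐ⁰`-valued
valuation of Mathlib is `exp (-v(x))`. -/
def abs (v : NonarchPlace K) (x : v.Completion) : ℝ :=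
  open Classical in
  if x = 0 then 0 else (Nat.card v.ResidueField : ℝ) ^ WithZero.log (Valued.v x)

end NonarchPlace

/-! ### Adeles and ideles -/

section Adeles

variable (K : Type*) [Field K]

/-- The non-archimedean part of the adele ring: the restricted product of the `K_v` with respect
to the `O_v` over all non-archimedean places `v`. -/
def NonarchAdeleRing : Type _ :=
  Πʳ v : NonarchPlace K, [v.Completion, v.integers]

instance : CommRing (NonarchAdeleRing K) :=
  inferInstanceAs <| CommRing <| Πʳ v : NonarchPlace K, [v.Completion, v.integers]

instance : TopologicalSpace (NonarchAdeleRing K) :=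
  inferInstanceAs <| TopologicalSpace <| Πʳ v : NonarchPlace K, [v.Completion, v.integers]

instance : DFunLike (NonarchAdeleRing K) (NonarchPlace K) NonarchPlace.Completion where
  coe a := a.1
  coe_injective _ _ := Subtype.ext

instance : IsTopologicalRing (NonarchAdeleRing K) :=
  haveI : Fact (∀ v : NonarchPlace K, IsOpen (v.integers : Set v.Completion)) :=
    ⟨fun _ ↦ Valued.isOpen_valuationSubring _⟩
  RestrictedProduct.isTopologicalRing (fun v : NonarchPlace K ↦ v.Completion)

/-- The adele ring `𝔸_K`: the (finite) product of the archimedean completions times the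
restricted product of the non-archimedean ones. -/
abbrev AdeleRing : Type _ := NumberField.InfiniteAdeleRing K × NonarchAdeleRing K

variable {K}

/-- The principal adeles, i.e. the diagonal image of `K` in `𝔸_K`: the adeles all of whose
components come from one element `x` of `K`. -/
def IsPrincipal (a : AdeleRing K) : Prop :=
  ∃ x : K, (∀ v : NumberField.InfinitePlace K, a.1 v = (x : v.Completion)) ∧
    ∀ v : NonarchPlace K, a.2 v = (x : v.Completion)

/-- The normalised absolute value at an archimedean place: the usual absolute value if `v` is
real, its square if `v` is complex. -/
def archAbs (v : NumberField.InfinitePlace K) (x : v.Completion) : ℝ := ‖x‖ ^ v.mult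

/-- The idele norm `|α| = ∏_v |α_v|_v`, over all places (almost all factors are `1`). -/
def ideleNorm (α : (AdeleRing K)ˣ) : ℝ :=
  (∏ᶠ v : NumberField.InfinitePlace K, archAbs v ((α : AdeleRing K).1 v)) *
    ∏ᶠ v : NonarchPlace K, v.abs ((α : AdeleRing K).2 v)

/-- The local factor `exp (-e_v π |x|_v ^ (2 / e_v))` at an archimedean place, where `e_v` is
`1` if `v` is real and `2` if `v` is complex. -/
def archFactor (v : NumberField.InfinitePlace K) (x : v.Completion) : ℝ :=
  Real.exp (-(v.mult : ℝ) * Real.pi * archAbs v x ^ (2 / (v.mult : ℝ)))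

/-- The local factor at a non-archimedean place: the characteristic function of `O_v`. -/
def nonarchFactor (v : NonarchPlace K) (x : v.Completion) : ℝ :=
  (v.integers : Set v.Completion).indicator 1 x

/-- The function `f_α(u) = ∏_v f_v(α_v⁻¹ u_v)` on the adeles (for each `u`, almost all factors
are `1`). -/
def adelicFun (α : (AdeleRing K)ˣ) (u : AdeleRing K) : ℝ :=
  (∏ᶠ v : NumberField.InfinitePlace K,
      archFactor v ((((α⁻¹ : (AdeleRing K)ˣ) : AdeleRing K) * u).1 v)) *
    ∏ᶠ v : NonarchPlace K,
      nonarchFactor v ((((α⁻¹ : (AdeleRing K)ˣ) : AdeleRing K) * u).2 v)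

/-! ### Self-dual measures and the Euler characteristic -/

/-- `ψ` is a nontrivial continuous additive character of `𝔸_K` that is trivial on `K`. -/
structure IsGlobalCharacter (ψ : AddChar (AdeleRing K) Circle) : Prop where
  continuous : Continuous ψ
  nontrivial : ψ ≠ 1
  trivial_on_principal : ∀ a : AdeleRing K, IsPrincipal a → ψ a = 1

/-- `μ` is self-dual for `ψ`: with `f̂(y) = ∫ f(x) ψ(-xy) dμ(x)`, the Fourier inversion formula
`f̂̂(x) = f(-x)` holds for all continuous integrable `f` whose Fourier transform is
integrable. -/
def IsSelfDual [MeasurableSpace (AdeleRing K)] (ψ : AddChar (AdeleRing K) Circle)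
    (μ : Measure (AdeleRing K)) : Prop :=
  ∀ f : AdeleRing K → ℂ, Continuous f → Integrable f μ →
    Integrable (Fourier.fourierIntegral ψ μ f) μ →
      ∀ x, Fourier.fourierIntegral ψ μ (Fourier.fourierIntegral ψ μ f) x = f (-x)

/-- The Euler characteristic `χ_K(D_α) = log ∫_{𝔸_K} f_α`. -/
def eulerChar [MeasurableSpace (AdeleRing K)] (μ : Measure (AdeleRing K))
    (α : (AdeleRing K)ˣ) : ℝ :=
  Real.log (∫ u, adelicFun α u ∂μ)

/-- `κ` is a canonical idele for `ψ`: the Fourier transform of `f_1` is a constant multiple of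
`f_κ`. -/
def IsCanonicalIdele [MeasurableSpace (AdeleRing K)] (ψ : AddChar (AdeleRing K) Circle)
    (μ : Measure (AdeleRing K)) (κ : (AdeleRing K)ˣ) : Prop :=
  ∃ c : ℂ, ∀ x, Fourier.fourierIntegral ψ μ (fun u ↦ (adelicFun (1 : (AdeleRing K)ˣ) u : ℂ)) x
    = c * (adelicFun κ x : ℂ)

end Adeles

/-! ### Constants, divisors, genus and the absolute discriminant -/

section Genus

variable (K : Type*) [Field K]

/-- The elements of `K` that are regular at every non-archimedean place. If `K` is a function
field, this is its field of constants. -/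
def constants : Subring K := ⨅ v : NonarchPlace K, v.ring.toSubring

variable {K}

theorem constants_le (v : NonarchPlace K) : constants K ≤ v.ring.toSubring :=
  iInf_le (fun v : NonarchPlace K ↦ v.ring.toSubring) v

/-- The map from the constants to the residue field of a place. -/
def constantsToResidueField (v : NonarchPlace K) : constants K →+* v.ResidueField :=
  (IsLocalRing.residue v.ring).comp (Subring.inclusion (constants_le v))

/-- The degree of a place of a function field: the degree of its residue field over the
field of constants. -/
def placeDegree (v : NonarchPlace K) : ℕ :=
  letI := (constantsToResidueField v).toAlgebra
  Module.finrank (constants K) v.ResidueField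

/-- The degree of a divisor. -/
def divisorDegree (D : NonarchPlace K →₀ ℤ) : ℤ :=
  D.sum fun v n ↦ n * (placeDegree v : ℤ)

/-- The Riemann-Roch space `L(D) = {x ∈ K | v(x) ≥ -D(v) for all v}` of a divisor, as a module
over the constants (`x = 0` included). -/
def riemannRochSpace (D : NonarchPlace K →₀ ℤ) : Submodule (constants K) K where
  carrier := {x | ∀ v : NonarchPlace K, v.prime.valuation K x ≤ WithZero.exp (D v)}
  zero_mem' v := by simp
  add_mem' hx hy v := (Valuation.map_add _ _ _).trans (max_le (hx v) (hy v))
  smul_mem' c x hx v := by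
    have hc : v.prime.valuation K (c : K) ≤ 1 :=
      HeightOneSpectrum.valuation_le_one (K := K) v.prime ⟨c, constants_le v c.2⟩
    rw [Subring.smul_def, smul_eq_mul, map_mul]
    exact (mul_le_of_le_one_left' hc).trans (hx v)

variable (K)

/-- The genus of a function field: the maximum of `deg D + 1 - dim L(D)` over all divisors `D`.
(The value `0` is attained at `D = 0`, so only the nonnegative values matter.) -/
def genus : ℕ :=
  sSup {n : ℕ | ∃ D : NonarchPlace K →₀ ℤ,
    (n : ℤ) = divisorDegree D + 1 - (Module.finrank (constants K) (riemannRochSpace D) : ℤ)}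

/-- The absolute discriminant `d_K` of a global field: the absolute value of the discriminant
if `K` is a number field, and `q ^ (2 g - 2)` if `K` is a function field, where `q` is the
cardinality of the field of constants and `g` the genus. -/
def absDiscr : ℝ :=
  open Classical in
  if _h : NumberField K then |((NumberField.discr K : ℤ) : ℝ)|
  else (Nat.card (constants K) : ℝ) ^ (2 * (genus K : ℤ) - 2)

end Genus

end GlobalField

end

/-! The function f_α is a Gaussian in the archimedean components times the indicator of the ball of
finite adeles bounded by the divisor of α. Haar measure turns scaling by α into the factor |α|, so ∫
f_α = C|α| with C = ∫ f_1 (`exists_adelic_integrals`). A global character ψ has a conductor idele κ: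
at infinity ψ is the standard trace character composed with multiplication by κ⁻¹, and the finite
ball of κ is the dual of ∏ O_v under ψ (`IsConductor`). Then the Fourier transform of f_1 is C f_κ
(`fourierIntegral_adelicFun_one`), and inversion at 0 reads 1 = C ∫ f_κ = C²|κ|. Everything follows
once |κ| = d_K is known (`main_of_isConductor`).

For a number field, triviality on K forces the archimedean part of ψ to be x ↦ exp(2πi Tr(ax)) with
a in K nonzero. Strong approximation then determines the finite part: the ball of κ is a⁻¹ times the
inverse different. By the product formula a does not contribute to |κ|, which is therefore the norm
of the different, i.e. |disc K| (`exists_isConductor_of_numberField`).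

For a function field the equality is Riemann–Roch, proved by counting. Write A(D) for the adeles
bounded by D, N(D) for the norm of D, h⁰(D) = #(K ∩ A(D)) and h¹(D) = #(𝔸/(K + A(D))). Indices of
balls show that h⁰(D)/(N(D) h¹(D)) does not depend on D (`hZero_eq`). A growth estimate shows that
continuous characters trivial on K are K-multiples of a single one (`exists_mulShift_eq`). The
resulting duality gives N(κ) = (h¹(0)/h⁰(0))² (`IsDifferential.divNorm_eq`), and h⁰(0) = q, h¹(0) =
q^g turn this into q^(2g-2). Finiteness of h⁰ and h¹ comes from covering the curve by the integral
closures of k[t] and k[t⁻¹]. Throughout, positive coefficients of a divisor allow poles. -/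

noncomputable section

namespace GlobalField

/-! ### Balls, residue fields and compactness in a nonarchimedean completion -/

namespace NonarchPlace

variable {K : Type*} [Field K] (v : NonarchPlace K)

theorem valued_coe (x : K) : Valued.v (x : v.Completion) = v.prime.valuation K x :=
  HeightOneSpectrum.valuedAdicCompletion_eq_valuation' v.prime x

theorem coe_sub (x y : K) : ((x - y : K) : v.Completion) = (x : v.Completion) - (y : v.Completion) :=
  map_sub (algebraMap K v.Completion) x y

/-- A discrete valuation ring has a single height one prime, so integrality there is integrality
everywhere. -/
theorem valuation_le_one_iff (x : K) : v.prime.valuation K x ≤ 1 ↔ x ∈ v.ring := by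
  constructor
  · intro h
    have := HeightOneSpectrum.mem_integers_of_valuation_le_one (R := v.ring) K x (fun w ↦ by
      have hw : w = v.prime := by
        ext1
        exact IsLocalRing.eq_maximalIdeal (w.isPrime.isMaximal w.ne_bot)
      rwa [hw])
    obtain ⟨y, rfl⟩ := this
    exact y.2
  · intro h
    exact HeightOneSpectrum.valuation_le_one (K := K) v.prime ⟨x, h⟩

/-- K is dense in its completion, and closed balls are open. -/
theorem exists_coe_sub_le (a : v.Completion) (n : ℤ) :
    ∃ x : K, Valued.v (a - (x : v.Completion)) ≤ WithZero.exp n := by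
  have hd := HeightOneSpectrum.denseRange_algebraMap (K := K) v.prime
  obtain ⟨u, hu⟩ := HeightOneSpectrum.valuedAdicCompletion_surjective K v.prime (WithZero.exp n)
  have hu0 : u ≠ 0 := by
    rintro rfl
    exact WithZero.exp_ne_zero ((map_zero _).symm.trans hu).symm
  have hopen : IsOpen {y : v.Completion | Valued.v y ≤ Valued.v u} := by
    have := Valued.isOpen_closedBall v.Completion (r := Valued.v.restrict u) (by simpa using hu0)
    simpa using! this
  obtain ⟨x, hx⟩ := hd.exists_mem_open (hopen.preimage (continuous_sub_left a)) ⟨a, by simp⟩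
  refine ⟨x, ?_⟩
  rw [← hu]
  exact hx

/-- The additive subgroup of elements of valuation at most `exp n` in the completion. -/
def ball (n : ℤ) : AddSubgroup v.Completion where
  carrier := {x | Valued.v x ≤ WithZero.exp n}
  zero_mem' := by simp
  add_mem' {x y} hx hy := by
    rw [Set.mem_ofPred_eq] at *
    exact (Valuation.map_add _ _ _).trans (max_le hx hy)
  neg_mem' {x} hx := by simpa using hx

theorem mem_ball {n : ℤ} {x : v.Completion} : x ∈ v.ball n ↔ Valued.v x ≤ WithZero.exp n := by
  rfl

theorem exists_valued_eq (n : ℤ) : ∃ u : v.Completion, Valued.v u = WithZero.exp n :=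
  HeightOneSpectrum.valuedAdicCompletion_surjective K v.prime (WithZero.exp n)

theorem exists_ball_subset {U : Set v.Completion} (hU : U ∈ nhds 0) :
    ∃ n : ℤ, n ≤ 0 ∧ (v.ball n : Set v.Completion) ⊆ U := by
  obtain ⟨γ, hγ⟩ := Valued.mem_nhds_zero.1 hU
  have hk := (WithZero.exp_log (x := MonoidWithZeroHom.ValueGroup₀.embedding γ.1) (by simp)).symm
  set k := WithZero.log (MonoidWithZeroHom.ValueGroup₀.embedding γ.1)
  refine ⟨min (k - 1) 0, min_le_right _ _, fun x hx ↦ hγ ?_⟩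
  rw [Set.mem_ofPred_eq, Valuation.restrict_lt_iff_lt_embedding, hk]
  refine lt_of_le_of_lt (v.mem_ball.1 hx) ?_
  rw [WithZero.exp_lt_exp]
  omega

theorem mul_mem_ball_iff {u x : v.Completion} {m n : ℤ} (hu : Valued.v u = WithZero.exp m) :
    u * x ∈ v.ball (m + n) ↔ x ∈ v.ball n := by
  rw [mem_ball, mem_ball, map_mul, hu, WithZero.exp_add]
  exact mul_le_mul_iff_right₀ WithZero.exp_pos

/-- The value group is discrete: the largest value below 1 is exp (-1). -/
theorem mem_ball_neg_one {x : v.Completion} : x ∈ v.ball (-1) ↔ Valued.v x < 1 := by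
  rw [mem_ball]
  rcases eq_or_ne x 0 with rfl | hx
  · simp
  · have h0 : Valued.v x ≠ 0 := by simpa using hx
    rw [← WithZero.exp_log h0, ← WithZero.exp_zero, WithZero.exp_le_exp, WithZero.exp_lt_exp]
    omega

/-- The map from the valuation ring to the integers of the completion. -/
def toIntegers : v.ring →+* v.integers where
  toFun x := ⟨((x : K) : v.Completion), by
    have := (v.valuation_le_one_iff (x : K)).2 x.2
    rwa [← v.valued_coe] at this⟩
  map_one' := Subtype.ext (map_one (algebraMap K v.Completion))
  map_zero' := Subtype.ext (map_zero (algebraMap K v.Completion))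
  map_add' _ _ := Subtype.ext (map_add (algebraMap K v.Completion) _ _)
  map_mul' _ _ := Subtype.ext (map_mul (algebraMap K v.Completion) _ _)

theorem valued_toIntegers_lt_one_iff (x : v.ring) :
    Valued.v (v.toIntegers x : v.Completion) < 1 ↔ x ∈ IsLocalRing.maximalIdeal v.ring := by
  change Valued.v ((x : K) : v.Completion) < 1 ↔ _
  rw [v.valued_coe]
  exact HeightOneSpectrum.valuation_lt_one_iff_mem v.prime x

theorem mem_maximalIdeal_integers_iff (x : v.integers) :
    x ∈ IsLocalRing.maximalIdeal v.integers ↔ Valued.v (x : v.Completion) < 1 :=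
  Valuation.mem_maximalIdeal_iff _ _

theorem exists_toIntegers_sub_lt_one (a : v.integers) :
    ∃ x : v.ring, Valued.v ((a - v.toIntegers x : v.integers) : v.Completion) < 1 := by
  obtain ⟨x, hx⟩ := v.exists_coe_sub_le a (-1)
  have hx1 := v.mem_ball_neg_one.1 (v.mem_ball.2 hx)
  have hxr : x ∈ v.ring := by
    rw [← v.valuation_le_one_iff, ← v.valued_coe]
    have : ((x : K) : v.Completion) = a - (a - (x : v.Completion)) := by ring
    rw [this]
    exact (Valuation.map_sub _ _ _).trans (max_le a.2 hx1.le)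
  exact ⟨⟨x, hxr⟩, hx1⟩

/-- Reduction of integral elements of `K` modulo the maximal ideal of the completion. -/
def reduction : v.ring →+* IsLocalRing.ResidueField v.integers :=
  (IsLocalRing.residue v.integers).comp v.toIntegers

theorem reduction_surjective : Function.Surjective v.reduction := by
  intro y
  obtain ⟨a, rfl⟩ := IsLocalRing.residue_surjective y
  obtain ⟨x, hx⟩ := v.exists_toIntegers_sub_lt_one a
  refine ⟨x, ?_⟩
  have : IsLocalRing.residue v.integers (a - v.toIntegers x) = 0 := by
    rw [IsLocalRing.residue_eq_zero_iff]
    exact (v.mem_maximalIdeal_integers_iff _).2 hx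
  rw [map_sub, sub_eq_zero] at this
  exact this.symm

theorem ker_reduction : RingHom.ker v.reduction = IsLocalRing.maximalIdeal v.ring := by
  ext x
  rw [RingHom.mem_ker]
  change IsLocalRing.residue v.integers (v.toIntegers x) = 0 ↔ _
  rw [IsLocalRing.residue_eq_zero_iff, mem_maximalIdeal_integers_iff,
    valued_toIntegers_lt_one_iff]

/-- The residue field does not change under completion. -/
def residueFieldEquiv : v.ResidueField ≃+* IsLocalRing.ResidueField v.integers :=
  (Ideal.quotEquivOfEq v.ker_reduction.symm).trans
    (RingHom.quotientKerEquivOfSurjective v.reduction_surjective)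

/-- Multiplication by an element of value exp (n + 1) carries O_v and its maximal ideal to the two
balls, so the index is the size of the residue field, which completion does not change. -/
theorem ball_relIndex (n : ℤ) :
    (v.ball n).relIndex (v.ball (n + 1)) = Nat.card v.ResidueField := by
  obtain ⟨u, hu⟩ := v.exists_valued_eq (n + 1)
  have hu0 : u ≠ 0 := by
    rintro rfl
    exact WithZero.exp_ne_zero ((map_zero _).symm.trans hu).symm
  let f : v.integers →+ v.Completion := (AddMonoidHom.mulLeft u).comp v.integers.toSubring.subtype.toAddMonoidHom
  have hf : Function.Injective f := fun x y hxy ↦ Subtype.ext (mul_left_cancel₀ hu0 hxy)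
  have h1 : (⊤ : AddSubgroup v.integers).map f = v.ball (n + 1) := by
    ext x
    constructor
    · rintro ⟨y, -, rfl⟩
      have := (v.mul_mem_ball_iff hu (n := 0) (x := y)).2 y.2
      rwa [add_zero] at this
    · intro hx
      have hx' : u * (u⁻¹ * x) ∈ v.ball (n + 1 + 0) := by
        rwa [mul_inv_cancel_left₀ hu0, add_zero]
      refine ⟨⟨u⁻¹ * x, (v.mul_mem_ball_iff hu).1 hx'⟩, trivial, mul_inv_cancel_left₀ hu0 x⟩
  have h2 : (v.ball n).comap f = (IsLocalRing.maximalIdeal v.integers).toAddSubgroup := by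
    ext x
    have := v.mul_mem_ball_iff hu (n := -1) (x := x)
    rw [add_neg_cancel_right] at this
    refine this.trans ?_
    rw [mem_ball_neg_one, ← mem_maximalIdeal_integers_iff]
    rfl
  rw [← h1, ← AddSubgroup.relIndex_comap, h2, AddSubgroup.relIndex_top_right]
  exact (Nat.card_congr v.residueFieldEquiv.toEquiv).symm

theorem compactSpace_integers [Finite v.ResidueField] : CompactSpace v.integers := by
  -- The compactness criterion needs a rank one structure; the base 2 is arbitrary.
  have : Valued.v.RankOne (R := v.Completion) := Valuation.IsRankOneDiscrete.rankOne
    (Valued.v : Valuation v.Completion ℤᵐ⁰) (e := 2) (by norm_num)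
  have h3 : Finite (IsLocalRing.ResidueField v.integers) := Finite.of_equiv _ v.residueFieldEquiv.toEquiv
  have h4 : CompleteSpace v.integers := by
    have : IsClosed (v.integers : Set v.Completion) := Valued.isClosed_valuationSubring _
    exact this.completeSpace_coe
  exact Valued.integer.compactSpace_iff_completeSpace_and_isDiscreteValuationRing_and_finite_residueField.2
    ⟨h4, inferInstanceAs (IsDiscreteValuationRing (v.prime.adicCompletionIntegers K)), h3⟩

end NonarchPlace
end GlobalField

/-! ### Nonarchimedean adeles and the balls attached to divisors -/

namespace GlobalField

variable {K : Type*} [Field K]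

namespace NonarchAdeleRing

theorem sub_apply (a b : NonarchAdeleRing K) (v : NonarchPlace K) : (a - b) v = a v - b v := rfl
theorem mul_apply (a b : NonarchAdeleRing K) (v : NonarchPlace K) : (a * b) v = a v * b v := rfl
theorem one_apply (v : NonarchPlace K) : (1 : NonarchAdeleRing K) v = 1 := rfl

@[ext] theorem ext {a b : NonarchAdeleRing K} (h : ∀ v, a v = b v) : a = b := DFunLike.ext _ _ h

/-- A nonarchimedean adele from its components. -/
def mk (f : ∀ v : NonarchPlace K, v.Completion)
    (hf : ∀ᶠ v in Filter.cofinite, f v ∈ v.integers) : NonarchAdeleRing K := ⟨f, hf⟩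

theorem eventually_mem (a : NonarchAdeleRing K) : ∀ᶠ v in Filter.cofinite, a v ∈ v.integers := a.2

/-- Evaluation at a place. -/
def eval (v : NonarchPlace K) : NonarchAdeleRing K →+ v.Completion where
  toFun a := a v
  map_zero' := rfl
  map_add' _ _ := rfl

open Classical in
/-- The adele with a single nonzero component. -/
def single (v : NonarchPlace K) (x : v.Completion) : NonarchAdeleRing K :=
  mk (Pi.single v x) (by
    filter_upwards [(Set.finite_singleton v).compl_mem_cofinite] with w hw
    rw [Pi.single_eq_of_ne hw]
    exact zero_mem _)

theorem single_same (v : NonarchPlace K) (x : v.Completion) : single v x v = x := by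
  classical exact Pi.single_eq_same v x

theorem single_of_ne {v w : NonarchPlace K} (h : w ≠ v) (x : v.Completion) : single v x w = 0 := by
  classical exact Pi.single_eq_of_ne h x

end NonarchAdeleRing

open NonarchAdeleRing

/-- The adeles whose components are bounded by a divisor. -/
def divSubgroup (D : NonarchPlace K →₀ ℤ) : AddSubgroup (NonarchAdeleRing K) where
  carrier := {a | ∀ v, a v ∈ v.ball (D v)}
  zero_mem' _ := zero_mem _
  add_mem' hx hy _ := add_mem (hx _) (hy _)
  neg_mem' hx _ := neg_mem (hx _)

theorem ball_mono (v : NonarchPlace K) {m n : ℤ} (h : m ≤ n) : v.ball m ≤ v.ball n := by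
  intro x hx
  exact v.mem_ball.2 ((v.mem_ball.1 hx).trans (WithZero.exp_le_exp.2 h))

theorem divSubgroup_mono {D E : NonarchPlace K →₀ ℤ} (h : D ≤ E) : divSubgroup D ≤ divSubgroup E :=
  fun _ ha v ↦ ball_mono v (h v) (ha v)

theorem ideleComponent_ne_zero (α : (NonarchAdeleRing K)ˣ) (v : NonarchPlace K) :
    (α : NonarchAdeleRing K) v ≠ 0 := by
  intro h
  have h1 := congrArg (fun a : NonarchAdeleRing K ↦ a v) α.mul_inv
  simp only [mul_apply, one_apply, h, zero_mul] at h1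
  exact zero_ne_one h1

theorem inv_apply (α : (NonarchAdeleRing K)ˣ) (v : NonarchPlace K) :
    ((α⁻¹ : (NonarchAdeleRing K)ˣ) : NonarchAdeleRing K) v = ((α : NonarchAdeleRing K) v)⁻¹ := by
  have h1 := congrArg (fun a : NonarchAdeleRing K ↦ a v) α.mul_inv
  exact eq_inv_of_mul_eq_one_right h1

/-- The divisor of an idele. -/
def ideleDiv (α : (NonarchAdeleRing K)ˣ) : NonarchPlace K →₀ ℤ :=
  Finsupp.ofSupportFinite (fun v ↦ WithZero.log (Valued.v ((α : NonarchAdeleRing K) v))) (by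
    have h := (eventually_mem (α : NonarchAdeleRing K)).and
      (eventually_mem ((α⁻¹ : (NonarchAdeleRing K)ˣ) : NonarchAdeleRing K))
    refine Set.Finite.subset (Filter.eventually_cofinite.1 h) fun v hv ↦ ?_
    rintro ⟨h1, h2⟩
    refine hv ?_
    have h1' : Valued.v ((α : NonarchAdeleRing K) v) ≤ 1 := h1
    have h2' : Valued.v (((α⁻¹ : (NonarchAdeleRing K)ˣ) : NonarchAdeleRing K) v) ≤ 1 := h2
    rw [inv_apply, map_inv₀, inv_le_one₀ (zero_lt_iff.2 (by simpa using ideleComponent_ne_zero α v))] at h2'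
    simp [le_antisymm h1' h2'])

theorem valued_idele (α : (NonarchAdeleRing K)ˣ) (v : NonarchPlace K) :
    Valued.v ((α : NonarchAdeleRing K) v) = WithZero.exp (ideleDiv α v) :=
  (WithZero.exp_log (by simpa using ideleComponent_ne_zero α v)).symm

/-- Makes every ball a multiple of ∏ O_v, so that its openness and compactness need proof only for
the zero divisor. -/
theorem exists_ideleDiv_eq (D : NonarchPlace K →₀ ℤ) :
    ∃ α : (NonarchAdeleRing K)ˣ, ideleDiv α = D := by
  choose u hu using fun v : NonarchPlace K ↦ v.exists_valued_eq (D v)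
  have hD : ∀ᶠ v in Filter.cofinite, D v = 0 := by
    rw [Filter.eventually_cofinite]
    exact D.hasFiniteSupport
  have h1 : ∀ᶠ v : NonarchPlace K in Filter.cofinite, u v ∈ v.integers := by
    filter_upwards [hD] with v hv
    have : Valued.v (u v) ≤ 1 := by rw [hu, hv, WithZero.exp_zero]
    exact this
  have h2 : ∀ᶠ v : NonarchPlace K in Filter.cofinite, (u v)⁻¹ ∈ v.integers := by
    filter_upwards [hD] with v hv
    have : Valued.v (u v)⁻¹ ≤ 1 := by rw [map_inv₀, hu, hv, WithZero.exp_zero, inv_one]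
    exact this
  have hne : ∀ v, u v ≠ 0 := fun v h ↦
    WithZero.exp_ne_zero (((map_zero _).symm.trans (congrArg _ h.symm)).trans (hu v)).symm
  refine ⟨⟨mk u h1, mk (fun v ↦ (u v)⁻¹) h2, ?_, ?_⟩, ?_⟩
  · exact NonarchAdeleRing.ext fun v ↦ mul_inv_cancel₀ (hne v)
  · exact NonarchAdeleRing.ext fun v ↦ inv_mul_cancel₀ (hne v)
  · ext v
    change WithZero.log (Valued.v (u v)) = D v
    rw [hu, WithZero.log_exp]

theorem mul_mem_divSubgroup_iff (α : (NonarchAdeleRing K)ˣ) (D : NonarchPlace K →₀ ℤ)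
    (a : NonarchAdeleRing K) :
    (α : NonarchAdeleRing K) * a ∈ divSubgroup (ideleDiv α + D) ↔ a ∈ divSubgroup D :=
  forall_congr' fun v ↦ v.mul_mem_ball_iff (valued_idele α v)

theorem inv_mul_mem_divSubgroup_iff (α : (NonarchAdeleRing K)ˣ) (D : NonarchPlace K →₀ ℤ)
    (a : NonarchAdeleRing K) :
    ((α⁻¹ : (NonarchAdeleRing K)ˣ) : NonarchAdeleRing K) * a ∈ divSubgroup D ↔
      a ∈ divSubgroup (ideleDiv α + D) := by
  rw [← mul_mem_divSubgroup_iff α, ← mul_assoc, Units.mul_inv, one_mul]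

theorem mul_mem_divSubgroup {D E : NonarchPlace K →₀ ℤ} {a b : NonarchAdeleRing K}
    (ha : a ∈ divSubgroup D) (hb : b ∈ divSubgroup E) : a * b ∈ divSubgroup (D + E) := by
  intro v
  rw [NonarchPlace.mem_ball, mul_apply, map_mul, Finsupp.add_apply, WithZero.exp_add]
  exact mul_le_mul' (v.mem_ball.1 (ha v)) (v.mem_ball.1 (hb v))

theorem coe_divSubgroup_zero : (divSubgroup (0 : NonarchPlace K →₀ ℤ) : Set (NonarchAdeleRing K)) =
    Set.range (RestrictedProduct.structureMap (fun v : NonarchPlace K ↦ v.Completion)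
      (fun v ↦ (v.integers : Set v.Completion)) Filter.cofinite) := by
  ext a
  constructor
  · intro h
    exact ⟨fun v ↦ ⟨a v, v.mem_ball.1 (h v)⟩, rfl⟩
  · rintro ⟨b, rfl⟩ v
    exact v.mem_ball.2 (b v).2

theorem mulLeft_preimage_divSubgroup (α : (NonarchAdeleRing K)ˣ) :
    (fun a ↦ ((α⁻¹ : (NonarchAdeleRing K)ˣ) : NonarchAdeleRing K) * a) ⁻¹'
      ((divSubgroup 0 : AddSubgroup (NonarchAdeleRing K)) : Set (NonarchAdeleRing K)) = divSubgroup (ideleDiv α) := by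
  ext a
  have := inv_mul_mem_divSubgroup_iff α 0 a
  rwa [add_zero] at this

theorem mulLeft_image_divSubgroup (α : (NonarchAdeleRing K)ˣ) :
    (fun a ↦ (α : NonarchAdeleRing K) * a) ''
      ((divSubgroup 0 : AddSubgroup (NonarchAdeleRing K)) : Set (NonarchAdeleRing K)) = divSubgroup (ideleDiv α) := by
  rw [← mulLeft_preimage_divSubgroup]
  ext a
  constructor
  · rintro ⟨b, hb, rfl⟩
    simpa using hb
  · intro h
    exact ⟨_, h, by simp⟩

theorem isOpen_divSubgroup (D : NonarchPlace K →₀ ℤ) :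
    IsOpen (divSubgroup D : Set (NonarchAdeleRing K)) := by
  obtain ⟨α, rfl⟩ := exists_ideleDiv_eq D
  rw [← mulLeft_preimage_divSubgroup]
  refine IsOpen.preimage (continuous_const_mul _) ?_
  rw [coe_divSubgroup_zero]
  exact (RestrictedProduct.isOpenEmbedding_structureMap
    (fun v : NonarchPlace K ↦ Valued.isOpen_valuationSubring _)).isOpen_range

theorem isCompact_divSubgroup [∀ v : NonarchPlace K, Finite v.ResidueField]
    (D : NonarchPlace K →₀ ℤ) : IsCompact (divSubgroup D : Set (NonarchAdeleRing K)) := by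
  obtain ⟨α, rfl⟩ := exists_ideleDiv_eq D
  rw [← mulLeft_image_divSubgroup]
  refine IsCompact.image ?_ (continuous_const_mul _)
  rw [coe_divSubgroup_zero]
  have := fun v : NonarchPlace K ↦ v.compactSpace_integers
  exact isCompact_range RestrictedProduct.isEmbedding_structureMap.continuous

/-- On ∏ O_v the topology is the product topology, so a neighbourhood of 0 constrains only finitely
many components; elsewhere the coefficient 0 is enough. -/
theorem exists_divSubgroup_subset {U : Set (NonarchAdeleRing K)} (hU : U ∈ nhds 0) :
    ∃ D : NonarchPlace K →₀ ℤ, D ≤ 0 ∧ (divSubgroup D : Set (NonarchAdeleRing K)) ⊆ U := by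
  classical
  let f : (∀ v : NonarchPlace K, v.integers) → NonarchAdeleRing K :=
    RestrictedProduct.structureMap (fun v : NonarchPlace K ↦ v.Completion)
      (fun v ↦ (v.integers : Set v.Completion)) Filter.cofinite
  have hf : Continuous f := RestrictedProduct.isEmbedding_structureMap.continuous
  have hU' : f ⁻¹' U ∈ nhds 0 := hf.continuousAt.preimage_mem_nhds hU
  rw [nhds_pi, Filter.mem_pi] at hU'
  obtain ⟨I, hI, t, ht, hsub⟩ := hU'
  have ht' : ∀ v : NonarchPlace K, ∃ n : ℤ, n ≤ 0 ∧
      ∀ x : v.integers, (x : v.Completion) ∈ v.ball n → x ∈ t v := by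
    intro v
    obtain ⟨s, hs, hst⟩ := mem_nhds_subtype _ _ _ |>.1 (ht v)
    obtain ⟨n, hn, hns⟩ := v.exists_ball_subset hs
    exact ⟨n, hn, fun x hx ↦ hst (hns hx)⟩
  choose n hn0 hn using ht'
  refine ⟨Finsupp.onFinset hI.toFinset (fun v ↦ if v ∈ I then n v else 0) ?_, ?_, ?_⟩
  · intro v hv
    rw [Set.Finite.mem_toFinset]
    by_contra h
    simp [h] at hv
  · intro v
    simp only [Finsupp.onFinset_apply, Finsupp.coe_zero, Pi.zero_apply]
    split_ifs
    · exact hn0 v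
    · rfl
  · intro a ha
    have hint : ∀ v, a v ∈ v.integers := by
      intro v
      have h1 := ha v
      rw [Finsupp.onFinset_apply] at h1
      refine v.mem_ball.1 (ball_mono v ?_ h1)
      split_ifs
      · exact hn0 v
      · rfl
    refine hsub (a := fun v ↦ ⟨a v, hint v⟩) fun v hv ↦ hn v _ ?_
    have h1 := ha v
    rw [Finsupp.onFinset_apply, if_pos hv] at h1
    exact h1

/-! ### Norms of divisors and indices -/

/-- The norm `∏ (#k_v) ^ (D v)` of a divisor. -/
def divNorm (D : NonarchPlace K →₀ ℤ) : ℝ := D.prod fun v n ↦ (Nat.card v.ResidueField : ℝ) ^ n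

theorem finprod_abs (α : (NonarchAdeleRing K)ˣ) :
    ∏ᶠ v : NonarchPlace K, v.abs ((α : NonarchAdeleRing K) v) = divNorm (ideleDiv α) := by
  have h : ∀ v : NonarchPlace K, v.abs ((α : NonarchAdeleRing K) v) =
      (Nat.card v.ResidueField : ℝ) ^ (ideleDiv α v) := fun v ↦ by
    rw [NonarchPlace.abs, if_neg (ideleComponent_ne_zero α v), valued_idele, WithZero.log_exp]
  simp_rw [h]
  rw [finprod_eq_prod_of_mulSupport_subset (s := (ideleDiv α).support)]
  · rfl
  · intro v hv
    simp only [Finset.mem_coe, Finsupp.mem_support_iff]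
    intro h0
    simp [h0] at hv

theorem divNorm_zero : divNorm (0 : NonarchPlace K →₀ ℤ) = 1 := Finsupp.prod_zero_index

/-- Only the component at v changes, so evaluation at v reduces the index to the local one. -/
theorem divSubgroup_relIndex_single (D : NonarchPlace K →₀ ℤ) (v : NonarchPlace K) :
    (divSubgroup D).relIndex (divSubgroup (D + Finsupp.single v 1)) = Nat.card v.ResidueField := by
  classical
  set E := D + Finsupp.single v 1
  have hEv : E v = D v + 1 := by simp [E]
  have h1 : divSubgroup D = (v.ball (D v)).comap (eval v) ⊓ divSubgroup E := by
    ext a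
    constructor
    · intro h
      exact ⟨h v, divSubgroup_mono (by simp [E]) h⟩
    · rintro ⟨h1, h2⟩ w
      rcases eq_or_ne w v with rfl | hw
      · exact h1
      · have := h2 w
        rwa [show E w = D w by simp [E, Finsupp.single_eq_of_ne hw]] at this
  have h2 : (divSubgroup E).map (eval v) = v.ball (D v + 1) := by
    ext x
    constructor
    · rintro ⟨a, ha, rfl⟩
      rw [← hEv]
      exact ha v
    · intro hx
      refine ⟨single v x, fun w ↦ ?_, single_same v x⟩
      rcases eq_or_ne w v with rfl | hw
      · rwa [single_same, hEv]
      · rw [single_of_ne hw]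
        exact zero_mem _
  rw [h1, AddSubgroup.inf_relIndex_right, AddSubgroup.relIndex_comap, h2, v.ball_relIndex]

section

variable [∀ v : NonarchPlace K, Finite v.ResidueField]

theorem natCard_residueField_pos (v : NonarchPlace K) : (0 : ℝ) < Nat.card v.ResidueField := by
  exact_mod_cast Nat.card_pos

theorem divNorm_pos (D : NonarchPlace K →₀ ℤ) : 0 < divNorm D :=
  Finset.prod_pos fun v _ ↦ zpow_pos (natCard_residueField_pos v) _

theorem divNorm_add (D E : NonarchPlace K →₀ ℤ) : divNorm (D + E) = divNorm D * divNorm E :=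
  Finsupp.prod_add_index' (fun _ ↦ zpow_zero _)
    fun v _ _ ↦ zpow_add₀ (natCard_residueField_pos v).ne' _ _

/-- The difference of the divisors has natural coefficients so that it can be built up by adding one
place at a time. -/
theorem divSubgroup_relIndex_add (D : NonarchPlace K →₀ ℤ) (E : NonarchPlace K →₀ ℕ) :
    ((divSubgroup D).relIndex (divSubgroup (D + E.mapRange Nat.cast Nat.cast_zero)) : ℝ) =
      divNorm (E.mapRange Nat.cast Nat.cast_zero) := by
  classical
  induction E using Finsupp.induction_linear generalizing D with
  | zero => simp [divNorm_zero]
  | add E F hE hF =>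
    rw [Finsupp.mapRange_add Nat.cast_add, ← add_assoc, divNorm_add, ← hE D, ← hF, ← Nat.cast_mul,
      AddSubgroup.relIndex_mul_relIndex]
    · exact divSubgroup_mono (le_add_of_nonneg_right fun v ↦ by simp)
    · exact divSubgroup_mono (le_add_of_nonneg_right fun v ↦ by simp)
  | single v n =>
    rw [Finsupp.mapRange_single]
    induction n generalizing D with
    | zero => simp [divNorm_zero]
    | succ n ih =>
      rw [Nat.cast_succ, Finsupp.single_add, ← add_assoc, divNorm_add, ← ih D,
        ← AddSubgroup.relIndex_mul_relIndex (divSubgroup D) _ _ (divSubgroup_mono (E := D + Finsupp.single v (n : ℤ)) ?_) (divSubgroup_mono ?_),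
        Nat.cast_mul, divSubgroup_relIndex_single]
      · simp [divNorm]
      · exact le_add_of_nonneg_right (Finsupp.single_nonneg.2 (by simp))
      · exact le_add_of_nonneg_right (Finsupp.single_nonneg.2 (by simp))

theorem divSubgroup_relIndex {D E : NonarchPlace K →₀ ℤ} (h : D ≤ E) :
    ((divSubgroup D).relIndex (divSubgroup E) : ℝ) * divNorm D = divNorm E := by
  have h1 : E = D + ((E - D).mapRange Int.toNat rfl).mapRange Nat.cast Nat.cast_zero := by
    ext v
    have := h v
    simp only [Finsupp.add_apply, Finsupp.mapRange_apply, Finsupp.sub_apply]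
    omega
  rw [h1, divSubgroup_relIndex_add, divNorm_add, mul_comm]

end

end GlobalField

/-! ### Gaussian integrals at the archimedean places -/

namespace GlobalField

open NumberField NumberField.InfinitePlace
open scoped RealInnerProductSpace

variable {K : Type*} [Field K]

/-- The local trace pairing `x ↦ e_v Re x` at an archimedean place, `x` being viewed in `ℂ`. -/
def archTrace (v : InfinitePlace K) (x : v.Completion) : ℝ :=
  v.mult * (Completion.extensionEmbedding v x).re

theorem archFactor_eq (v : InfinitePlace K) (x : v.Completion) :
    archFactor v x = Real.exp (-(v.mult * Real.pi) * ‖x‖ ^ 2) := by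
  have hm : (v.mult : ℝ) ≠ 0 := by exact_mod_cast v.mult_ne_zero
  rw [archFactor, archAbs, ← Real.rpow_natCast, ← Real.rpow_mul (norm_nonneg x),
    mul_div_cancel₀ _ hm, Real.rpow_ofNat, neg_mul]

theorem continuous_archFactor (v : InfinitePlace K) : Continuous (archFactor v) := by
  simp_rw [funext (archFactor_eq v)]
  fun_prop

/-- The properties of a Haar measure on an archimedean completion that are used below. -/
structure IsGaussianMeasure (v : InfinitePlace K) [MeasurableSpace v.Completion]
    (l : Measure v.Completion) (c : ℝ) : Prop where
  haar : l.IsAddHaarMeasure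
  sigmaFinite : SigmaFinite l
  pos : 0 < c
  integrable : Integrable (archFactor v) l
  integral_scale : ∀ a : v.Completion, a ≠ 0 → ∫ x, archFactor v (a⁻¹ * x) ∂l = archAbs v a * c
  fourier : ∀ z : v.Completion, ∫ x, (archFactor v x : ℂ) *
    Complex.exp ((-(2 * Real.pi * archTrace v (x * z)) : ℝ) * Complex.I) ∂l = c * archFactor v z

/-- Real and complex places are treated together as Euclidean spaces of dimension `v.mult`. With b =
`v.mult` * π the Gaussian is exp(-b‖x‖²) and the trace character is exp(-2ib⟨w, x⟩), so the Gaussian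
is its own transform up to the constant c. -/
theorem exists_isGaussianMeasure_of_isometry (v : InfinitePlace K) [MeasurableSpace v.Completion]
    [BorelSpace v.Completion] {V : Type*} [NormedAddCommGroup V] [InnerProductSpace ℝ V]
    [FiniteDimensional ℝ V] [MeasurableSpace V] [BorelSpace V] (e : v.Completion ≃ᵢ V)
    (he : ∀ x y, e (x + y) = e x + e y) (hV : Module.finrank ℝ V = v.mult)
    (hp : ∀ z : v.Completion, ∃ w : V, ‖w‖ = ‖z‖ ∧
      ∀ x : v.Completion, (Completion.extensionEmbedding v (x * z)).re = ⟪w, e x⟫) :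
    ∃ (l : Measure v.Completion) (c : ℝ), IsGaussianMeasure v l c := by
  have he0 : e 0 = 0 := by simpa using he 0 0
  have hnorm : ∀ x, ‖e x‖ = ‖x‖ := fun x ↦ by
    rw [← dist_zero_right, ← he0, e.dist_eq, dist_zero_right]
  let E : v.Completion ≃+ V := { e.toEquiv with map_add' := he }
  have hm : (0 : ℝ) < v.mult := by exact_mod_cast v.mult_pos
  set b : ℝ := v.mult * Real.pi with hb
  have hb0 : 0 < b := mul_pos hm Real.pi_pos
  let g : V → ℝ := fun x ↦ Real.exp (-b * ‖x‖ ^ 2)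
  have hg : ∀ x, archFactor v x = g (e x) := fun x ↦ by rw [archFactor_eq]; simp only [g, hnorm, hb]
  have hgi : Integrable g := by
    have h1 := GaussianFourier.integrable_cexp_neg_mul_sq_norm_add (V := V) (b := b) (by simpa) 0 0
    have h2 := h1.norm
    refine h2.congr (Filter.Eventually.of_forall fun x ↦ ?_)
    simp only [Complex.norm_exp, g]
    congr 1
    simp [← Complex.ofReal_pow]
  let M : V ≃ᵐ v.Completion := e.symm.toHomeomorph.toMeasurableEquiv
  have hM : ∀ x, e (M x) = x := fun x ↦ e.apply_symm_apply x
  have hint : ∀ {F : Type _} [NormedAddCommGroup F] [NormedSpace ℝ F] (f : v.Completion → F),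
      ∫ x, f x ∂(volume.map M) = ∫ y : V, f (M y) := fun f ↦ integral_map_equiv M f
  refine ⟨volume.map M, ∫ y, g y, ?_, ?_, ?_, ?_, ?_, ?_⟩
  · exact AddEquiv.isAddHaarMeasure_map volume E.symm e.symm.continuous e.continuous
  · exact M.sigmaFinite_map
  · refine (integral_pos_iff_support_of_nonneg (fun _ ↦ (Real.exp_pos _).le) hgi).2 ?_
    rw [Function.support_eq_univ fun _ ↦ (Real.exp_pos _).ne']
    exact Measure.measure_univ_pos.2 (NeZero.ne _)
  · rw [integrable_map_equiv]
    refine hgi.congr (Filter.Eventually.of_forall fun x ↦ ?_)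
    simp [hg, hM]
  · intro a ha
    rw [hint]
    have ha' : (0 : ℝ) < ‖a‖ := norm_pos_iff.2 ha
    have h1 : ∀ y : V, archFactor v (a⁻¹ * M y) = g (‖a‖⁻¹ • y) := fun y ↦ by
      rw [archFactor_eq]
      simp only [g, hb]
      rw [norm_mul, norm_inv, norm_smul, norm_inv, norm_norm, ← hnorm (M y), hM]
    simp_rw [h1]
    rw [Measure.integral_comp_inv_smul_of_nonneg volume g ha'.le, hV, smul_eq_mul]
    rfl
  · intro z
    obtain ⟨w, hw, hwx⟩ := hp z
    rw [hint]
    have h1 : ∀ y : V, (archFactor v (M y) : ℂ) *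
        Complex.exp ((-(2 * Real.pi * archTrace v (M y * z)) : ℝ) * Complex.I) =
        Complex.exp (-(b : ℂ) * ‖y‖ ^ 2 + (-(2 * b) * Complex.I) * ⟪w, y⟫) := fun y ↦ by
      rw [hg, hM, archTrace, hwx, hM, Complex.ofReal_exp, ← Complex.exp_add]
      congr 1
      push_cast [hb]
      ring
    have h2 : ∀ c : ℂ, ∀ w : V, ∫ y : V, Complex.exp (-(b : ℂ) * ‖y‖ ^ 2 + c * ⟪w, y⟫) =
        (Real.pi / b) ^ (Module.finrank ℝ V / 2 : ℂ) * Complex.exp (c ^ 2 * ‖w‖ ^ 2 / (4 * b)) :=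
      fun c w ↦ GaussianFourier.integral_cexp_neg_mul_sq_norm_add (by simpa) c w
    have h3 : ((∫ y, g y : ℝ) : ℂ) = (Real.pi / b) ^ (Module.finrank ℝ V / 2 : ℂ) := by
      rw [← integral_complex_ofReal]
      have := h2 0 0
      simp only [zero_mul, add_zero, norm_zero, ne_eq, OfNat.ofNat_ne_zero, not_false_eq_true, zero_pow, zero_div, Complex.exp_zero,
        mul_one] at this
      rw [← this]
      congr 1
      ext y
      simp [g]
    simp_rw [h1]
    rw [h2, h3, archFactor_eq, hw]
    congr 1
    rw [Complex.ofReal_exp]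
    congr 1
    have hbC : (b : ℂ) ≠ 0 := by exact_mod_cast hb0.ne'
    rw [← hb]
    push_cast
    field_simp
    rw [Complex.I_sq]
    ring

/-- The vector w representing x ↦ Re(xz) is z itself at a real place and the conjugate of z at a
complex one. -/
theorem exists_isGaussianMeasure (v : InfinitePlace K) [MeasurableSpace v.Completion]
    [BorelSpace v.Completion] :
    ∃ (l : Measure v.Completion) (c : ℝ), IsGaussianMeasure v l c := by
  by_cases hv : v.IsReal
  · refine exists_isGaussianMeasure_of_isometry v (Completion.isometryEquivRealOfIsReal hv)
      (map_add (Completion.ringEquivRealOfIsReal hv)) (by simp [mult, hv]) fun z ↦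
      ⟨Completion.ringEquivRealOfIsReal hv z, ?_, fun x ↦ ?_⟩
    · have := (Completion.isometry_extensionEmbeddingOfIsReal hv).norm_map_of_map_zero (map_zero _) z
      exact this
    · rw [← Completion.extensionEmbeddingOfIsReal_apply hv, Complex.ofReal_re, map_mul]
      rfl
  · have hv' := not_isReal_iff_isComplex.1 hv
    refine exists_isGaussianMeasure_of_isometry v (Completion.isometryEquivComplexOfIsComplex hv')
      (map_add (Completion.ringEquivComplexOfIsComplex hv')) (by simp [mult, hv]) fun z ↦
      ⟨(starRingEnd ℂ) (Completion.extensionEmbedding v z), ?_, fun x ↦ ?_⟩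
    · rw [RCLike.norm_conj]
      exact (Completion.isometry_extensionEmbedding v).norm_map_of_map_zero (map_zero _) z
    · have : Completion.isometryEquivComplexOfIsComplex hv' x = Completion.extensionEmbedding v x := rfl
      rw [this, Complex.inner, map_mul, Complex.conj_conj, mul_comm]

theorem secondCountableTopology_completion (v : InfinitePlace K) :
    SecondCountableTopology v.Completion :=
  (Completion.isometry_extensionEmbedding v).isEmbedding.secondCountableTopology

/-! ### The Gaussian on the product of the archimedean completions -/

/-- The archimedean part of `f_1`. -/
def gaussian (x : InfiniteAdeleRing K) : ℝ := ∏ᶠ v : InfinitePlace K, archFactor v (x v)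

/-- The trace form on the product of the archimedean completions. -/
def infTrace (x : InfiniteAdeleRing K) : ℝ := ∑ᶠ v : InfinitePlace K, archTrace v (x v)

/-- The Borel structure on the archimedean adeles. -/
instance : MeasurableSpace (InfiniteAdeleRing K) := borel _

instance : BorelSpace (InfiniteAdeleRing K) := ⟨rfl⟩

theorem continuous_gaussian [Finite (InfinitePlace K)] :
    Continuous (gaussian : InfiniteAdeleRing K → ℝ) := by
  have := Fintype.ofFinite (InfinitePlace K)
  unfold gaussian
  simp_rw [finprod_eq_prod_of_fintype]
  exact continuous_finsetProd _ fun v _ ↦ (continuous_archFactor v).comp (continuous_apply v)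

theorem gaussian_zero : gaussian (0 : InfiniteAdeleRing K) = 1 := by
  unfold gaussian
  have : ∀ v : InfinitePlace K, archFactor v ((0 : InfiniteAdeleRing K) v) = 1 := fun v ↦ by
    rw [archFactor_eq]
    have : ((0 : InfiniteAdeleRing K) v) = 0 := rfl
    simp [this]
  simp [this]

/-- Any Haar measure is a positive multiple k of the product of the local measures. The Gaussian,
the norm and the character factor over the places, so C is k times the product of the local
constants, and the same C serves for scaling and for the transform. -/
theorem exists_gaussian_integral [Finite (InfinitePlace K)]
    (ν : Measure (InfiniteAdeleRing K)) [ν.IsAddHaarMeasure] :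
    ∃ C : ℝ, 0 < C ∧ Integrable gaussian ν ∧
      (∀ a : (InfiniteAdeleRing K)ˣ, ∫ x, gaussian (((a⁻¹ : (InfiniteAdeleRing K)ˣ) : InfiniteAdeleRing K) * x) ∂ν =
        (∏ᶠ v : InfinitePlace K, archAbs v ((a : InfiniteAdeleRing K) v)) * C) ∧
      ∀ z : InfiniteAdeleRing K, ∫ x, (gaussian x : ℂ) *
        Complex.exp ((-(2 * Real.pi * infTrace (x * z)) : ℝ) * Complex.I) ∂ν = C * gaussian z := by
  have := Fintype.ofFinite (InfinitePlace K)
  let _ : ∀ v : InfinitePlace K, MeasurableSpace v.Completion := fun v ↦ borel _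
  have _ : ∀ v : InfinitePlace K, BorelSpace v.Completion := fun v ↦ ⟨rfl⟩
  have _ := secondCountableTopology_completion (K := K)
  choose l c h using fun v : InfinitePlace K ↦ exists_isGaussianMeasure v
  have _ := fun v ↦ (h v).haar
  have _ := fun v ↦ (h v).sigmaFinite
  have hlc : LocallyCompactSpace (∀ v : InfinitePlace K, v.Completion) := Pi.locallyCompactSpace_of_finite
  let ι : InfiniteAdeleRing K ≃+ (∀ v : InfinitePlace K, v.Completion) := AddEquiv.refl _
  have hι : Continuous ι := continuous_id
  have hι' : Continuous ι.symm := continuous_id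
  let M : InfiniteAdeleRing K ≃ᵐ (∀ v : InfinitePlace K, v.Completion) :=
    (Homeomorph.mk ι.toEquiv hι hι').toMeasurableEquiv
  have hν : (ν.map M).IsAddHaarMeasure := AddEquiv.isAddHaarMeasure_map ν ι hι hι'
  have heq := Measure.isAddLeftInvariant_eq_smul (ν.map M) (Measure.pi l)
  set k := Measure.addHaarScalarFactor (ν.map M) (Measure.pi l)
  have hk : 0 < k := Measure.addHaarScalarFactor_pos_of_isAddHaarMeasure _ _
  have hint : ∀ {F : Type _} [NormedAddCommGroup F] [NormedSpace ℝ F] (f : (∀ v : InfinitePlace K, v.Completion) → F),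
      ∫ x, f (M x) ∂ν = (k : ℝ) • ∫ y, f y ∂(Measure.pi l) := fun f ↦ by
    rw [← integral_map_equiv M f, heq, integral_smul_nnreal_measure]
    rfl
  refine ⟨k * ∏ v, c v, mul_pos hk (Finset.prod_pos fun v _ ↦ (h v).pos), ?_, ?_, ?_⟩
  · have h1 : Integrable (fun y : ∀ v : InfinitePlace K, v.Completion ↦ ∏ v, archFactor v (y v)) (Measure.pi l) :=
      Integrable.fintype_prod_dep fun v ↦ (h v).integrable
    have h2 := h1.smul_measure_nnreal (c := k)
    rw [← heq, integrable_map_equiv] at h2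
    refine h2.congr (Filter.Eventually.of_forall fun x ↦ ?_)
    exact (finprod_eq_prod_of_fintype _).symm
  · intro a
    have ha : ∀ v, (a : InfiniteAdeleRing K) v ≠ 0 := fun v h0 ↦ by
      have h1 := congrFun a.mul_inv v
      have h2 : (a : InfiniteAdeleRing K) v * ((a⁻¹ : (InfiniteAdeleRing K)ˣ) : InfiniteAdeleRing K) v = 1 := h1
      rw [h0, zero_mul] at h2
      exact zero_ne_one h2
    have ha' : ∀ v, ((a⁻¹ : (InfiniteAdeleRing K)ˣ) : InfiniteAdeleRing K) v = ((a : InfiniteAdeleRing K) v)⁻¹ := fun v ↦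
      eq_inv_of_mul_eq_one_right (congrFun a.mul_inv v)
    rw [finprod_eq_prod_of_fintype]
    have h1 := hint (fun y ↦ ∏ v, archFactor v (((a : InfiniteAdeleRing K) v)⁻¹ * y v))
    rw [integral_fintype_prod_eq_prod (f := fun v y ↦ archFactor v (((a : InfiniteAdeleRing K) v)⁻¹ * y)),
      Finset.prod_congr rfl fun v _ ↦ (h v).integral_scale _ (ha v), Finset.prod_mul_distrib] at h1
    rw [mul_left_comm, ← smul_eq_mul (k : ℝ), ← h1]
    congr 1
    ext x
    rw [gaussian, finprod_eq_prod_of_fintype]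
    refine Finset.prod_congr rfl fun v _ ↦ ?_
    rw [← ha']
    rfl
  · intro z
    let w : ∀ v : InfinitePlace K, v.Completion := z
    have h1 := hint (fun y ↦ ∏ v : InfinitePlace K, ((archFactor v (y v) : ℂ) *
      Complex.exp ((-(2 * Real.pi * archTrace v (y v * w v)) : ℝ) * Complex.I)))
    rw [integral_fintype_prod_eq_prod (f := fun v y ↦ ((archFactor v y : ℂ) *
      Complex.exp ((-(2 * Real.pi * archTrace v (y * w v)) : ℝ) * Complex.I))),
      Finset.prod_congr rfl fun v _ ↦ (h v).fourier (w v), Finset.prod_mul_distrib] at h1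
    rw [gaussian, finprod_eq_prod_of_fintype]
    rw [Complex.ofReal_mul, Complex.ofReal_prod, Complex.ofReal_prod, mul_assoc,
      ← Complex.real_smul (x := (k : ℝ)), ← h1]
    congr 1
    ext x
    have hs : ∑ v, -(2 * Real.pi * archTrace v (M x v * w v)) =
        -(2 * Real.pi * infTrace (x * z)) := by
      rw [infTrace, finsum_eq_sum_of_fintype, Finset.sum_neg_distrib, ← Finset.mul_sum]
      rfl
    rw [gaussian, finprod_eq_prod_of_fintype, Finset.prod_mul_distrib, ← Complex.exp_sum,
      ← Finset.sum_mul, ← Complex.ofReal_sum, hs, Complex.ofReal_prod]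
    rfl

end GlobalField

/-! ### Reduction of adelic integrals to the archimedean adeles -/

namespace GlobalField

open NumberField NonarchAdeleRing
open scoped Pointwise

/-- The larger group is a finite disjoint union of translates of the smaller one. -/
theorem relIndex_mul_measure {G : Type*} [AddCommGroup G] [MeasurableSpace G] [MeasurableAdd G]
    (ρ : Measure G) [ρ.IsAddLeftInvariant] {H H' : AddSubgroup G} (hle : H ≤ H')
    (hfin : H.relIndex H' ≠ 0) (hH : MeasurableSet (H : Set G)) :
    H.relIndex H' * ρ H = ρ H' := by
  have hfi : (H.addSubgroupOf H').FiniteIndex := ⟨hfin⟩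
  have : Finite (H' ⧸ H.addSubgroupOf H') := inferInstance
  let r : H' ⧸ H.addSubgroupOf H' → G := fun q ↦ (q.out : H')
  have hU : (H' : Set G) = ⋃ q, r q +ᵥ (H : Set G) := by
    ext x
    simp only [SetLike.mem_coe, Set.mem_iUnion, Set.mem_vadd_set_iff_neg_vadd_mem, vadd_eq_add]
    constructor
    · intro hx
      refine ⟨QuotientAddGroup.mk ⟨x, hx⟩, ?_⟩
      have := QuotientAddGroup.eq.1 (QuotientAddGroup.out_eq' (QuotientAddGroup.mk (s := H.addSubgroupOf H') ⟨x, hx⟩))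
      exact this
    · rintro ⟨q, hq⟩
      have := add_mem (q.out : H').2 (hle hq)
      rwa [add_neg_cancel_left] at this
  rw [hU, measure_iUnion]
  · simp [measure_vadd, ENat.card_eq_coe_natCard, AddSubgroup.relIndex, AddSubgroup.index]
  · intro p q hpq
    rw [Function.onFun, Set.disjoint_left]
    intro x hx hy
    simp only [Set.mem_vadd_set_iff_neg_vadd_mem, vadd_eq_add, SetLike.mem_coe] at hx hy
    refine hpq ?_
    rw [← QuotientAddGroup.out_eq' p, ← QuotientAddGroup.out_eq' q, QuotientAddGroup.eq]
    change -(r p) + r q ∈ H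
    have := sub_mem hx hy
    rwa [show -r p + x - (-r q + x) = -r p + r q by abel] at this
  · exact fun q ↦ hH.const_vadd _

variable {K : Type*} [Field K]

instance : T2Space (InfiniteAdeleRing K) :=
  inferInstanceAs (T2Space (∀ v : InfinitePlace K, v.Completion))

/-- The Borel structure on the nonarchimedean adeles. -/
instance : MeasurableSpace (NonarchAdeleRing K) := borel _

instance : BorelSpace (NonarchAdeleRing K) := ⟨rfl⟩

/-- The strip of adeles with nonarchimedean part bounded by `D`. -/
def strip (D : NonarchPlace K →₀ ℤ) : Set (AdeleRing K) :=
  Prod.snd ⁻¹' (divSubgroup D : Set (NonarchAdeleRing K))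

theorem mem_strip {D : NonarchPlace K →₀ ℤ} {u : AdeleRing K} :
    u ∈ strip D ↔ u.2 ∈ divSubgroup D := Iff.rfl

section

variable [MeasurableSpace (AdeleRing K)] [BorelSpace (AdeleRing K)]

theorem measurable_fst_adele : Measurable (Prod.fst : AdeleRing K → InfiniteAdeleRing K) :=
  continuous_fst.measurable

theorem measurable_snd_adele : Measurable (Prod.snd : AdeleRing K → NonarchAdeleRing K) :=
  continuous_snd.measurable

theorem measurableSet_strip (D : NonarchPlace K →₀ ℤ) : MeasurableSet (strip D) :=
  ((isOpen_divSubgroup D).preimage continuous_snd).measurableSet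

/-- The measure on the archimedean adeles induced by a measure on the adeles and a divisor. -/
def archMeasure (μ : Measure (AdeleRing K)) (D : NonarchPlace K →₀ ℤ) :
    Measure (InfiniteAdeleRing K) := (μ.restrict (strip D)).map Prod.fst

theorem archMeasure_apply (μ : Measure (AdeleRing K)) (D : NonarchPlace K →₀ ℤ)
    {B : Set (InfiniteAdeleRing K)} (hB : MeasurableSet B) :
    archMeasure μ D B = μ (Prod.fst ⁻¹' B ∩ strip D) := by
  rw [archMeasure, Measure.map_apply measurable_fst_adele hB,
    Measure.restrict_apply (measurable_fst_adele hB)]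

theorem integral_strip (μ : Measure (AdeleRing K)) {E : Type*} [NormedAddCommGroup E] [NormedSpace ℝ E] (D : NonarchPlace K →₀ ℤ)
    {g : InfiniteAdeleRing K → E} (hg : AEStronglyMeasurable g (archMeasure μ D)) :
    ∫ u, (strip D).indicator (fun u ↦ g u.1) u ∂μ = ∫ x, g x ∂(archMeasure μ D) := by
  rw [integral_indicator (measurableSet_strip D), archMeasure,
    integral_map measurable_fst_adele.aemeasurable hg]

variable (μ : Measure (AdeleRing K)) [μ.IsAddHaarMeasure]

/-- Compact sets stay finite because the ball of D is compact, open sets stay positive because it is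
open, and invariance is translation by (r, 0). -/
instance [∀ v : NonarchPlace K, Finite v.ResidueField] (D : NonarchPlace K →₀ ℤ) :
    (archMeasure μ D).IsAddHaarMeasure where
  lt_top_of_isCompact C hC := by
    rw [archMeasure_apply μ D hC.measurableSet]
    exact (hC.prod (isCompact_divSubgroup D)).measure_lt_top
  map_add_left_eq_self r := by
    ext B hB
    have hm : Measurable fun x ↦ r + x := (continuous_const_add r).measurable
    rw [Measure.map_apply hm hB, archMeasure_apply μ D (hm hB), archMeasure_apply μ D hB,
      ← measure_preimage_add μ (r, 0) (Prod.fst ⁻¹' B ∩ strip D)]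
    congr 1
    ext u
    simp [strip]
  open_pos U hU hne := by
    rw [archMeasure_apply μ D hU.measurableSet]
    exact ((hU.prod (isOpen_divSubgroup D)).measure_pos μ
      (hne.prod ⟨0, zero_mem _⟩)).ne'

/-- For a fixed archimedean set B the measure of B × S is translation invariant in S, so the coset
count applies to it. -/
theorem archMeasure_relIndex {D E : NonarchPlace K →₀ ℤ} (h : D ≤ E)
    (hfin : (divSubgroup D).relIndex (divSubgroup E) ≠ 0) :
    archMeasure μ E = (divSubgroup D).relIndex (divSubgroup E) • archMeasure μ D := by
  ext B hB
  let ρ : Measure (NonarchAdeleRing K) := (μ.restrict (Prod.fst ⁻¹' B)).map Prod.snd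
  have hρ : ∀ S : Set (NonarchAdeleRing K), MeasurableSet S → ρ S = μ (Prod.fst ⁻¹' B ∩ Prod.snd ⁻¹' S) := by
    intro S hS
    rw [Measure.map_apply measurable_snd_adele hS, Measure.restrict_apply (measurable_snd_adele hS),
      Set.inter_comm]
  have : ρ.IsAddLeftInvariant := by
    refine ⟨fun r ↦ ?_⟩
    ext S hS
    have hm : Measurable fun x ↦ r + x := (continuous_const_add r).measurable
    rw [Measure.map_apply hm hS, hρ _ (hm hS), hρ S hS,
      ← measure_preimage_add μ (0, r) (Prod.fst ⁻¹' B ∩ Prod.snd ⁻¹' S)]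
    congr 1
    ext u
    simp
  have h1 := relIndex_mul_measure ρ (divSubgroup_mono h) hfin (isOpen_divSubgroup D).measurableSet
  rw [hρ _ (isOpen_divSubgroup D).measurableSet, hρ _ (isOpen_divSubgroup E).measurableSet] at h1
  rw [archMeasure_apply μ E hB, Measure.smul_apply, archMeasure_apply μ D hB, nsmul_eq_mul]
  exact h1.symm

theorem integral_archMeasure [∀ v : NonarchPlace K, Finite v.ResidueField]
    (D : NonarchPlace K →₀ ℤ) (g : InfiniteAdeleRing K → ℝ) :
    ∫ x, g x ∂(archMeasure μ D) = divNorm D * ∫ x, g x ∂(archMeasure μ 0) := by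
  -- D and 0 need not be comparable; both are compared with D ⊓ 0.
  have key : ∀ E, D ⊓ 0 ≤ E → (∫ x, g x ∂(archMeasure μ E)) * divNorm (D ⊓ 0) =
      divNorm E * ∫ x, g x ∂(archMeasure μ (D ⊓ 0)) := by
    intro E hE
    have h1 := divSubgroup_relIndex hE
    have h0 : (divSubgroup (D ⊓ 0)).relIndex (divSubgroup E) ≠ 0 := by
      intro h0
      rw [h0, Nat.cast_zero, zero_mul] at h1
      exact (divNorm_pos E).ne h1
    rw [archMeasure_relIndex μ hE h0, ← Nat.cast_smul_eq_nsmul NNReal, integral_smul_nnreal_measure,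
      ← h1, NNReal.smul_def, smul_eq_mul, NNReal.coe_natCast]
    ring
  have h1 := key D inf_le_left
  have h2 := key 0 inf_le_right
  rw [divNorm_zero, one_mul] at h2
  have h3 := divNorm_pos (D ⊓ 0)
  rw [← h2] at h1
  have : (∫ x, g x ∂(archMeasure μ D) - divNorm D * ∫ x, g x ∂(archMeasure μ 0)) * divNorm (D ⊓ 0) = 0 := by
    linear_combination h1
  rcases mul_eq_zero.1 this with h | h
  · linarith
  · exact absurd h h3.ne'

end

/-! ### The functions `f_α` -/

/-- The archimedean part of an idele. -/
def archPart (α : (AdeleRing K)ˣ) : (InfiniteAdeleRing K)ˣ :=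
  Units.map (RingHom.fst (InfiniteAdeleRing K) (NonarchAdeleRing K)).toMonoidHom α

/-- The nonarchimedean part of an idele. -/
def nonarchPart (α : (AdeleRing K)ˣ) : (NonarchAdeleRing K)ˣ :=
  Units.map (RingHom.snd (InfiniteAdeleRing K) (NonarchAdeleRing K)).toMonoidHom α

/-- The archimedean part of the idele norm. -/
def archNorm (a : (InfiniteAdeleRing K)ˣ) : ℝ :=
  ∏ᶠ v : InfinitePlace K, archAbs v ((a : InfiniteAdeleRing K) v)

theorem ideleNorm_eq (α : (AdeleRing K)ˣ) :
    ideleNorm α = archNorm (archPart α) * divNorm (ideleDiv (nonarchPart α)) := by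
  rw [ideleNorm, ← finprod_abs]
  rfl

theorem finprod_nonarchFactor (a : NonarchAdeleRing K) :
    ∏ᶠ v : NonarchPlace K, nonarchFactor v (a v) = ((divSubgroup 0 : AddSubgroup (NonarchAdeleRing K)) : Set (NonarchAdeleRing K)).indicator 1 a := by
  by_cases ha : a ∈ divSubgroup (0 : NonarchPlace K →₀ ℤ)
  · rw [Set.indicator_of_mem (SetLike.mem_coe.2 ha), Pi.one_apply]
    refine finprod_eq_one_of_forall_eq_one fun v ↦ ?_
    have h : a v ∈ (v.integers : Set v.Completion) := v.mem_ball.1 (ha v)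
    rw [nonarchFactor, Set.indicator_of_mem h, Pi.one_apply]
  · rw [Set.indicator_of_notMem (mt SetLike.mem_coe.1 ha)]
    have : ∃ v, a v ∉ v.integers := by
      by_contra! h
      exact ha fun v ↦ v.mem_ball.2 (h v)
    obtain ⟨v, hv⟩ := this
    -- A zero factor kills a `finprod` only if finitely many factors differ from 1; here almost all
    -- components are integral.
    refine finprod_eq_zero _ v (Set.indicator_of_notMem hv _) ?_
    refine Set.Finite.subset (Filter.eventually_cofinite.1 (eventually_mem a)) fun w hw hw' ↦ ?_
    exact hw (Set.indicator_of_mem hw' _)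

/-- In this form an integral of f_α becomes an integral over the archimedean adeles alone. -/
theorem adelicFun_eq (α : (AdeleRing K)ˣ) :
    adelicFun α = (strip (ideleDiv (nonarchPart α))).indicator fun u ↦
      gaussian ((((archPart α)⁻¹ : (InfiniteAdeleRing K)ˣ) : InfiniteAdeleRing K) * u.1) := by
  ext u
  have h1 : adelicFun α u = gaussian ((((archPart α)⁻¹ : (InfiniteAdeleRing K)ˣ) : InfiniteAdeleRing K) * u.1) *
      ((divSubgroup 0 : AddSubgroup (NonarchAdeleRing K)) : Set (NonarchAdeleRing K)).indicator 1
        ((((nonarchPart α)⁻¹ : (NonarchAdeleRing K)ˣ) : NonarchAdeleRing K) * u.2) := by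
    rw [← finprod_nonarchFactor]
    rfl
  have h2 := inv_mul_mem_divSubgroup_iff (nonarchPart α) 0 u.2
  rw [add_zero] at h2
  rw [h1]
  by_cases hu : u ∈ strip (ideleDiv (nonarchPart α))
  · rw [Set.indicator_of_mem hu, Set.indicator_of_mem (h2.2 hu)]
    simp
  · rw [Set.indicator_of_notMem hu, Set.indicator_of_notMem (mt h2.1 hu), mul_zero]

theorem archPart_one : archPart (1 : (AdeleRing K)ˣ) = 1 := rfl

theorem ideleDiv_nonarchPart_one : ideleDiv (nonarchPart (1 : (AdeleRing K)ˣ)) = 0 := by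
  ext v
  change WithZero.log (Valued.v (1 : v.Completion)) = 0
  rw [map_one, WithZero.log_one]

theorem adelicFun_one :
    adelicFun (1 : (AdeleRing K)ˣ) = (strip 0).indicator fun u ↦ gaussian u.1 := by
  rw [adelicFun_eq, ideleDiv_nonarchPart_one, archPart_one]
  simp

theorem adelicFun_zero (α : (AdeleRing K)ˣ) : adelicFun α 0 = 1 := by
  have : (0 : AdeleRing K) ∈ strip (ideleDiv (nonarchPart α)) := mem_strip.2 (zero_mem _)
  rw [adelicFun_eq, Set.indicator_of_mem this]
  have h : (((archPart α)⁻¹ : (InfiniteAdeleRing K)ˣ) : InfiniteAdeleRing K) * (0 : AdeleRing K).1 = 0 := mul_zero _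
  rw [h, gaussian_zero]

/-- The strip is both open and closed, so its indicator does no harm. -/
theorem continuous_adelicFun [Finite (InfinitePlace K)] (α : (AdeleRing K)ˣ) : Continuous (adelicFun α) := by
  rw [adelicFun_eq]
  refine IsClopen.continuous_indicator ?_ (continuous_gaussian.comp (continuous_const.mul continuous_fst))
  exact ⟨((divSubgroup _).isClosed_of_isOpen (isOpen_divSubgroup _)).preimage continuous_snd,
    (isOpen_divSubgroup _).preimage continuous_snd⟩

theorem archComponent_ne_zero (a : (InfiniteAdeleRing K)ˣ) (v : InfinitePlace K) :
    (a : InfiniteAdeleRing K) v ≠ 0 := by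
  intro h0
  have h : (a : InfiniteAdeleRing K) v * ((a⁻¹ : (InfiniteAdeleRing K)ˣ) : InfiniteAdeleRing K) v = 1 :=
    congrFun a.mul_inv v
  rw [h0, zero_mul] at h
  exact zero_ne_one h

theorem archNorm_pos [Finite (InfinitePlace K)] (a : (InfiniteAdeleRing K)ˣ) : 0 < archNorm a := by
  have := Fintype.ofFinite (InfinitePlace K)
  rw [archNorm, finprod_eq_prod_of_fintype]
  exact Finset.prod_pos fun v _ ↦ pow_pos (norm_pos_iff.2 (archComponent_ne_zero a v)) _

theorem ideleNorm_pos [∀ v : NonarchPlace K, Finite v.ResidueField] [Finite (InfinitePlace K)]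
    (α : (AdeleRing K)ˣ) : 0 < ideleNorm α := by
  rw [ideleNorm_eq]
  exact mul_pos (archNorm_pos _) (divNorm_pos _)

theorem continuous_infTrace [Finite (InfinitePlace K)] :
    Continuous (infTrace : InfiniteAdeleRing K → ℝ) := by
  have := Fintype.ofFinite (InfinitePlace K)
  have h : (infTrace : InfiniteAdeleRing K → ℝ) = fun x ↦ ∑ v, archTrace v (x v) :=
    funext fun x ↦ finsum_eq_sum_of_fintype _
  rw [h]
  exact continuous_finsetSum _ fun v _ ↦ (continuous_const.mul (Complex.continuous_re.comp
    (InfinitePlace.Completion.isometry_extensionEmbedding v).continuous)).comp (continuous_apply v)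

theorem infTrace_neg (x : InfiniteAdeleRing K) : infTrace (-x) = -infTrace x := by
  rw [infTrace, infTrace, ← finsum_neg_distrib]
  refine finsum_congr fun v ↦ ?_
  change archTrace v (-x v) = _
  simp [archTrace]

/-! ### The transform of f_1 and the use of self-duality -/

section Main

variable [∀ v : NonarchPlace K, Finite v.ResidueField] [Finite (InfinitePlace K)]
  [MeasurableSpace (AdeleRing K)] [BorelSpace (AdeleRing K)]

/-- Changing the ball contributes `divNorm`, dilating the Gaussian contributes the archimedean norm.
That the constant C of the integrals is also the constant of the Gaussian transform is what
self-duality will exploit. -/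
theorem exists_adelic_integrals (μ : Measure (AdeleRing K)) [μ.IsAddHaarMeasure] :
    ∃ C : ℝ, 0 < C ∧ (∀ α : (AdeleRing K)ˣ, Integrable (adelicFun α) μ ∧
      ∫ u, adelicFun α u ∂μ = ideleNorm α * C) ∧
      ∀ z : InfiniteAdeleRing K, ∫ x, (gaussian x : ℂ) *
        Complex.exp ((-(2 * Real.pi * infTrace (x * z)) : ℝ) * Complex.I) ∂(archMeasure μ 0) =
          C * gaussian z := by
  obtain ⟨C, hC, hint, hscale, hfour⟩ := exists_gaussian_integral (archMeasure μ 0)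
  refine ⟨C, hC, fun α ↦ ?_, hfour⟩
  have hcont : Continuous fun x : InfiniteAdeleRing K ↦
      gaussian ((((archPart α)⁻¹ : (InfiniteAdeleRing K)ˣ) : InfiniteAdeleRing K) * x) :=
    continuous_gaussian.comp (continuous_const_mul _)
  have hI : ∫ u, adelicFun α u ∂μ = ideleNorm α * C := by
    rw [adelicFun_eq, integral_strip μ _ hcont.aestronglyMeasurable, integral_archMeasure, hscale,
      ideleNorm_eq, archNorm]
    ring
  -- The integral of a nonintegrable function is 0 by convention, so a nonzero value proves
  -- integrability.
  exact ⟨.of_integral_ne_zero (hI ▸ (mul_pos (ideleNorm_pos α) hC).ne'), hI⟩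

/-- The archimedean component and the conductor of `ψ` are described by the idele `κ`. -/
structure IsConductor (ψ : AddChar (AdeleRing K) Circle) (κ : (AdeleRing K)ˣ) : Prop where
  nonarch : ∀ y : NonarchAdeleRing K, (∀ u ∈ divSubgroup (0 : NonarchPlace K →₀ ℤ),
    ψ (0, u * y) = 1) ↔ y ∈ divSubgroup (ideleDiv (nonarchPart κ))
  arch : ∀ x : InfiniteAdeleRing K, ψ (x, 0) = Circle.exp (2 * Real.pi *
    infTrace ((((archPart κ)⁻¹ : (InfiniteAdeleRing K)ˣ) : InfiniteAdeleRing K) * x))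

/-- If the finite part of y lies in the ball of κ, the finite part of the character is trivial on
the support and the archimedean transform remains. Otherwise the character is nontrivial on ∏ O_v
and the integral cancels. -/
theorem fourierIntegral_adelicFun_one {ψ : AddChar (AdeleRing K) Circle} {κ : (AdeleRing K)ˣ}
    (hκ : IsConductor ψ κ) (μ : Measure (AdeleRing K)) [μ.IsAddHaarMeasure] {C : ℝ}
    (hC : ∀ z : InfiniteAdeleRing K, ∫ x, (gaussian x : ℂ) *
        Complex.exp ((-(2 * Real.pi * infTrace (x * z)) : ℝ) * Complex.I) ∂(archMeasure μ 0) =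
          C * gaussian z) (y : AdeleRing K) :
    Fourier.fourierIntegral ψ μ (fun u ↦ (adelicFun (1 : (AdeleRing K)ˣ) u : ℂ)) y =
      C * (adelicFun κ y : ℂ) := by
  rw [Fourier.fourierIntegral_def, adelicFun_one, adelicFun_eq κ]
  set k : InfiniteAdeleRing K := (((archPart κ)⁻¹ : (InfiniteAdeleRing K)ˣ) : InfiniteAdeleRing K)
  by_cases hy : y ∈ strip (ideleDiv (nonarchPart κ))
  · rw [Set.indicator_of_mem hy, ← hC]
    have hψ : ∀ x : InfiniteAdeleRing K, (ψ (-(x * y.1), 0) : ℂ) =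
        Complex.exp ((-(2 * Real.pi * infTrace (x * (k * y.1))) : ℝ) * Complex.I) := by
      intro x
      have : k * -(x * y.1) = -(x * (k * y.1)) := by ring
      rw [hκ.arch, this, Circle.coe_exp, infTrace_neg, mul_neg]
    have hcont : Continuous fun x : InfiniteAdeleRing K ↦
        (gaussian x : ℂ) * (ψ (-(x * y.1), 0) : ℂ) := by
      simp_rw [hψ]
      have h1 := continuous_infTrace.comp
        (continuous_mul_const (k * y.1) : Continuous fun x : InfiniteAdeleRing K ↦ x * (k * y.1))
      have h2 : Continuous fun x : InfiniteAdeleRing K ↦ infTrace (x * (k * y.1)) := h1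
      have h3 := Complex.continuous_ofReal.comp (continuous_gaussian (K := K))
      have h4 : Continuous fun x : InfiniteAdeleRing K ↦ (gaussian x : ℂ) := h3
      fun_prop
    simp_rw [← hψ]
    rw [← integral_strip μ 0 (g := fun x ↦ (gaussian x : ℂ) * (ψ (-(x * y.1), 0) : ℂ))
      hcont.aestronglyMeasurable]
    congr 1
    ext u
    by_cases hu : u ∈ strip 0
    · rw [Set.indicator_of_mem hu, Set.indicator_of_mem hu]
      have h1 : -(u * y) = (-(u.1 * y.1), 0) + (0, (-u.2) * y.2) := by
        ext1 <;> simp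
      rw [h1, AddChar.map_add_eq_mul, (hκ.nonarch y.2).2 hy _ (neg_mem hu), mul_one, Circle.smul_def,
        smul_eq_mul, mul_comm]
    · rw [Set.indicator_of_notMem hu, Set.indicator_of_notMem hu]
      simp
  · rw [Set.indicator_of_notMem hy, Complex.ofReal_zero, mul_zero]
    have : ∃ u ∈ divSubgroup (0 : NonarchPlace K →₀ ℤ), ψ (0, u * y.2) ≠ 1 := by
      by_contra! h
      exact hy ((hκ.nonarch y.2).1 h)
    obtain ⟨u, hu, hψu⟩ := this
    set I := ∫ v, ψ (-(v * y)) • (((strip 0).indicator (fun u ↦ gaussian u.1) v : ℝ) : ℂ) ∂μ with hI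
    -- Translation by (0, -u) fixes f_1 and multiplies the character by ψ (0, u * y.2) ≠ 1, which
    -- forces I = 0.
    have h1 : I = (ψ (0, u * y.2) : ℂ) * I := by
      rw [hI, ← integral_const_mul]
      rw [← integral_add_left_eq_self _ ((0, -u) : AdeleRing K)]
      congr 1
      ext v
      have h2 : -(((0, -u) + v) * y) = (0, u * y.2) + -(v * y) := by
        ext1 <;> simp
        ring
      have h3 : (strip 0).indicator (fun u : AdeleRing K ↦ gaussian u.1) ((0, -u) + v) =
          (strip 0).indicator (fun u : AdeleRing K ↦ gaussian u.1) v := by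
        have h4 : (0, -u) + v ∈ strip 0 ↔ v ∈ strip 0 := by
          rw [mem_strip, mem_strip]
          exact AddSubgroup.add_mem_cancel_left _ (neg_mem hu)
        by_cases hv : v ∈ strip 0
        · rw [Set.indicator_of_mem hv, Set.indicator_of_mem (h4.2 hv)]
          simp
        · rw [Set.indicator_of_notMem hv, Set.indicator_of_notMem (mt h4.1 hv)]
      rw [h2, h3, AddChar.map_add_eq_mul, Circle.smul_def, Circle.smul_def, Circle.coe_mul, smul_eq_mul,
        smul_eq_mul, mul_assoc]
    have h5 : (1 - (ψ (0, u * y.2) : ℂ)) * I = 0 := by linear_combination h1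
    rcases mul_eq_zero.1 h5 with h | h
    · exact absurd (Circle.ext (sub_eq_zero.1 h).symm) hψu
    · exact h

/-- The main theorem for a character whose conductor idele `κ` is known. -/
theorem main_of_isConductor {ψ : AddChar (AdeleRing K) Circle}
    {κ : (AdeleRing K)ˣ} (hκ : IsConductor ψ κ) (μ : Measure (AdeleRing K)) [μ.IsAddHaarMeasure]
    (hμ : IsSelfDual ψ μ) {d : ℝ} (hd : ideleNorm κ = d) (α : (AdeleRing K)ˣ) :
    Integrable (adelicFun α) μ ∧ 0 < ∫ u, adelicFun α u ∂μ ∧ 0 < ideleNorm α ∧ 0 < d ∧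
    eulerChar μ α = Real.log (ideleNorm α) - 1 / 2 * Real.log d ∧
    (∀ κ : (AdeleRing K)ˣ, ideleNorm κ = d ^ (-(1 / 2) : ℝ) →
        eulerChar μ α = Real.log (ideleNorm α) + Real.log (ideleNorm κ)) ∧
    (∀ κ : (AdeleRing K)ˣ, IsCanonicalIdele ψ μ κ → ideleNorm κ = d ∧
        eulerChar μ α = Real.log (ideleNorm α) - 1 / 2 * Real.log (ideleNorm κ)) ∧
    eulerChar μ α - eulerChar μ 1 = Real.log (ideleNorm α) := by
  obtain ⟨C, hC, hint, hfour⟩ := exists_adelic_integrals μ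
  have hF : Fourier.fourierIntegral ψ μ (fun u ↦ (adelicFun (1 : (AdeleRing K)ˣ) u : ℂ)) =
      fun y ↦ C * (adelicFun κ y : ℂ) :=
    funext (fourierIntegral_adelicFun_one hκ μ hfour)
  have hd0 : 0 < d := hd ▸ ideleNorm_pos κ
  -- Fourier inversion for f_1 at the point 0, where every f_α has the value 1.
  have hCd : C ^ 2 * d = 1 := by
    have h := hμ (fun u ↦ (adelicFun (1 : (AdeleRing K)ˣ) u : ℂ))
      (Complex.continuous_ofReal.comp (continuous_adelicFun 1)) (hint 1).1.ofReal
      (by rw [hF]; exact (hint κ).1.ofReal.const_mul _) 0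
    rw [hF, Fourier.fourierIntegral_def] at h
    simp only [mul_zero, neg_zero, AddChar.map_zero_eq_one, one_smul, adelicFun_zero] at h
    rw [integral_const_mul, integral_complex_ofReal, (hint κ).2, hd] at h
    have h' : ((C * (d * C) : ℝ) : ℂ) = ((1 : ℝ) : ℂ) := by rw [Complex.ofReal_mul]; exact h
    have := Complex.ofReal_injective h'
    linear_combination this
  have hlogC : Real.log C = -(1 / 2) * Real.log d := by
    have := congrArg Real.log hCd
    rw [Real.log_mul (pow_pos hC 2).ne' hd0.ne', Real.log_pow, Real.log_one] at this
    push_cast at this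
    linarith
  have hlog : ∀ α, eulerChar μ α = Real.log (ideleNorm α) - 1 / 2 * Real.log d := fun α ↦ by
    rw [eulerChar, (hint α).2, Real.log_mul (ideleNorm_pos α).ne' hC.ne', hlogC]
    ring
  have hone : ideleNorm (1 : (AdeleRing K)ˣ) = 1 := by
    rw [ideleNorm_eq, ideleDiv_nonarchPart_one, divNorm_zero, archPart_one, archNorm, mul_one]
    refine finprod_eq_one_of_forall_eq_one fun v ↦ ?_
    change ‖(1 : v.Completion)‖ ^ v.mult = 1
    rw [norm_one, one_pow]
  refine ⟨(hint α).1, ?_, ideleNorm_pos α, hd0, hlog α, fun κ' hκ' ↦ ?_, fun κ' hκ' ↦ ?_, ?_⟩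
  · rw [(hint α).2]
    exact mul_pos (ideleNorm_pos α) hC
  · rw [hlog, hκ', Real.log_rpow hd0]
    ring
  · obtain ⟨c, hc⟩ := hκ'
    have hcC : c = C := by
      have := hc 0
      rw [hF] at this
      simpa [adelicFun_zero] using this.symm
    -- A canonical idele need not equal κ, but its function does, and the integral of that function
    -- determines the norm.
    have hfun : adelicFun κ' = adelicFun κ := by
      ext y
      have := hc y
      rw [hF, hcC] at this
      exact_mod_cast (mul_left_cancel₀ (Complex.ofReal_ne_zero.2 hC.ne') this).symm
    have hn : ideleNorm κ' = d := by
      have h1 := (hint κ').2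
      rw [hfun, (hint κ).2] at h1
      rw [← hd]
      exact (mul_right_cancel₀ hC.ne' h1).symm
    exact ⟨hn, by rw [hlog, hn]⟩
  · rw [hlog, hlog, hone, Real.log_one]
    ring

end Main

end GlobalField

namespace GlobalField

open NonarchAdeleRing

variable {K : Type*} [Field K]

/-! ### Places lying over a Dedekind domain -/

/-- The valuations are equivalent, and surjectivity makes exp (-1) the largest value below 1 for
both. Hence they agree on a uniformizer π, and every nonzero element is a power of π times an
element of value 1. -/
theorem valuation_eq_of_valuationSubring_eq {v w : Valuation K ℤᵐ⁰}
    (hv : Function.Surjective v) (hw : Function.Surjective w)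
    (h : v.valuationSubring = w.valuationSubring) : v = w := by
  have he : v.IsEquiv w := (Valuation.isEquiv_iff_valuationSubring _ _).2 h
  obtain ⟨π, hπ⟩ := hv (WithZero.exp (-1))
  obtain ⟨ϖ, hϖ⟩ := hw (WithZero.exp (-1))
  have key : ∀ {a : ℤᵐ⁰}, a < 1 → a ≤ WithZero.exp (-1) := by
    intro a ha
    rcases eq_or_ne a 0 with rfl | h0
    · exact zero_le
    · rw [← WithZero.exp_log h0] at ha ⊢
      rw [← WithZero.exp_zero, WithZero.exp_lt_exp] at ha
      rw [WithZero.exp_le_exp]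
      omega
  have hlt : WithZero.exp (-1) < (1 : ℤᵐ⁰) := by
    rw [← WithZero.exp_zero, WithZero.exp_lt_exp]; norm_num
  have hwπ : w π = WithZero.exp (-1) := by
    refine le_antisymm (key ?_) ?_
    · rw [← Valuation.isEquiv_iff_val_lt_one.1 he, hπ]
      exact hlt
    · have h1 : v ϖ ≤ v π := by
        rw [hπ]
        refine key ?_
        rw [Valuation.isEquiv_iff_val_lt_one.1 he, hϖ]
        exact hlt
      rw [← hϖ]
      exact (he _ _).1 h1
  ext x
  rcases eq_or_ne x 0 with rfl | hx
  · simp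
  have hx' : v x ≠ 0 := (Valuation.ne_zero_iff _).2 hx
  set n := WithZero.log (v x) with hn
  have h1 : v (x * π ^ n) = 1 := by
    rw [map_mul, map_zpow₀, hπ, ← WithZero.exp_log hx', ← hn, ← WithZero.exp_zsmul,
      ← WithZero.exp_add]
    simp
  have h2 : w (x * π ^ n) = 1 := (Valuation.isEquiv_iff_val_eq_one.1 he).1 h1
  rw [map_mul, map_zpow₀, hπ] at h1
  rw [map_mul, map_zpow₀, hwπ] at h2
  exact mul_right_cancel₀ (zpow_ne_zero _ WithZero.exp_ne_zero) (h1.trans h2.symm)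

theorem NonarchPlace.valuationSubring_eq (v : NonarchPlace K) :
    (v.prime.valuation K).valuationSubring = v.ring := by
  ext x
  exact v.valuation_le_one_iff x

theorem NonarchPlace.ring_ne_top (v : NonarchPlace K) : v.ring ≠ ⊤ := by
  rw [← v.valuationSubring_eq, ne_eq, Valuation.valuationSubring_eq_top_iff, not_not]
  infer_instance

theorem NonarchPlace.ext_ring {v w : NonarchPlace K} (h : v.ring = w.ring) : v = w := Subtype.ext h

section Dedekind

variable (R : Type*) [CommRing R] [IsDedekindDomain R] [Algebra R K] [IsFractionRing R K]

/-- `v` lies over `R`, i.e. its valuation ring contains `R`. -/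
def NonarchPlace.LiesOver (v : NonarchPlace K) : Prop := ∀ r : R, algebraMap R K r ∈ v.ring

variable {R}

/-- The maximal ideal of v contracts to a prime P of R, and the valuation ring of P is contained in
that of v. A discrete valuation ring has no proper overring except the field, so the two coincide.
-/
theorem NonarchPlace.LiesOver.exists_eq {v : NonarchPlace K} (hv : v.LiesOver R) :
    ∃ P : HeightOneSpectrum R, v.prime.valuation K = P.valuation K := by
  let f : R →+* v.ring := (algebraMap R K).codRestrict v.ring.toSubring hv
  have hf : ∀ r, (f r : K) = algebraMap R K r := fun r ↦ rfl
  let I : Ideal R := (IsLocalRing.maximalIdeal v.ring).comap f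
  have hI : ∀ r, r ∉ I → (algebraMap R K r)⁻¹ ∈ v.ring := by
    intro r hr
    have : IsUnit (f r) := by
      rw [← IsLocalRing.notMem_maximalIdeal]
      exact hr
    obtain ⟨u, hu⟩ := this
    have h1 : (u⁻¹.1 : K) * algebraMap R K r = 1 := by
      rw [← hf, ← hu]
      exact_mod_cast congrArg Subtype.val u.inv_mul
    rw [← eq_inv_of_mul_eq_one_left h1]
    exact SetLike.coe_mem _
  -- If the contraction were zero, every nonzero element of R would be a unit at v and the valuation
  -- ring would be all of K.
  have hbot : I ≠ ⊥ := by
    intro h0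
    refine v.ring_ne_top (top_le_iff.1 fun x _ ↦ ?_)
    obtain ⟨a, b, hb, rfl⟩ := IsFractionRing.div_surjective (A := R) x
    rw [div_eq_mul_inv]
    refine mul_mem (hv a) (hI b ?_)
    rw [h0]
    exact nonZeroDivisors.ne_zero hb
  let P : HeightOneSpectrum R := ⟨I, inferInstance, hbot⟩
  refine ⟨P, valuation_eq_of_valuationSubring_eq (v.prime.valuation_surjective K) (P.valuation_surjective K) ?_⟩
  rw [v.valuationSubring_eq]
  refine (ValuationSubring.eq_of_le_of_ne_top _ (fun x hx ↦ ?_) v.ring_ne_top).symm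
  obtain ⟨n, d, h⟩ := P.exists_primeCompl_mul_eq_of_integer x hx
  have hd : algebraMap R K d ≠ 0 := fun h0 ↦ d.2 (by
    rw [(IsFractionRing.injective R K).eq_iff' (map_zero _) |>.1 h0]
    exact zero_mem _)
  have : x = algebraMap R K n * (algebraMap R K d)⁻¹ := by
    field_simp
    linear_combination h
  rw [this]
  exact mul_mem (hv n) (hI _ d.2)

theorem exists_place (P : HeightOneSpectrum R) :
    ∃ v : NonarchPlace K, v.LiesOver R ∧ v.prime.valuation K = P.valuation K := by
  have hd : IsDiscreteValuationRing (P.valuation K).valuationSubring := by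
    rw [← P.valuationSubringAtPrime_eq_valuationSubring]
    exact IsLocalization.AtPrime.isDiscreteValuationRing_of_dedekind_domain R P.ne_bot
      (P.valuationSubringAtPrime K)
  let v : NonarchPlace K := ⟨(P.valuation K).valuationSubring, hd⟩
  refine ⟨v, fun r ↦ P.valuation_le_one r, ?_⟩
  exact valuation_eq_of_valuationSubring_eq (v.prime.valuation_surjective K) (P.valuation_surjective K)
    v.valuationSubring_eq

/-- The places over `R` are the primes of `R`. -/
def overEquiv : {v : NonarchPlace K // v.LiesOver R} ≃ HeightOneSpectrum R where
  toFun v := v.2.exists_eq.choose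
  invFun P := ⟨(exists_place P).choose, (exists_place P).choose_spec.1⟩
  left_inv v := by
    refine Subtype.ext (NonarchPlace.ext_ring ?_)
    have h1 := (exists_place (K := K) v.2.exists_eq.choose).choose_spec.2
    replace h1 := h1.trans v.2.exists_eq.choose_spec.symm
    exact (NonarchPlace.valuationSubring_eq _).symm.trans
      ((congrArg _ h1).trans (NonarchPlace.valuationSubring_eq _))
  right_inv P := by
    refine HeightOneSpectrum.eq_of_valuation_isEquiv_valuation (K := K) ?_
    have h1 := (exists_place (K := K) P).choose_spec
    rw [← h1.1.exists_eq.choose_spec, h1.2]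

theorem valuation_overEquiv (v : {v : NonarchPlace K // v.LiesOver R}) :
    (overEquiv v).valuation K = v.1.prime.valuation K := v.2.exists_eq.choose_spec.symm

/-- Only finitely many primes of R occur in the denominator of x. -/
theorem NonarchPlace.LiesOver.finite_one_lt (x : K) :
    {v : NonarchPlace K | v.LiesOver R ∧ 1 < v.prime.valuation K x}.Finite := by
  have h := (HeightOneSpectrum.Support.finite (R := R) x).preimage
    (overEquiv (K := K) (R := R)).injective.injOn
  refine (h.image Subtype.val).subset ?_
  rintro v ⟨hv, hx⟩
  refine ⟨⟨v, hv⟩, ?_, rfl⟩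
  change 1 < (overEquiv ⟨v, hv⟩).valuation K x
  rwa [valuation_overEquiv ⟨v, hv⟩]

theorem NonarchPlace.LiesOver.exists_sub_lt_one {v : NonarchPlace K} (hv : v.LiesOver R) {x : K}
    (hx : x ∈ v.ring) : ∃ r : R, v.prime.valuation K (algebraMap R K r - x) < 1 := by
  obtain ⟨P, hP⟩ := hv.exists_eq
  rw [← v.valuation_le_one_iff, hP] at hx
  rw [hP]
  exact P.exists_valuation_sub_lt_of_integer hx 1

/-- The residue field of a place over `R` is the quotient by the corresponding prime. -/
theorem nonempty_quotient_equiv_residueField (v : {v : NonarchPlace K // v.LiesOver R}) :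
    Nonempty ((R ⧸ (overEquiv v).asIdeal) ≃+* v.1.ResidueField) := by
  let f : R →+* v.1.ring := (algebraMap R K).codRestrict v.1.ring.toSubring v.2
  let g : R →+* v.1.ResidueField := (IsLocalRing.residue v.1.ring).comp f
  have hlt : ∀ y : v.1.ring, v.1.prime.valuation K (y : K) < 1 ↔ IsLocalRing.residue v.1.ring y = 0 := by
    intro y
    rw [IsLocalRing.residue_eq_zero_iff]
    exact v.1.prime.valuation_lt_one_iff_mem (K := K) y
  have hg : Function.Surjective g := by
    intro z
    obtain ⟨x, rfl⟩ := IsLocalRing.residue_surjective z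
    obtain ⟨r, hr⟩ := v.2.exists_sub_lt_one x.2
    refine ⟨r, ?_⟩
    have := (hlt (f r - x)).1 hr
    rwa [map_sub, sub_eq_zero] at this
  have hk : RingHom.ker g = (overEquiv v).asIdeal := by
    ext r
    rw [RingHom.mem_ker, ← (overEquiv v).valuation_lt_one_iff_mem (K := K), valuation_overEquiv]
    exact (hlt (f r)).symm
  exact ⟨(Ideal.quotEquivOfEq hk.symm).trans (RingHom.quotientKerEquivOfSurjective hg)⟩

theorem NonarchPlace.LiesOver.finite_residueField [Ring.HasFiniteQuotients R] {v : NonarchPlace K}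
    (hv : v.LiesOver R) : Finite v.ResidueField := by
  obtain ⟨e⟩ := nonempty_quotient_equiv_residueField ⟨v, hv⟩
  have := Ring.HasFiniteQuotients.finiteQuotient (overEquiv (K := K) (R := R) ⟨v, hv⟩).ne_bot
  exact Finite.of_equiv _ e.toEquiv

/-- Strong approximation for the places over a Dedekind domain. -/
theorem exists_sub_mem_ball_of_liesOver (R : Type*) [CommRing R] [IsDedekindDomain R] [Algebra R K]
    [IsFractionRing R K] (a : NonarchAdeleRing K) (D : NonarchPlace K →₀ ℤ) :
    ∃ x : K, ∀ v : NonarchPlace K, v.LiesOver R → a v - (x : v.Completion) ∈ v.ball (D v) := by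
  classical
  let S := {v : NonarchPlace K // v.LiesOver R}
  let T : Set (NonarchPlace K) := {v | a v ∉ v.integers} ∪ {v | D v ≠ 0}
  have hT : T.Finite := (Filter.eventually_cofinite.1 (eventually_mem a)).union D.hasFiniteSupport
  choose b hb using fun v : NonarchPlace K ↦ v.exists_coe_sub_le (a v) (D v)
  -- With a common denominator d of the local approximations, the problem becomes one of congruences
  -- in R for the numerator.
  obtain ⟨⟨d, hd⟩, hdb⟩ := IsLocalization.exist_integer_multiples (nonZeroDivisors R) hT.toFinset b
  have hd0 : algebraMap R K d ≠ 0 := by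
    rw [ne_eq, FaithfulSMul.algebraMap_eq_zero_iff]
    exact nonZeroDivisors.ne_zero hd
  choose c hc using fun v : S ↦ (show ∃ c : R, v.1 ∈ T → algebraMap R K c = algebraMap R K d * b v.1 by
    by_cases hv : v.1 ∈ T
    · obtain ⟨c, hc⟩ := hdb v.1 (hT.mem_toFinset.2 hv)
      exact ⟨c, fun _ ↦ by rw [hc, Algebra.smul_def]⟩
    · exact ⟨0, fun h ↦ absurd h hv⟩)
  -- The congruence must still have precision exp (D v) after division by d.
  choose e he using fun v : S ↦ (show ∃ e : ℕ, WithZero.exp (-(e : ℤ)) ≤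
      v.1.prime.valuation K (algebraMap R K d) * WithZero.exp (D v.1) by
    have h0 : v.1.prime.valuation K (algebraMap R K d) ≠ 0 := (Valuation.ne_zero_iff _).2 hd0
    refine ⟨(-(WithZero.log (v.1.prime.valuation K (algebraMap R K d)) + D v.1)).toNat, ?_⟩
    nth_rw 2 [← WithZero.exp_log h0]
    rw [← WithZero.exp_add, WithZero.exp_le_exp]
    omega)
  -- The places where d is not a unit are included: there y must be divisible enough for y / d to
  -- remain integral.
  let T' : Set S := Subtype.val ⁻¹' (T ∪ {v | v.LiesOver R ∧ 1 < v.prime.valuation K (algebraMap R K d)⁻¹})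
  have hT' : T'.Finite :=
    (hT.union (NonarchPlace.LiesOver.finite_one_lt _)).preimage Subtype.val_injective.injOn
  obtain ⟨y, hy⟩ := IsDedekindDomain.exists_forall_sub_mem_ideal (s := hT'.toFinset)
    (fun v : S ↦ (overEquiv v).asIdeal) e (fun v _ ↦ (overEquiv v).prime)
    (fun v _ w _ hvw h ↦ hvw (overEquiv.injective (HeightOneSpectrum.ext h)))
    (fun v ↦ if v.1.1 ∈ T then c v.1 else 0)
  have hyv : ∀ v : S, v.1.prime.valuation K (algebraMap R K y) ≤ 1 := fun v ↦
    (v.1.valuation_le_one_iff _).2 (v.2 y)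
  have hdv : ∀ v : S, 0 < v.1.prime.valuation K (algebraMap R K d) := fun v ↦
    zero_lt_iff.2 ((Valuation.ne_zero_iff _).2 hd0)
  have key : ∀ v : S, v ∈ T' → v.1.prime.valuation K
      ((algebraMap R K y - algebraMap R K (if v.1 ∈ T then c v else 0)) / algebraMap R K d) ≤
        WithZero.exp (D v.1) := by
    intro v hv
    have h1 := hy v (hT'.mem_toFinset.2 hv)
    rw [← HeightOneSpectrum.intValuation_le_pow_iff_mem,
      ← HeightOneSpectrum.valuation_of_algebraMap (K := K), valuation_overEquiv] at h1
    change v.1.prime.valuation K (algebraMap R K (y - if v.1 ∈ T then c v else 0)) ≤ _ at h1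
    rw [map_sub] at h1
    rw [map_div₀, div_le_iff₀ (hdv v), mul_comm]
    exact h1.trans (he v)
  refine ⟨algebraMap R K y / algebraMap R K d, fun v hv ↦ ?_⟩
  by_cases hvT : v ∈ T
  · have h1 := key ⟨v, hv⟩ (Or.inl hvT)
    rw [if_pos hvT, hc ⟨v, hv⟩ hvT, sub_div, mul_div_cancel_left₀ _ hd0,
      ← v.valued_coe, v.coe_sub] at h1
    have h2 := (v.ball (D v)).sub_mem (v.mem_ball.2 (hb v)) (v.mem_ball.2 h1)
    rwa [sub_sub_sub_cancel_right] at h2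
  · have hav : a v ∈ v.integers := by
      by_contra h
      exact hvT (Or.inl h)
    have hDv : D v = 0 := by
      by_contra h
      exact hvT (Or.inr h)
    refine sub_mem ?_ (v.mem_ball.2 ?_)
    · rw [hDv]
      exact v.mem_ball.2 hav
    · rw [v.valued_coe]
      by_cases hvT' : (⟨v, hv⟩ : S) ∈ T'
      · have h1 := key ⟨v, hv⟩ hvT'
        rwa [if_neg hvT, map_zero, sub_zero] at h1
      · have h1 : v.prime.valuation K (algebraMap R K d)⁻¹ ≤ 1 := by
          by_contra! h
          exact hvT' (Or.inr ⟨hv, h⟩)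
        rw [hDv, WithZero.exp_zero, div_eq_mul_inv, map_mul]
        exact mul_le_one' (hyv ⟨v, hv⟩) h1

end Dedekind

/-! ### Principal adeles and characters -/

variable (K) in
/-- Every element of `K` is integral at almost all nonarchimedean places. -/
class HasFinitePoles : Prop where
  finite_one_lt (x : K) : {v : NonarchPlace K | 1 < v.prime.valuation K x}.Finite

/-- The diagonal embedding of `K` in the nonarchimedean adeles. -/
def principal [HasFinitePoles K] : K →+* NonarchAdeleRing K where
  toFun x := mk (fun v ↦ (x : v.Completion)) (by
    rw [Filter.eventually_cofinite]
    refine (HasFinitePoles.finite_one_lt x).subset fun v hv ↦ ?_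
    by_contra h
    refine hv ?_
    change Valued.v (x : v.Completion) ≤ 1
    rw [v.valued_coe]
    exact not_lt.1 h)
  map_zero' := NonarchAdeleRing.ext fun v ↦ HeightOneSpectrum.adicCompletion.coe_zero K v.prime
  map_one' := NonarchAdeleRing.ext fun v ↦ HeightOneSpectrum.adicCompletion.coe_one K v.prime
  map_add' x y := NonarchAdeleRing.ext fun v ↦ HeightOneSpectrum.adicCompletion.coe_add K v.prime x y
  map_mul' x y := NonarchAdeleRing.ext fun v ↦ HeightOneSpectrum.adicCompletion.coe_mul K v.prime x y

section Principal

variable [HasFinitePoles K]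

theorem principal_apply (x : K) (v : NonarchPlace K) : principal x v = (x : v.Completion) := rfl

theorem principal_mem_divSubgroup {x : K} {D : NonarchPlace K →₀ ℤ} :
    principal x ∈ divSubgroup D ↔ ∀ v, v.prime.valuation K x ≤ WithZero.exp (D v) :=
  forall_congr' fun v ↦ by rw [principal_apply, v.mem_ball, v.valued_coe]

/-- The principal idele of a nonzero element of `K`. -/
def principalIdele (x : Kˣ) : (NonarchAdeleRing K)ˣ := Units.map (principal : K →+* _).toMonoidHom x

theorem coe_principalIdele (x : Kˣ) : (principalIdele x : NonarchAdeleRing K) = principal (x : K) := rfl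

theorem exp_ideleDiv_principalIdele (x : Kˣ) (v : NonarchPlace K) :
    WithZero.exp (ideleDiv (principalIdele x) v) = v.prime.valuation K (x : K) := by
  rw [← valued_idele, coe_principalIdele, principal_apply, v.valued_coe]

theorem principal_mul_mem_divSubgroup_iff (x : Kˣ) (D : NonarchPlace K →₀ ℤ)
    (a : NonarchAdeleRing K) :
    principal (x : K) * a ∈ divSubgroup (ideleDiv (principalIdele x) + D) ↔ a ∈ divSubgroup D :=
  mul_mem_divSubgroup_iff (principalIdele x) D a

end Principal

/-- The circle has no small subgroups. If c = Re w > 0 then Re w² = 2c² - 1 and 1 - Re w² = 2(1 -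
c)(1 + c) ≥ 2(1 - c), so repeated squaring would push 1 - Re beyond 1. -/
theorem Circle.eq_one_of_forall_pow_re_pos {z : Circle} (h : ∀ n : ℕ, 0 < ((z ^ n : Circle) : ℂ).re) :
    z = 1 := by
  have hsq : ∀ w : Circle, ((w : ℂ).re) ^ 2 + (w : ℂ).im ^ 2 = 1 := fun w ↦ by
    have := Circle.normSq_coe w
    rw [Complex.normSq_apply] at this
    linarith
  have hle : ∀ w : Circle, (w : ℂ).re ≤ 1 := fun w ↦ by nlinarith [hsq w, sq_nonneg (w : ℂ).im]
  have key : ∀ k : ℕ, 2 ^ k * (1 - (z : ℂ).re) ≤ 1 - ((z ^ (2 ^ k) : Circle) : ℂ).re := by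
    intro k
    induction k with
    | zero => simp
    | succ k ih =>
      have h1 := h (2 ^ k)
      set w := z ^ (2 ^ k)
      have h2 : ((z ^ (2 ^ (k + 1)) : Circle) : ℂ).re = 2 * (w : ℂ).re ^ 2 - 1 := by
        rw [pow_succ 2 k, pow_mul, pow_two, Circle.coe_mul, Complex.mul_re]
        linear_combination -hsq w
      rw [h2, pow_succ]
      nlinarith [hle w]
  have h1 : (z : ℂ).re = 1 := by
    by_contra hne
    have hpos : 0 < 1 - (z : ℂ).re := sub_pos.2 (lt_of_le_of_ne (hle z) hne)
    obtain ⟨k, hk⟩ := pow_unbounded_of_one_lt (1 / (1 - (z : ℂ).re)) (one_lt_two (α := ℝ))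
    rw [div_lt_iff₀ hpos] at hk
    linarith [key k, h (2 ^ k)]
  have h2 : (z : ℂ).im = 0 := by
    have := hsq z
    rw [h1] at this
    nlinarith
  exact Circle.ext (Complex.ext h1 h2)

/-- A continuous character of the nonarchimedean adeles has an open kernel. -/
theorem exists_divSubgroup_le_ker {φ : AddChar (NonarchAdeleRing K) Circle} (hφ : Continuous φ) :
    ∃ D : NonarchPlace K →₀ ℤ, D ≤ 0 ∧ ∀ a ∈ divSubgroup D, φ a = 1 := by
  have hU : {a : NonarchAdeleRing K | 0 < (φ a : ℂ).re} ∈ nhds 0 := by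
    refine IsOpen.mem_nhds (isOpen_lt continuous_const
      (Complex.continuous_re.comp (continuous_subtype_val.comp hφ))) ?_
    rw [Set.mem_ofPred_eq, φ.map_zero_eq_one]
    simp
  obtain ⟨D, hD, hDU⟩ := exists_divSubgroup_subset hU
  refine ⟨D, hD, fun a ha ↦ Circle.eq_one_of_forall_pow_re_pos fun n ↦ ?_⟩
  rw [← φ.map_nsmul_eq_pow]
  exact hDU (nsmul_mem ha n)

end GlobalField

namespace GlobalField

open NumberField NonarchAdeleRing InfinitePlace

/-! ### Characters of the archimedean adeles -/

/-- A continuous character of a real topological vector space is the exponential of a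
continuous additive functional. -/
theorem exists_exp_eq_of_continuous {E : Type*} [NormedAddCommGroup E] [NormedSpace ℝ E]
    {φ : AddChar E Circle} (hφ : Continuous φ) :
    ∃ l : E →+ ℝ, Continuous l ∧ ∀ x, φ x = Circle.exp (2 * Real.pi * l x) := by
  obtain ⟨F, ⟨hF0, hF⟩, -⟩ := Circle.isCoveringMap_exp.existsUnique_continuousMap_lifts
    (⟨φ, hφ⟩ : C(E, Circle)) (0 : E) (0 : ℝ) (by simp)
  have hF' : ∀ x, Circle.exp (F x) = φ x := fun x ↦ congrFun hF x
  -- The failure of additivity is a continuous function on a connected space with values in 2πℤ,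
  -- hence constant, and it vanishes at the origin.
  have hadd : ∀ x y, F (x + y) = F x + F y := by
    have h1 : Set.range (fun p : E × E ↦ F (p.1 + p.2) - F p.1 - F p.2) ⊆
        Set.range (fun n : ℤ ↦ n * (2 * Real.pi)) := by
      rintro _ ⟨p, rfl⟩
      have h2 : Circle.exp (F (p.1 + p.2) - F p.1 - F p.2) = 1 := by
        rw [Circle.exp_sub, Circle.exp_sub, hF', hF', hF', φ.map_add_eq_mul]
        simp
      obtain ⟨n, hn⟩ := Circle.exp_eq_one.1 h2
      exact ⟨n, hn.symm⟩
    have hc : Continuous fun p : E × E ↦ F (p.1 + p.2) - F p.1 - F p.2 := by fun_prop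
    have h3 : (Set.range (fun p : E × E ↦ F (p.1 + p.2) - F p.1 - F p.2)).Subsingleton :=
      (Set.countable_range _).isTotallyDisconnected _ h1 (isPreconnected_range hc)
    intro x y
    have h4 := h3 ⟨(x, y), rfl⟩ ⟨(0, 0), rfl⟩
    simp only [add_zero, hF0] at h4
    linarith
  refine ⟨⟨⟨fun x ↦ F x / (2 * Real.pi), by simp [hF0]⟩, fun x y ↦ ?_⟩, ?_, fun x ↦ ?_⟩
  · simp only [hadd]
    ring
  · exact F.continuous.div_const _
  · rw [← hF']
    congr 1
    change F x = 2 * Real.pi * (F x / (2 * Real.pi))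
    field_simp

variable {K : Type*} [Field K]

theorem continuous_ringEquiv_mixedSpace :
    Continuous (InfiniteAdeleRing.ringEquiv_mixedSpace K) := by
  have h : ⇑(InfiniteAdeleRing.ringEquiv_mixedSpace K) = fun x ↦
      (fun (v : {w : InfinitePlace K // IsReal w}) ↦ Completion.extensionEmbeddingOfIsReal v.2 (x v),
       fun (v : {w : InfinitePlace K // IsComplex w}) ↦ Completion.extensionEmbedding v.1 (x v)) := rfl
  rw [h]
  refine (continuous_pi fun v ↦ ?_).prodMk (continuous_pi fun v ↦ ?_)
  · exact (Completion.isometry_extensionEmbeddingOfIsReal v.2).continuous.comp (continuous_apply v.1)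
  · exact (Completion.isometry_extensionEmbedding v.1).continuous.comp (continuous_apply v.1)

theorem continuous_ringEquiv_mixedSpace_symm :
    Continuous (InfiniteAdeleRing.ringEquiv_mixedSpace K).symm := by
  have h : ∀ y, InfiniteAdeleRing.ringEquiv_mixedSpace K
      ((InfiniteAdeleRing.ringEquiv_mixedSpace K).symm y) = y := RingEquiv.apply_symm_apply _
  refine continuous_pi fun v ↦ ?_
  rcases isReal_or_isComplex v with hv | hv
  · rw [(Completion.isometry_extensionEmbeddingOfIsReal hv).isUniformInducing.isInducing.continuous_iff]
    have h1 : Completion.extensionEmbeddingOfIsReal hv ∘ (fun y ↦ (InfiniteAdeleRing.ringEquiv_mixedSpace K).symm y v) =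
        fun y ↦ y.1 ⟨v, hv⟩ := funext fun y ↦ congrFun (congrArg Prod.fst (h y)) ⟨v, hv⟩
    rw [h1]
    fun_prop
  · rw [(Completion.isometry_extensionEmbedding v).isUniformInducing.isInducing.continuous_iff]
    have h1 : Completion.extensionEmbedding v ∘ (fun y ↦ (InfiniteAdeleRing.ringEquiv_mixedSpace K).symm y v) =
        fun y ↦ y.2 ⟨v, hv⟩ := funext fun y ↦ congrFun (congrArg Prod.snd (h y)) ⟨v, hv⟩
    rw [h1]
    fun_prop

variable [NumberField K]

-- The mixed space supplies the normed real vector space on which characters lift to functionals.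
open scoped Classical in
theorem exists_exp_eq_infiniteAdeleRing {φ : AddChar (InfiniteAdeleRing K) Circle}
    (hφ : Continuous φ) : ∃ l : InfiniteAdeleRing K →+ ℝ, Continuous l ∧
      ∀ x, φ x = Circle.exp (2 * Real.pi * l x) := by
  let e := InfiniteAdeleRing.ringEquiv_mixedSpace K
  let φ' := φ.compAddMonoidHom e.symm.toAddMonoidHom
  have hφ' : Continuous φ' := hφ.comp continuous_ringEquiv_mixedSpace_symm
  obtain ⟨l, hl, h⟩ := exists_exp_eq_of_continuous (E := mixedEmbedding.mixedSpace K) (φ := φ') hφ'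
  refine ⟨l.comp e.toAddMonoidHom, hl.comp continuous_ringEquiv_mixedSpace, fun x ↦ ?_⟩
  change φ x = Circle.exp (2 * Real.pi * l (e x))
  rw [← h]
  change φ x = φ (e.symm (e x))
  rw [e.symm_apply_apply]

/-- The trace is the sum over complex embeddings; the `v.mult` embeddings inducing v have the same
real part. -/
theorem infTrace_algebraMap (x : K) :
    infTrace (algebraMap K (InfiniteAdeleRing K) x) = Algebra.trace ℚ K x := by
  classical
  have h1 : (Algebra.trace ℚ K x : ℝ) = ∑ φ : K →+* ℂ, (φ x).re := by
    have h2 := trace_eq_sum_embeddings ℂ (K := ℚ) (L := K) (x := x)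
    have h3 := congrArg Complex.re h2
    rw [Complex.re_sum] at h3
    rw [← Equiv.sum_comp (RingHom.equivRatAlgHom (R := K) (S := ℂ)).symm]
    simpa using h3
  rw [h1, infTrace, finsum_eq_sum_of_fintype, ← Finset.sum_fiberwise (g := InfinitePlace.mk)]
  refine Finset.sum_congr rfl fun v _ ↦ ?_
  have h4 : ∀ φ ∈ Finset.univ.filter (fun φ : K →+* ℂ ↦ InfinitePlace.mk φ = v), (φ x).re = (v.embedding x).re := by
    intro φ hφ
    have h5 : InfinitePlace.mk φ = InfinitePlace.mk v.embedding := by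
      rw [mk_embedding]
      exact (Finset.mem_filter.1 hφ).2
    rcases InfinitePlace.mk_eq_iff.1 h5 with h | h
    · rw [h]
    · rw [← h, ComplexEmbedding.conjugate_coe_eq, Complex.conj_re]
  rw [Finset.sum_congr rfl h4, Finset.sum_const, card_filter_mk_eq, nsmul_eq_mul, archTrace,
    InfiniteAdeleRing.algebraMap_apply, Completion.extensionEmbedding_coe]
  rfl

/-- An additive functional on the archimedean adeles that is integral on a nonzero multiple of
the ring of integers is given by the trace form. -/
theorem exists_eq_infTrace_mul {l : InfiniteAdeleRing K →+ ℝ} (hl : Continuous l) {N : 𝓞 K}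
    (hN : N ≠ 0) (h : ∀ o : 𝓞 K, ∃ n : ℤ, l (algebraMap K _ (N * o : K)) = n) :
    ∃ a : K, ∀ x, l x = infTrace (algebraMap K (InfiniteAdeleRing K) a * x) := by
  -- A nonzero integer multiple of x lies in N times the ring of integers, where l is integral.
  have hrat : ∀ x : K, ∃ q : ℚ, l (algebraMap K _ x) = q := by
    intro x
    obtain ⟨m, hm, o, ho⟩ : ∃ m : ℤ, m ≠ 0 ∧ ∃ o : 𝓞 K, (m : K) * x = N * o := by
      have hal : IsAlgebraic ℤ (x / (N : K)) :=
        (IsFractionRing.isAlgebraic_iff ℤ ℚ K).2 (Algebra.IsAlgebraic.isAlgebraic _)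
      obtain ⟨m, hm, ho⟩ := hal.exists_integral_multiple
      have hN' : (N : K) ≠ 0 := RingOfIntegers.coe_ne_zero_iff.2 hN
      refine ⟨m, hm, ⟨m • (x / (N : K)), (mem_integralClosure_iff ℤ K).2 ho⟩, ?_⟩
      change (m : K) * x = N * (m • (x / (N : K)))
      rw [zsmul_eq_mul]
      field_simp
    obtain ⟨n, hn⟩ := h o
    refine ⟨n / m, ?_⟩
    have h1 : (algebraMap K (InfiniteAdeleRing K)) ((m : K) * x) = m • algebraMap K (InfiniteAdeleRing K) x := by
      rw [map_mul, map_intCast, zsmul_eq_mul]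
    rw [← ho, h1, map_zsmul, zsmul_eq_mul] at hn
    have hm' : (m : ℝ) ≠ 0 := by exact_mod_cast hm
    push_cast
    rw [eq_div_iff hm', mul_comm, hn]
  choose q hq using hrat
  have hqadd : ∀ x y, q (x + y) = q x + q y := fun x y ↦ by
    have : (q (x + y) : ℝ) = q x + q y := by rw [← hq, ← hq, ← hq, map_add, map_add]
    exact_mod_cast this
  -- On K the functional l is rational-valued and ℚ-linear, so nondegeneracy of the trace form
  -- represents it by an element a.
  let Q : K →ₗ[ℚ] ℚ := (AddMonoidHom.mk' q hqadd).toRatLinearMap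
  let a : K := (LinearMap.BilinForm.toDual (Algebra.traceForm ℚ K) (traceForm_nondegenerate ℚ K)).symm Q
  have ha : ∀ x, Algebra.trace ℚ K (a * x) = q x := fun x ↦
    LinearMap.BilinForm.apply_toDual_symm_apply (B := Algebra.traceForm ℚ K)
      (hB := traceForm_nondegenerate ℚ K) Q x
  refine ⟨a, fun x ↦ ?_⟩
  have hcont : Continuous fun x : InfiniteAdeleRing K ↦ infTrace (algebraMap K (InfiniteAdeleRing K) a * x) :=
    continuous_infTrace.comp (continuous_const_mul _)
  -- Both sides are continuous and K is dense in the archimedean adeles.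
  refine congrFun ((InfiniteAdeleRing.denseRange_algebraMap K).equalizer hl hcont (funext fun x ↦ ?_)) x
  change l (algebraMap K _ x) = infTrace (algebraMap K _ a * algebraMap K _ x)
  rw [hq, ← map_mul, infTrace_algebraMap, ha]

end GlobalField

/-! ### Number fields: the conductor and the different -/

namespace GlobalField

open NumberField NonarchAdeleRing InfinitePlace

theorem NonarchPlace.mem_ring_of_isIntegral {K : Type*} [Field K] (v : NonarchPlace K) {S : Type*} [CommRing S] [Algebra S K]
    (hS : ∀ s, algebraMap S K s ∈ v.ring) {x : K} (hx : IsIntegral S x) : x ∈ v.ring := by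
  obtain ⟨p, hp, h⟩ := hx
  let f : S →+* v.ring := (algebraMap S K).codRestrict v.ring.toSubring hS
  have hf : algebraMap S K = (algebraMap v.ring K).comp f := rfl
  have hi : IsIntegral v.ring x := ⟨p.map f, hp.map f, by rwa [Polynomial.eval₂_map, ← hf]⟩
  obtain ⟨y, rfl⟩ := IsIntegrallyClosed.isIntegral_iff.1 hi
  exact y.2

/-- The elements of `K` that multiply a nonzero ideal into the ring, locally. -/
theorem forall_mul_mem_range_iff {R K : Type*} [CommRing R] [IsDedekindDomain R] [Field K]
    [Algebra R K] [IsFractionRing R K] {I : Ideal R} (hI : I ≠ ⊥) (w : K) :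
    (∀ d ∈ I, w * algebraMap R K d ∈ (algebraMap R K).range) ↔
      ∀ P : HeightOneSpectrum R, P.valuation K w ≤ WithZero.exp (multiplicity P.asIdeal I : ℤ) := by
  have hfin : ∀ P : HeightOneSpectrum R, FiniteMultiplicity P.asIdeal I := fun P ↦
    FiniteMultiplicity.of_prime_left P.prime hI
  constructor
  · intro h P
    -- The ideal I therefore contains an element d whose order at P is no larger than that of I;
    -- testing w against d gives the bound.
    have h1 : ¬ P.asIdeal ^ (multiplicity P.asIdeal I + 1) ∣ I :=
      (hfin P).not_pow_dvd_of_multiplicity_lt (Nat.lt_succ_self _)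
    rw [Ideal.dvd_iff_le] at h1
    obtain ⟨d, hd, hdP⟩ := Set.not_subset.1 h1
    have h2 : WithZero.exp (-(multiplicity P.asIdeal I : ℤ)) ≤ P.intValuation d := by
      have hd' : ¬ P.intValuation d ≤ WithZero.exp (-((multiplicity P.asIdeal I + 1 : ℕ) : ℤ)) :=
        mt (P.intValuation_le_pow_iff_mem d _).1 hdP
      have h0 : P.intValuation d ≠ 0 := fun h0 ↦ hd' (h0 ▸ zero_le)
      rw [← WithZero.exp_log h0, WithZero.exp_le_exp] at hd' ⊢
      push_cast at hd'
      omega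
    obtain ⟨r, hr⟩ := h d hd
    have h3 := P.valuation_le_one (K := K) r
    change P.valuation K (algebraMap R K r) ≤ 1 at h3
    rw [hr, map_mul, P.valuation_of_algebraMap] at h3
    have h4 := (mul_le_mul_right h2 (P.valuation K w)).trans h3
    rwa [WithZero.exp_neg, ← div_eq_mul_inv, div_le_one₀ (by simp)] at h4
  · intro h d hd
    refine HeightOneSpectrum.mem_integers_of_valuation_le_one K _ fun P ↦ ?_
    have h1 : P.intValuation d ≤ WithZero.exp (-(multiplicity P.asIdeal I : ℤ)) := by
      rw [HeightOneSpectrum.intValuation_le_pow_iff_mem]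
      exact Ideal.dvd_iff_le.1 (pow_multiplicity_dvd _ _) hd
    rw [map_mul, P.valuation_of_algebraMap]
    refine (mul_le_mul' (h P) h1).trans ?_
    rw [← WithZero.exp_add, add_neg_cancel, WithZero.exp_zero]

section

variable {K : Type*} [Field K]

theorem ideleDiv_mul (α β : (NonarchAdeleRing K)ˣ) : ideleDiv (α * β) = ideleDiv α + ideleDiv β := by
  ext v
  rw [Finsupp.add_apply, ← WithZero.exp_inj, WithZero.exp_add, ← valued_idele, ← valued_idele,
    ← valued_idele, ← map_mul]
  rfl

end

section NumberField

variable {K : Type*} [Field K]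

theorem liesOver_ringOfIntegers (v : NonarchPlace K) : v.LiesOver (𝓞 K) := fun r ↦
  v.mem_ring_of_isIntegral (S := ℤ) (fun n ↦ by simp) r.2

variable [NumberField K]

/-- The nonarchimedean places of a number field. -/
def placeEquiv : NonarchPlace K ≃ FinitePlace K :=
  (Equiv.subtypeUnivEquiv liesOver_ringOfIntegers).symm.trans
    (overEquiv.trans FinitePlace.equivHeightOneSpectrum.symm)

theorem valuation_placeEquiv (v : NonarchPlace K) :
    (placeEquiv v).maximalIdeal.valuation K = v.prime.valuation K := by
  have h : (placeEquiv v).maximalIdeal = overEquiv ⟨v, liesOver_ringOfIntegers v⟩ :=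
    FinitePlace.equivHeightOneSpectrum.apply_symm_apply _
  rw [h, valuation_overEquiv]

theorem natCard_residueField (v : NonarchPlace K) :
    Nat.card v.ResidueField = (placeEquiv v).maximalIdeal.asIdeal.absNorm := by
  have h : (placeEquiv v).maximalIdeal = overEquiv ⟨v, liesOver_ringOfIntegers v⟩ :=
    FinitePlace.equivHeightOneSpectrum.apply_symm_apply _
  obtain ⟨e⟩ := nonempty_quotient_equiv_residueField (R := 𝓞 K) ⟨v, liesOver_ringOfIntegers v⟩
  rw [h, Ideal.absNorm_apply, Submodule.cardQuot_apply, Nat.card_congr e.toEquiv]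

instance (v : NonarchPlace K) : Finite v.ResidueField :=
  (liesOver_ringOfIntegers v).finite_residueField

instance : HasFinitePoles K where
  finite_one_lt x := (NonarchPlace.LiesOver.finite_one_lt (R := 𝓞 K) x).subset
    fun v hv ↦ ⟨liesOver_ringOfIntegers v, hv⟩

/-- The finite half of the product formula; the archimedean half contributes the inverse factor. -/
theorem divNorm_principalIdele (x : Kˣ) :
    divNorm (ideleDiv (principalIdele x)) = |(Algebra.norm ℚ (x : K) : ℝ)|⁻¹ := by
  have h := FinitePlace.prod_eq_inv_abs_norm x.ne_zero
  push_cast at h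
  rw [← finprod_abs, ← h, ← finprod_comp_equiv placeEquiv]
  refine finprod_congr fun v ↦ ?_
  have h0 : v.prime.valuation K (x : K) ≠ 0 := (Valuation.ne_zero_iff _).2 x.ne_zero
  have h1 : (placeEquiv v) (x : K) =
      (((placeEquiv v).maximalIdeal.asIdeal.absNorm : ℝ)) ^ WithZero.log (v.prime.valuation K (x : K)) := by
    rw [← FinitePlace.norm_embedding_eq, FinitePlace.norm_embedding', valuation_placeEquiv,
      WithZeroMulInt.toNNReal_neg_apply _ h0]
    push_cast
    congr 1
    rw [← WithZero.exp_inj, WithZero.exp_log h0]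
    exact WithZero.coe_unzero h0
  rw [h1, NonarchPlace.abs, if_neg (ideleComponent_ne_zero _ v), natCard_residueField,
    coe_principalIdele, principal_apply, v.valued_coe]

/-- The divisor of a nonzero ideal. -/
theorem exists_divNorm_eq_absNorm {I : Ideal (𝓞 K)} (hI : I ≠ ⊥) :
    ∃ D : NonarchPlace K →₀ ℤ, (∀ v, D v = multiplicity (placeEquiv v).maximalIdeal.asIdeal I) ∧
      divNorm D = I.absNorm := by
  have hs : {v : NonarchPlace K | (multiplicity (placeEquiv v).maximalIdeal.asIdeal I : ℤ) ≠ 0}.Finite := by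
    refine Set.Finite.subset ((Ideal.finite_factors hI).preimage
      (FinitePlace.maximalIdeal_injective.comp placeEquiv.injective).injOn) fun v hv ↦ ?_
    by_contra h
    have h' : ¬ (placeEquiv v).maximalIdeal.asIdeal ∣ I := h
    exact hv (by rw [multiplicity_eq_zero.2 h']; rfl)
  refine ⟨Finsupp.ofSupportFinite _ hs, fun v ↦ rfl, ?_⟩
  obtain ⟨δ, hδ⟩ := exists_ideleDiv_eq (Finsupp.ofSupportFinite _ hs)
  rw [← hδ, ← finprod_abs]
  conv_rhs => rw [← FinitePlace.finprod_finitePlace_pow_multiplicity hI]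
  have h2 := ((Nat.castRingHom ℝ).toMonoidHom.comp (Ideal.absNorm (S := 𝓞 K)).toMonoidHom).map_finprod_of_preimage_one
    (by simp) (fun v : FinitePlace K ↦ v.maximalIdeal.asIdeal ^ multiplicity v.maximalIdeal.asIdeal I)
  refine Eq.trans ?_ h2.symm
  rw [← finprod_comp_equiv placeEquiv]
  refine finprod_congr fun v ↦ ?_
  rw [NonarchPlace.abs, if_neg (ideleComponent_ne_zero _ v), valued_idele, WithZero.log_exp, hδ,
    natCard_residueField]
  change _ ^ (multiplicity (placeEquiv v).maximalIdeal.asIdeal I : ℤ) = ((Ideal.absNorm _ : ℕ) : ℝ)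
  rw [map_pow, zpow_natCast]
  push_cast
  rfl

/-- The trace dual of the ring of integers is the inverse of the different, and membership in it can
be tested prime by prime. -/
theorem mem_dual_one_iff (w : K) : (∀ o : 𝓞 K, ∃ n : ℤ, Algebra.trace ℚ K (w * o) = n) ↔
    ∀ v : NonarchPlace K, v.prime.valuation K w ≤
      WithZero.exp (multiplicity (placeEquiv v).maximalIdeal.asIdeal (differentIdeal ℤ (𝓞 K)) : ℤ) := by
  have hne : differentIdeal ℤ (𝓞 K) ≠ ⊥ := differentIdeal_ne_bot
  have h1 := forall_mul_mem_range_iff hne w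
  have h2 : (∀ o : 𝓞 K, ∃ n : ℤ, Algebra.trace ℚ K (w * o) = n) ↔
      w ∈ FractionalIdeal.dual ℤ ℚ (1 : FractionalIdeal (nonZeroDivisors (𝓞 K)) K) := by
    rw [FractionalIdeal.mem_dual (@one_ne_zero (FractionalIdeal (nonZeroDivisors (𝓞 K)) K) _ _ _)]
    constructor
    · intro h a ha
      obtain ⟨o, rfl⟩ := (FractionalIdeal.mem_one_iff _).1 ha
      obtain ⟨n, hn⟩ := h o
      exact ⟨n, by simpa using hn.symm⟩
    · intro h o
      obtain ⟨n, hn⟩ := h (algebraMap (𝓞 K) K o) ((FractionalIdeal.mem_one_iff _).2 ⟨o, rfl⟩)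
      exact ⟨n, by simpa using hn.symm⟩
  have h3 : w ∈ FractionalIdeal.dual ℤ ℚ (1 : FractionalIdeal (nonZeroDivisors (𝓞 K)) K) ↔
      ∀ d ∈ differentIdeal ℤ (𝓞 K), w * algebraMap (𝓞 K) K d ∈ (algebraMap (𝓞 K) K).range := by
    have h4 := coeIdeal_differentIdeal ℤ ℚ K (𝓞 K)
    rw [← inv_inv (FractionalIdeal.dual ℤ ℚ (1 : FractionalIdeal (nonZeroDivisors (𝓞 K)) K)), ← h4,
      FractionalIdeal.mem_inv_iff (FractionalIdeal.coeIdeal_ne_zero.2 hne)]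
    constructor
    · intro h d hd
      obtain ⟨r, hr⟩ := (FractionalIdeal.mem_one_iff _).1 (h _ (FractionalIdeal.mem_coeIdeal_of_mem _ hd))
      exact ⟨r, hr⟩
    · intro h y hy
      obtain ⟨d, hd, rfl⟩ := (FractionalIdeal.mem_coeIdeal _).1 hy
      obtain ⟨r, hr⟩ := h d hd
      exact (FractionalIdeal.mem_one_iff _).2 ⟨r, hr⟩
  rw [h2, h3, h1]
  constructor
  · intro h v
    rw [← valuation_placeEquiv]
    exact h _
  · intro h P
    have h5 := h (placeEquiv.symm (FinitePlace.equivHeightOneSpectrum.symm P))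
    have h6 : (FinitePlace.equivHeightOneSpectrum.symm P).maximalIdeal = P :=
      FinitePlace.equivHeightOneSpectrum.apply_symm_apply P
    rwa [← valuation_placeEquiv, Equiv.apply_symm_apply, h6] at h5

/-- The conductor of a global character of a number field. -/
theorem exists_isConductor_of_numberField {ψ : AddChar (AdeleRing K) Circle}
    (hψ : IsGlobalCharacter ψ) :
    ∃ κ : (AdeleRing K)ˣ, IsConductor ψ κ ∧ ideleNorm κ = |((discr K : ℤ) : ℝ)| := by
  let φ : AddChar (InfiniteAdeleRing K) Circle := ψ.compAddMonoidHom (AddMonoidHom.inl _ _)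
  let φ' : AddChar (NonarchAdeleRing K) Circle := ψ.compAddMonoidHom (AddMonoidHom.inr _ _)
  have hφ : ∀ x, φ x = ψ (x, 0) := fun _ ↦ rfl
  have hφ' : ∀ x, φ' x = ψ (0, x) := fun _ ↦ rfl
  have hφc : Continuous φ := hψ.continuous.comp (Continuous.prodMk_left 0)
  have hφc' : Continuous φ' := hψ.continuous.comp (Continuous.prodMk_right 0)
  have hprod : ∀ x y, ψ (x, y) = φ x * φ' y := fun x y ↦ by
    rw [hφ, hφ', ← ψ.map_add_eq_mul, Prod.mk_add_mk, add_zero, zero_add]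
  -- On K the finite part of ψ is the inverse of the archimedean part; all later information comes
  -- from this.
  have hK : ∀ x : K, φ (algebraMap K _ x) * φ' (principal x) = 1 := fun x ↦ by
    rw [← hprod]
    exact hψ.trivial_on_principal _ ⟨x, fun v ↦ rfl, fun v ↦ rfl⟩
  obtain ⟨D, hD, hDφ⟩ := exists_divSubgroup_le_ker hφc'
  have happrox : ∀ (y : NonarchAdeleRing K) (E : NonarchPlace K →₀ ℤ),
      ∃ x : K, y - principal x ∈ divSubgroup E := fun y E ↦ by
    obtain ⟨x, hx⟩ := exists_sub_mem_ball_of_liesOver (𝓞 K) y E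
    exact ⟨x, fun v ↦ hx v (liesOver_ringOfIntegers v)⟩
  obtain ⟨l, hl, hexp⟩ := exists_exp_eq_infiniteAdeleRing hφc
  -- Integral multiples of N lie in the kernel of φ', so φ is trivial on them and l takes integral
  -- values there.
  obtain ⟨N, hN, hND⟩ : ∃ N : 𝓞 K, N ≠ 0 ∧ principal (N : K) ∈ divSubgroup D := by
    choose b hb using fun v : NonarchPlace K ↦ v.prime.valuation_surjective K (WithZero.exp (-D v))
    obtain ⟨⟨N, hN⟩, hNb⟩ := IsLocalization.exist_integer_multiples (nonZeroDivisors (𝓞 K)) D.support b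
    refine ⟨N, nonZeroDivisors.ne_zero hN, principal_mem_divSubgroup.2 fun v ↦ ?_⟩
    by_cases hv : v ∈ D.support
    · obtain ⟨r, hr⟩ := hNb v hv
      have h1 := (v.valuation_le_one_iff _).2 (liesOver_ringOfIntegers v r)
      rw [hr, Algebra.smul_def, map_mul, hb, WithZero.exp_neg, ← div_eq_mul_inv,
        div_le_one₀ (by simp)] at h1
      exact h1
    · rw [Finsupp.notMem_support_iff.1 hv, WithZero.exp_zero, v.valuation_le_one_iff]
      exact liesOver_ringOfIntegers v N
  have hint : ∀ o : 𝓞 K, principal (o : K) ∈ divSubgroup (0 : NonarchPlace K →₀ ℤ) := fun o ↦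
    principal_mem_divSubgroup.2 fun v ↦ by
      rw [Finsupp.coe_zero, Pi.zero_apply, WithZero.exp_zero, v.valuation_le_one_iff]
      exact liesOver_ringOfIntegers v o
  have hexp1 : ∀ t : ℝ, Circle.exp (2 * Real.pi * t) = 1 ↔ ∃ n : ℤ, t = n := fun t ↦ by
    rw [Circle.exp_eq_one]
    refine exists_congr fun n ↦ ?_
    rw [mul_comm]
    exact mul_left_inj' (by positivity)
  obtain ⟨a, ha⟩ := exists_eq_infTrace_mul hl hN fun o ↦ by
    rw [← hexp1, ← hexp]
    have h1 := mul_mem_divSubgroup hND (hint o)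
    rw [add_zero, ← map_mul] at h1
    have h2 := hK (N * o)
    rwa [hDφ _ h1, mul_one] at h2
  -- If a = 0 then φ is trivial, so φ' is trivial on K as well as on the ball of D. These span the
  -- finite adeles by strong approximation, and ψ would be trivial.
  have ha0 : a ≠ 0 := by
    rintro rfl
    refine hψ.nontrivial (DFunLike.ext _ _ fun u ↦ ?_)
    have h0 : ∀ x, φ x = 1 := fun x ↦ by
      have : l x = -l x := by
        conv_lhs => rw [ha, map_zero, zero_mul, ← neg_zero, infTrace_neg]
        rw [ha x, map_zero, zero_mul]
      rw [hexp, show l x = 0 by linarith, mul_zero, Circle.exp_zero]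
    obtain ⟨x, hx⟩ := happrox u.2 D
    have h1 : φ' u.2 = 1 := by
      have h2 := hK x
      rw [h0, one_mul] at h2
      rw [← sub_add_cancel u.2 (principal x), φ'.map_add_eq_mul, hDφ _ hx, h2, mul_one]
    rw [← Prod.mk.eta (p := u), hprod, h0, h1]
    simp
  have hne : differentIdeal ℤ (𝓞 K) ≠ ⊥ := differentIdeal_ne_bot
  obtain ⟨F, hF, hFn⟩ := exists_divNorm_eq_absNorm hne
  obtain ⟨δ, hδ⟩ := exists_ideleDiv_eq F
  let a' : Kˣ := Units.mk0 a ha0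
  -- κ is a⁻¹ times a finite idele with the multiplicities of the different. As positive
  -- coefficients allow poles, the ball of κ is a⁻¹ times the inverse different.
  let κ₁ : (InfiniteAdeleRing K)ˣ := Units.map (algebraMap K (InfiniteAdeleRing K)).toMonoidHom a'⁻¹
  let κ₂ : (NonarchAdeleRing K)ˣ := principalIdele a'⁻¹ * δ
  let κ : (AdeleRing K)ˣ := MulEquiv.prodUnits.symm (κ₁, κ₂)
  have hκ₁ : archPart κ = κ₁ := rfl
  have hκ₂ : nonarchPart κ = κ₂ := rfl
  have hdiv : ideleDiv κ₂ = ideleDiv (principalIdele a'⁻¹) + F := by rw [ideleDiv_mul, hδ]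
  -- For x in K, triviality of ψ on K turns the condition on φ' into integrality of Tr(a x o).
  have hdual : ∀ x : K, principal x ∈ divSubgroup (ideleDiv κ₂) ↔
      ∀ o : 𝓞 K, φ' (principal (x * o)) = 1 := by
    intro x
    have h1 : ∀ o : 𝓞 K, φ' (principal (x * o)) = 1 ↔ ∃ n : ℤ, Algebra.trace ℚ K (a * x * o) = n := by
      intro o
      have h2 := hK (x * o)
      rw [hexp, ha, ← map_mul, infTrace_algebraMap, ← mul_assoc] at h2
      have h3 : φ' (principal (x * o)) = 1 ↔
          Circle.exp (2 * Real.pi * (Algebra.trace ℚ K (a * x * o) : ℚ)) = 1 := by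
        constructor
        · intro h
          rwa [h, mul_one] at h2
        · intro h
          rwa [h, one_mul] at h2
      rw [h3, hexp1]
      refine exists_congr fun n ↦ ?_
      exact_mod_cast Iff.rfl
    simp_rw [h1]
    rw [mem_dual_one_iff]
    have h4 : principal x = principal ((a'⁻¹ : Kˣ) : K) * principal (a * x) := by
      rw [← map_mul]
      congr 1
      have : ((a'⁻¹ : Kˣ) : K) = a⁻¹ := Units.val_inv_eq_inv_val a'
      rw [this]
      field_simp
    rw [hdiv, h4, principal_mul_mem_divSubgroup_iff, principal_mem_divSubgroup]
    refine forall_congr' fun v ↦ ?_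
    rw [hF]
  refine ⟨κ, ⟨fun y ↦ ?_, fun x ↦ ?_⟩, ?_⟩
  · rw [hκ₂]
    -- Neither side changes when y is replaced by x: their difference lies in the ball of κ, and its
    -- integral multiples lie in the kernel of φ'.
    obtain ⟨x, hx⟩ := happrox y (D ⊓ ideleDiv κ₂)
    have h1 : y ∈ divSubgroup (ideleDiv κ₂) ↔ principal x ∈ divSubgroup (ideleDiv κ₂) := by
      have h2 := divSubgroup_mono (inf_le_right) hx
      constructor
      · intro h
        simpa using sub_mem h h2
      · intro h
        simpa using add_mem h2 h
    have h2 : ∀ u ∈ divSubgroup (0 : NonarchPlace K →₀ ℤ), ψ (0, u * y) = φ' (u * principal x) := by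
      intro u hu
      have h3 := mul_mem_divSubgroup hu (divSubgroup_mono (inf_le_left) hx)
      rw [zero_add, mul_sub] at h3
      rw [← hφ', ← sub_add_cancel (u * y) (u * principal x), φ'.map_add_eq_mul, hDφ _ h3, one_mul]
    rw [h1, hdual]
    constructor
    · intro h o
      rw [mul_comm, map_mul, ← h2 _ (hint o)]
      exact h _ (hint o)
    · intro h u hu
      rw [h2 u hu]
      rcases eq_or_ne x 0 with rfl | hx0
      · rw [map_zero, mul_zero, φ'.map_zero_eq_one]
      let x' : Kˣ := Units.mk0 x hx0
      -- The bound makes x(u - z) fall in the ball of D, and the infimum with 0 makes z integral.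
      obtain ⟨z, hz⟩ := happrox u ((D - ideleDiv (principalIdele x')) ⊓ 0)
      have hz0 : principal z ∈ divSubgroup (0 : NonarchPlace K →₀ ℤ) := by
        simpa using sub_mem hu (divSubgroup_mono inf_le_right hz)
      obtain ⟨o, rfl⟩ : ∃ o : 𝓞 K, (o : K) = z := by
        refine HeightOneSpectrum.mem_integers_of_valuation_le_one (R := 𝓞 K) K z fun P ↦ ?_
        obtain ⟨v, -, hv⟩ := exists_place (K := K) P
        rw [← hv]
        exact principal_mem_divSubgroup.1 hz0 v
      have h4 := (principal_mul_mem_divSubgroup_iff x' _ _).2 (divSubgroup_mono inf_le_left hz)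
      rw [add_sub_cancel, mul_sub] at h4
      have h5 : u * principal x = (principal (x' : K) * u - principal (x' : K) * principal (o : K)) +
          principal (x * o) := by
        rw [map_mul]
        change u * principal x = (principal x * u - principal x * principal (o : K)) + _
        ring
      rw [h5, φ'.map_add_eq_mul, hDφ _ h4, h o, one_mul]
  · rw [← hφ, hexp, ha, hκ₁]
    have h1 : ((κ₁⁻¹ : (InfiniteAdeleRing K)ˣ) : InfiniteAdeleRing K) = algebraMap K _ a := by
      rw [← map_inv, inv_inv]
      rfl
    rw [h1]
  · have h1 : archNorm κ₁ = |(Algebra.norm ℚ ((a'⁻¹ : Kˣ) : K) : ℝ)| := by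
      rw [archNorm, finprod_eq_prod_of_fintype]
      have h2 := InfinitePlace.prod_eq_abs_norm ((a'⁻¹ : Kˣ) : K)
      rw [Rat.cast_abs] at h2
      rw [← h2]
      refine Finset.prod_congr rfl fun v _ ↦ ?_
      rw [archAbs]
      congr 1
      exact Completion.norm_coe _ _
    have h2 : (Algebra.norm ℚ ((a'⁻¹ : Kˣ) : K) : ℝ) ≠ 0 := by
      exact_mod_cast Algebra.norm_ne_zero_iff.2 (Units.ne_zero _)
    -- The contributions of a at finite and infinite places cancel; the norm of the different is
    -- left.
    rw [ideleNorm_eq, hκ₁, hκ₂, hdiv, divNorm_add, divNorm_principalIdele, h1, hFn,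
      absNorm_differentIdeal K, ← mul_assoc, mul_inv_cancel₀ (abs_ne_zero.2 h2), one_mul,
      Nat.cast_natAbs, Int.cast_abs]

end NumberField

end GlobalField

/-! ### Function fields: Riemann–Roch by counting -/

namespace GlobalField

open NonarchAdeleRing

/-- The two factors are the steps of the chain A ≤ A ⊔ H ⊓ B ≤ B, by the second isomorphism theorem
and the modular law. -/
theorem relIndex_eq_inf_mul_sup {G : Type*} [AddCommGroup G] (H : AddSubgroup G) {A B : AddSubgroup G}
    (hAB : A ≤ B) :
    A.relIndex B = (H ⊓ A).relIndex (H ⊓ B) * (H ⊔ A).relIndex (H ⊔ B) := by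
  have h1 : A.relIndex (A ⊔ H ⊓ B) = (H ⊓ A).relIndex (H ⊓ B) := by
    rw [AddSubgroup.relIndex_sup_left, ← AddSubgroup.inf_relIndex_right]
    congr 1
    rw [inf_comm, inf_assoc, inf_eq_right.2 hAB]
  have h2 : (A ⊔ H ⊓ B).relIndex B = (H ⊔ A).relIndex (H ⊔ B) := by
    have h3 : H ⊔ B = B ⊔ (H ⊔ A) := by
      rw [sup_left_comm, sup_eq_left.2 hAB]
    rw [h3, AddSubgroup.relIndex_sup_right, ← AddSubgroup.inf_relIndex_right (H ⊔ A), sup_comm H A,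
      sup_inf_assoc_of_le H hAB]
  rw [← h1, ← h2, AddSubgroup.relIndex_mul_relIndex _ _ _ le_sup_left (sup_le hAB inf_le_right)]

/-- The characters that are trivial on a subgroup of finite index. -/
theorem natCard_addChar_of_finiteIndex {G : Type*} [AddCommGroup G] (S : AddSubgroup G) [S.FiniteIndex] :
    Finite {φ : AddChar G Circle // ∀ a ∈ S, φ a = 1} ∧
      Nat.card {φ : AddChar G Circle // ∀ a ∈ S, φ a = 1} = S.index := by
  let e : {φ : AddChar G Circle // ∀ a ∈ S, φ a = 1} ≃ AddChar (G ⧸ S) Circle :=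
    { toFun := fun φ ↦ AddChar.toAddMonoidHomEquiv.symm
        (QuotientAddGroup.lift S (AddChar.toAddMonoidHomEquiv φ.1) fun a ha ↦ φ.2 a ha)
      invFun := fun χ ↦ ⟨χ.compAddMonoidHom (QuotientAddGroup.mk' S), fun a ha ↦ by
        have : (QuotientAddGroup.mk' S a) = 0 := (QuotientAddGroup.eq_zero_iff a).2 ha
        rw [AddChar.compAddMonoidHom_apply, this, χ.map_zero_eq_one]⟩
      left_inv := fun φ ↦ rfl
      right_inv := fun χ ↦ by
        ext x
        obtain ⟨a, rfl⟩ := QuotientAddGroup.mk_surjective x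
        rfl }
  have := Fintype.ofFinite (G ⧸ S)
  have h := AddChar.card_eq (α := G ⧸ S)
  let e' := e.trans AddChar.circleEquivComplex.toEquiv
  refine ⟨Finite.of_equiv _ e'.symm, ?_⟩
  rw [Nat.card_congr e', Nat.card_eq_fintype_card, h, AddSubgroup.index, Nat.card_eq_fintype_card]

variable {K : Type*} [Field K]

/-- Each component is assigned to whichever divisor has the larger coefficient at that place. -/
theorem exists_mem_divSubgroup_add {D E : NonarchPlace K →₀ ℤ} {a : NonarchAdeleRing K}
    (ha : a ∈ divSubgroup (D ⊔ E)) : ∃ b ∈ divSubgroup D, ∃ c ∈ divSubgroup E, a = b + c := by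
  classical
  let b : NonarchAdeleRing K := mk (fun v ↦ if E v ≤ D v then a v else 0) (by
    filter_upwards [eventually_mem a] with v hv
    split_ifs
    · exact hv
    · exact zero_mem _)
  have hb : ∀ v, b v = if E v ≤ D v then a v else 0 := fun v ↦ rfl
  refine ⟨b, fun v ↦ ?_, a - b, fun v ↦ ?_, (add_sub_cancel b a).symm⟩
  · rw [hb]
    split_ifs with h
    · have := ha v
      rwa [Finsupp.sup_apply, sup_eq_left.2 h] at this
    · exact zero_mem _
  · rw [NonarchAdeleRing.sub_apply, hb]
    split_ifs with h
    · rw [sub_self]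
      exact zero_mem _
    · have := ha v
      rwa [Finsupp.sup_apply, sup_eq_right.2 (not_le.1 h).le, ← sub_zero (a v)] at this

/-- An idele with divisor D attains the bound at every place. -/
theorem divSubgroup_le_iff {D E : NonarchPlace K →₀ ℤ} : divSubgroup D ≤ divSubgroup E ↔ D ≤ E := by
  refine ⟨fun h v ↦ ?_, divSubgroup_mono⟩
  obtain ⟨α, hα⟩ := exists_ideleDiv_eq D
  have h1 : (α : NonarchAdeleRing K) ∈ divSubgroup D := fun w ↦ by
    rw [w.mem_ball, valued_idele, hα]
  have h2 := h h1 v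
  rwa [v.mem_ball, valued_idele, hα, WithZero.exp_le_exp] at h2

section Counting

variable [∀ v : NonarchPlace K, Finite v.ResidueField]

theorem divSubgroup_relIndex_ne_zero {D E : NonarchPlace K →₀ ℤ} (h : D ≤ E) :
    (divSubgroup D).relIndex (divSubgroup E) ≠ 0 := by
  intro h0
  have h1 := divSubgroup_relIndex h
  rw [h0, Nat.cast_zero, zero_mul] at h1
  exact (divNorm_pos E).ne h1

theorem divNorm_mono {D E : NonarchPlace K →₀ ℤ} (h : D ≤ E) : divNorm D ≤ divNorm E := by
  rw [← divSubgroup_relIndex h]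
  exact le_mul_of_one_le_left (divNorm_pos D).le
    (by exact_mod_cast Nat.one_le_iff_ne_zero.2 (divSubgroup_relIndex_ne_zero h))

end Counting

section Cohomology

variable [HasFinitePoles K]

variable (K) in
/-- The diagonal image of `K` in the nonarchimedean adeles. -/
def principalSubgroup : AddSubgroup (NonarchAdeleRing K) :=
  (principal : K →+* NonarchAdeleRing K).toAddMonoidHom.range

theorem principal_mem_principalSubgroup (x : K) : principal x ∈ principalSubgroup K := ⟨x, rfl⟩

variable (K) in
/-- The principal adeles and the adelic ball of some divisor span all adeles, and the adelic ball
of some divisor contains no nonzero principal adele. -/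
class HasFiniteCohomology : Prop where
  exists_sub_mem : ∃ D : NonarchPlace K →₀ ℤ, ∀ a : NonarchAdeleRing K, ∃ x : K, a - principal x ∈ divSubgroup D
  exists_eq_zero : ∃ D : NonarchPlace K →₀ ℤ, ∀ x : K, principal x ∈ divSubgroup D → x = 0

/-- The size of `H⁰(D)`. -/
def hZero (D : NonarchPlace K →₀ ℤ) : ℕ :=
  Nat.card (principalSubgroup K ⊓ divSubgroup D : AddSubgroup (NonarchAdeleRing K))

/-- The size of `H¹(D)`. -/
def hOne (D : NonarchPlace K →₀ ℤ) : ℕ := (principalSubgroup K ⊔ divSubgroup D).index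

/-- The relative indices modulo `K` multiply to the relative index of the adelic balls. -/
theorem relIndex_inf_sup {D E : NonarchPlace K →₀ ℤ} (h : D ≤ E) :
    (divSubgroup D).relIndex (divSubgroup E) =
      (principalSubgroup K ⊓ divSubgroup D).relIndex (principalSubgroup K ⊓ divSubgroup E) *
      (principalSubgroup K ⊔ divSubgroup D).relIndex (principalSubgroup K ⊔ divSubgroup E) :=
  relIndex_eq_inf_mul_sup _ (divSubgroup_mono h)

theorem hZero_eq_relIndex_mul {D E : NonarchPlace K →₀ ℤ} (h : D ≤ E) :
    hZero E = hZero D *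
      (principalSubgroup K ⊓ divSubgroup D).relIndex (principalSubgroup K ⊓ divSubgroup E) := by
  rw [hZero, hZero, ← AddSubgroup.relIndex_bot_left, ← AddSubgroup.relIndex_bot_left,
    AddSubgroup.relIndex_mul_relIndex _ _ _ bot_le (inf_le_inf_left _ (divSubgroup_mono h))]

theorem hOne_eq_relIndex_mul {D E : NonarchPlace K →₀ ℤ} (h : D ≤ E) :
    hOne D = (principalSubgroup K ⊔ divSubgroup D).relIndex (principalSubgroup K ⊔ divSubgroup E) *
      hOne E :=
  (AddSubgroup.relIndex_mul_index (sup_le_sup_left (divSubgroup_mono h) _)).symm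

/-- Multiplication by a nonzero element of `K` on the adeles. -/
def mulEquiv (x : Kˣ) : NonarchAdeleRing K ≃+ NonarchAdeleRing K :=
  AddAut.mulLeft (principalIdele x)

theorem map_mulEquiv_divSubgroup (x : Kˣ) (D : NonarchPlace K →₀ ℤ) :
    (divSubgroup D).map (mulEquiv x : NonarchAdeleRing K →+ NonarchAdeleRing K) =
      divSubgroup (ideleDiv (principalIdele x) + D) := by
  ext a
  constructor
  · rintro ⟨b, hb, rfl⟩
    exact (principal_mul_mem_divSubgroup_iff x D b).2 hb
  · intro ha
    obtain ⟨b, rfl⟩ := (mulEquiv x).surjective a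
    exact ⟨b, (principal_mul_mem_divSubgroup_iff x D b).1 ha, rfl⟩

theorem map_mulEquiv_principalSubgroup (x : Kˣ) :
    (principalSubgroup K).map (mulEquiv x : NonarchAdeleRing K →+ NonarchAdeleRing K) =
      principalSubgroup K := by
  ext a
  constructor
  · rintro ⟨_, ⟨y, rfl⟩, rfl⟩
    exact ⟨x * y, map_mul (principal : K →+* _) _ _⟩
  · rintro ⟨y, rfl⟩
    refine ⟨principal ((x⁻¹ : Kˣ) * y : K), principal_mem_principalSubgroup _, ?_⟩
    change principal (x : K) * principal ((x⁻¹ : Kˣ) * y : K) = principal y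
    rw [← map_mul, Units.mul_inv_cancel_left]

/-- Multiplication by x is an automorphism of the adeles that preserves K and shifts every ball by
the divisor of x. -/
theorem hZero_ideleDiv_add (x : Kˣ) (D : NonarchPlace K →₀ ℤ) :
    hZero (ideleDiv (principalIdele x) + D) = hZero D := by
  rw [hZero, hZero, ← map_mulEquiv_divSubgroup]
  nth_rw 1 [← map_mulEquiv_principalSubgroup x]
  rw [← AddSubgroup.map_inf_eq _ _ (mulEquiv x : NonarchAdeleRing K →+ NonarchAdeleRing K)
    (mulEquiv x).injective]
  exact (Nat.card_congr (AddSubgroup.equivMapOfInjective _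
    (mulEquiv x : NonarchAdeleRing K →+ NonarchAdeleRing K) (mulEquiv x).injective).toEquiv).symm

theorem hOne_ideleDiv_add (x : Kˣ) (D : NonarchPlace K →₀ ℤ) :
    hOne (ideleDiv (principalIdele x) + D) = hOne D := by
  rw [hOne, hOne, ← map_mulEquiv_divSubgroup]
  nth_rw 1 [← map_mulEquiv_principalSubgroup x]
  rw [← AddSubgroup.map_sup, AddSubgroup.index_map_equiv]

/-- When D grows, the index of the balls splits into the growth of `hZero` and the decline of
`hOne`. -/
theorem hZero_mul_of_le [∀ v : NonarchPlace K, Finite v.ResidueField] {D E : NonarchPlace K →₀ ℤ} (h : D ≤ E) :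
    (hZero E : ℝ) * (divNorm D * hOne D) = hZero D * (divNorm E * hOne E) := by
  rw [hZero_eq_relIndex_mul h, hOne_eq_relIndex_mul h, ← divSubgroup_relIndex h, relIndex_inf_sup h]
  push_cast
  ring

variable [HasFiniteCohomology K]

variable (K) in
theorem exists_principalSubgroup_sup_eq_top :
    ∃ D : NonarchPlace K →₀ ℤ, principalSubgroup K ⊔ divSubgroup D = ⊤ := by
  obtain ⟨D, hD⟩ := HasFiniteCohomology.exists_sub_mem (K := K)
  refine ⟨D, top_le_iff.1 fun a _ ↦ ?_⟩
  obtain ⟨x, hx⟩ := hD a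
  rw [← add_sub_cancel (principal x) a]
  exact AddSubgroup.add_mem_sup (principal_mem_principalSubgroup x) hx

variable (K) in
theorem exists_principalSubgroup_inf_eq_bot :
    ∃ D : NonarchPlace K →₀ ℤ, principalSubgroup K ⊓ divSubgroup D = ⊥ := by
  obtain ⟨D, hD⟩ := HasFiniteCohomology.exists_eq_zero (K := K)
  refine ⟨D, le_bot_iff.1 ?_⟩
  rintro _ ⟨⟨x, rfl⟩, hx⟩
  have : x = 0 := hD x hx
  rw [this]
  exact map_zero (principal : K →+* _)

variable [∀ v : NonarchPlace K, Finite v.ResidueField]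

/-- This is finiteness, since `Nat.card` is 0 on infinite types. Some D ⊓ E contains no nonzero
element of K, and passing from it to D costs at most the finite index of the balls. -/
theorem hZero_ne_zero (D : NonarchPlace K →₀ ℤ) : hZero D ≠ 0 := by
  obtain ⟨E, hE⟩ := exists_principalSubgroup_inf_eq_bot K
  have h1 : hZero (D ⊓ E) = 1 := by
    have : principalSubgroup K ⊓ divSubgroup (D ⊓ E) = ⊥ :=
      le_bot_iff.1 ((inf_le_inf_left _ (divSubgroup_mono inf_le_right)).trans hE.le)
    rw [hZero, this, Nat.card_unique]
  have h2 := divSubgroup_relIndex_ne_zero (inf_le_left : D ⊓ E ≤ D)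
  rw [hZero_eq_relIndex_mul (inf_le_left : D ⊓ E ≤ D), h1, one_mul]
  rw [relIndex_inf_sup inf_le_left] at h2
  exact left_ne_zero_of_mul h2

/-- Again finiteness, now descending to D from a larger divisor D ⊔ E for which K and the ball span
everything. -/
theorem hOne_ne_zero (D : NonarchPlace K →₀ ℤ) : hOne D ≠ 0 := by
  obtain ⟨E, hE⟩ := exists_principalSubgroup_sup_eq_top K
  have h1 : hOne (D ⊔ E) = 1 := by
    have : principalSubgroup K ⊔ divSubgroup (D ⊔ E) = ⊤ :=
      top_le_iff.1 (hE.ge.trans (sup_le_sup_left (divSubgroup_mono le_sup_right) _))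
    rw [hOne, this, AddSubgroup.index_top]
  have h2 := divSubgroup_relIndex_ne_zero (le_sup_left : D ≤ D ⊔ E)
  rw [hOne_eq_relIndex_mul (le_sup_left : D ≤ D ⊔ E), h1, mul_one]
  rw [relIndex_inf_sup le_sup_left] at h2
  exact right_ne_zero_of_mul h2

/-- The qualitative Riemann–Roch theorem. -/
theorem hZero_eq (D : NonarchPlace K →₀ ℤ) :
    (hZero D : ℝ) * hOne (0 : NonarchPlace K →₀ ℤ) =
      hZero (0 : NonarchPlace K →₀ ℤ) * (divNorm D * hOne D) := by
  have h1 := hZero_mul_of_le (inf_le_left : D ⊓ 0 ≤ D)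
  have h2 := hZero_mul_of_le (inf_le_right : D ⊓ 0 ≤ 0)
  rw [divNorm_zero, one_mul] at h2
  have h3 : (hZero (D ⊓ 0) : ℝ) ≠ 0 := by exact_mod_cast hZero_ne_zero _
  have h4 : divNorm (D ⊓ 0) * (hOne (D ⊓ 0) : ℝ) ≠ 0 :=
    mul_ne_zero (divNorm_pos _).ne' (by exact_mod_cast hOne_ne_zero _)
  refine mul_right_cancel₀ (mul_ne_zero h3 h4) ?_
  linear_combination (hZero (D ⊓ 0) : ℝ) * hOne (0 : NonarchPlace K →₀ ℤ) * h1 -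
    (hZero (D ⊓ 0) : ℝ) * divNorm D * hOne D * h2

/-- The product formula. -/
theorem divNorm_ideleDiv_principalIdele (x : Kˣ) : divNorm (ideleDiv (principalIdele x)) = 1 := by
  -- The divisor of x has the same `hZero` and `hOne` as 0, so this identity leaves no norm but 1.
  have h1 := hZero_eq (ideleDiv (principalIdele x))
  have h2 := hZero_ideleDiv_add x 0
  have h3 := hOne_ideleDiv_add x 0
  rw [add_zero] at h2 h3
  rw [h2, h3] at h1
  have h4 : (hZero (0 : NonarchPlace K →₀ ℤ) : ℝ) * hOne (0 : NonarchPlace K →₀ ℤ) ≠ 0 :=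
    mul_ne_zero (by exact_mod_cast hZero_ne_zero _) (by exact_mod_cast hOne_ne_zero _)
  refine mul_right_cancel₀ h4 ?_
  linear_combination -h1

/-- A nonzero x in the ball has divisor at most D, while the divisor of x has norm 1. -/
theorem hZero_eq_one {D : NonarchPlace K →₀ ℤ} (hD : divNorm D < 1) : hZero D = 1 := by
  have : principalSubgroup K ⊓ divSubgroup D = ⊥ := by
    refine le_bot_iff.1 ?_
    rintro _ ⟨⟨x, rfl⟩, hx⟩
    by_cases hx0 : x = 0
    · rw [hx0]
      exact map_zero (principal : K →+* _)
    · exfalso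
      let x' : Kˣ := Units.mk0 x hx0
      have h1 : ideleDiv (principalIdele x') ≤ D := fun v ↦ by
        rw [← WithZero.exp_le_exp, exp_ideleDiv_principalIdele]
        exact principal_mem_divSubgroup.1 hx v
      have h2 := divNorm_mono h1
      rw [divNorm_ideleDiv_principalIdele] at h2
      linarith
  rw [hZero, this, Nat.card_unique]

end Cohomology

end GlobalField

/-! ### Differentials and duality -/

namespace GlobalField

open NonarchAdeleRing

variable {K : Type*} [Field K]

section

variable [∀ v : NonarchPlace K, Finite v.ResidueField]

/-- Divisors of arbitrarily large degree exist. -/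
theorem exists_lt_divNorm [Nontrivial (NonarchAdeleRing K)] (B : ℝ) :
    ∃ F : NonarchPlace K →₀ ℤ, B < divNorm F := by
  have hne : Nonempty (NonarchPlace K) := by
    by_contra h
    rw [not_nonempty_iff] at h
    exact zero_ne_one (α := NonarchAdeleRing K) (NonarchAdeleRing.ext fun v ↦ isEmptyElim v)
  obtain ⟨v⟩ := hne
  have h2 : (1 : ℝ) < Nat.card v.ResidueField := by exact_mod_cast Finite.one_lt_card
  obtain ⟨n, hn⟩ := pow_unbounded_of_one_lt B h2
  refine ⟨Finsupp.single v n, ?_⟩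
  rw [divNorm, Finsupp.prod_single_index (by simp), zpow_natCast]
  exact hn

theorem divNorm_neg (D : NonarchPlace K →₀ ℤ) : divNorm (-D) = (divNorm D)⁻¹ := by
  have h := divNorm_add D (-D)
  rw [add_neg_cancel, divNorm_zero] at h
  exact eq_inv_of_mul_eq_one_right h.symm

theorem divNorm_sub (D E : NonarchPlace K →₀ ℤ) : divNorm (D - E) = divNorm D / divNorm E := by
  rw [sub_eq_add_neg, divNorm_add, divNorm_neg, div_eq_mul_inv]

end

variable [HasFinitePoles K]

/-- A nontrivial character of the nonarchimedean adeles that is trivial on `K`. -/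
structure IsDifferential (φ : AddChar (NonarchAdeleRing K) Circle) : Prop where
  nontrivial : φ ≠ 1
  map_principal (x : K) : φ (principal x) = 1

/-- The characters of the nonarchimedean adeles that are trivial on `K` and on the adelic ball of
a divisor. -/
def Differentials (D : NonarchPlace K →₀ ℤ) : Type _ :=
  {χ : AddChar (NonarchAdeleRing K) Circle // ∀ a ∈ principalSubgroup K ⊔ divSubgroup D, χ a = 1}

section

variable {φ : AddChar (NonarchAdeleRing K) Circle}

theorem IsDifferential.nontrivial_ring (hφ : IsDifferential φ) : Nontrivial (NonarchAdeleRing K) := by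
  by_contra h
  rw [not_nontrivial_iff_subsingleton] at h
  refine hφ.nontrivial (DFunLike.ext _ _ fun a ↦ ?_)
  rw [Subsingleton.elim a 0, φ.map_zero_eq_one, AddChar.map_zero_eq_one]

theorem IsDifferential.principal_injective (hφ : IsDifferential φ) :
    Function.Injective (principal : K →+* NonarchAdeleRing K) :=
  have := hφ.nontrivial_ring
  RingHom.injective _

theorem IsDifferential.natCard_eq_hZero (hφ : IsDifferential φ) (D : NonarchPlace K →₀ ℤ) :
    Nat.card {x : K // principal x ∈ divSubgroup D} = hZero D := by
  refine Nat.card_congr (Equiv.ofBijective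
    (fun x ↦ ⟨principal x.1, principal_mem_principalSubgroup x.1, x.2⟩) ⟨fun x y h ↦ ?_, ?_⟩)
  · exact Subtype.ext (hφ.principal_injective (Subtype.ext_iff.1 h))
  · rintro ⟨_, ⟨x, rfl⟩, hx⟩
    exact ⟨⟨x, hx⟩, rfl⟩

theorem IsDifferential.eq_zero_of_mulShift_eq_one (hφ : IsDifferential φ) {x : K}
    (h : φ.mulShift (principal x) = 1) : x = 0 := by
  by_contra hx
  refine hφ.nontrivial (DFunLike.ext _ _ fun a ↦ ?_)
  have h1 := DFunLike.congr_fun h (principal x⁻¹ * a)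
  rwa [AddChar.mulShift_apply, ← mul_assoc, ← map_mul, mul_inv_cancel₀ hx, map_one, one_mul] at h1

theorem mulShift_eq_one_of_mem {E F : NonarchPlace K →₀ ℤ} (hφ : ∀ x : K, φ (principal x) = 1)
    (hE : ∀ a ∈ divSubgroup E, φ a = 1) {x : K} (hx : principal x ∈ divSubgroup F)
    {a : NonarchAdeleRing K} (ha : a ∈ principalSubgroup K ⊔ divSubgroup (E - F)) :
    φ.mulShift (principal x) a = 1 := by
  obtain ⟨_, ⟨y, rfl⟩, b, hb, rfl⟩ := AddSubgroup.mem_sup.1 ha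
  have h1 := mul_mem_divSubgroup hx hb
  rw [add_sub_cancel] at h1
  rw [AddChar.map_add_eq_mul, AddChar.mulShift_apply, AddChar.mulShift_apply, hE _ h1, mul_one]
  change φ (principal x * principal y) = 1
  rw [← map_mul, hφ]

end

section

variable [HasFiniteCohomology K] [∀ v : NonarchPlace K, Finite v.ResidueField]

theorem natCard_differentials (D : NonarchPlace K →₀ ℤ) :
    Finite (Differentials D) ∧ Nat.card (Differentials D) = hOne D := by
  have : (principalSubgroup K ⊔ divSubgroup D).FiniteIndex := ⟨hOne_ne_zero D⟩
  exact natCard_addChar_of_finiteIndex _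

theorem hZero_zero_pos : (0 : ℝ) < hZero (0 : NonarchPlace K →₀ ℤ) := by
  exact_mod_cast Nat.pos_of_ne_zero (hZero_ne_zero _)

theorem hOne_pos (D : NonarchPlace K →₀ ℤ) : (0 : ℝ) < hOne D := by
  exact_mod_cast Nat.pos_of_ne_zero (hOne_ne_zero _)

/-- Multiplying the argument of φ by x embeds the sections of F into the characters trivial on K and
on the ball of E - F, and there are `hOne (E - F)` of these. -/
theorem hZero_le_hOne {φ : AddChar (NonarchAdeleRing K) Circle} (hφ : IsDifferential φ)
    {E : NonarchPlace K →₀ ℤ} (hE : ∀ a ∈ divSubgroup E, φ a = 1) (F : NonarchPlace K →₀ ℤ) :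
    hZero F ≤ hOne (E - F) := by
  obtain ⟨h1, h2⟩ := natCard_differentials (E - F)
  rw [← hφ.natCard_eq_hZero, ← h2]
  refine Nat.card_le_card_of_injective
    (fun x ↦ ⟨φ.mulShift (principal x.1), fun a ↦ mulShift_eq_one_of_mem hφ.map_principal hE x.2⟩)
    fun x y h ↦ Subtype.ext ?_
  have h3 : φ.mulShift (principal x.1) = φ.mulShift (principal y.1) := Subtype.ext_iff.1 h
  rw [← sub_eq_zero]
  refine hφ.eq_zero_of_mulShift_eq_one (DFunLike.ext _ _ fun a ↦ ?_)
  have h4 := DFunLike.congr_fun h3 a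
  rw [AddChar.mulShift_apply, AddChar.mulShift_apply] at h4
  rw [AddChar.mulShift_apply, map_sub, sub_mul, AddChar.map_sub_eq_div, h4, div_self']
  rfl

/-- If a differential is trivial on the ball of `E` then the degree of `E` is bounded. -/
theorem divNorm_le_of_trivial {φ : AddChar (NonarchAdeleRing K) Circle} (hφ : IsDifferential φ)
    {E : NonarchPlace K →₀ ℤ} (hE : ∀ a ∈ divSubgroup E, φ a = 1) :
    divNorm E * (hZero (0 : NonarchPlace K →₀ ℤ) : ℝ) ^ 2 ≤ (hOne (0 : NonarchPlace K →₀ ℤ) : ℝ) ^ 2 := by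
  have := hφ.nontrivial_ring
  -- F is large enough that E - F has norm below 1 and hence no sections; then `hOne (E - F)` is
  -- known exactly.
  obtain ⟨F, hF⟩ := exists_lt_divNorm (K := K) (divNorm E)
  have hF0 := divNorm_pos F
  have hE0 := divNorm_pos E
  have h1 : (hZero F : ℝ) ≤ hOne (E - F) := by exact_mod_cast hZero_le_hOne hφ hE F
  have h2 := hZero_eq F
  have h3 := hZero_eq (E - F)
  rw [hZero_eq_one (by rwa [divNorm_sub, div_lt_one hF0]), Nat.cast_one, one_mul, divNorm_sub] at h3
  have h4 : (1 : ℝ) ≤ hOne F := by exact_mod_cast Nat.one_le_iff_ne_zero.2 (hOne_ne_zero F)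
  have hz := hZero_zero_pos (K := K)
  have ho := hOne_pos (0 : NonarchPlace K →₀ ℤ)
  set z : ℝ := (hZero (0 : NonarchPlace K →₀ ℤ) : ℝ)
  set o : ℝ := (hOne (0 : NonarchPlace K →₀ ℤ) : ℝ)
  have h5 : z * divNorm F ≤ hZero F * o := by
    rw [h2]
    nlinarith [mul_pos hz hF0]
  have h6 : (hOne (E - F) : ℝ) * (z * divNorm E) = o * divNorm F := by
    rw [h3]
    field_simp
  have h7 : z * divNorm F * (z * divNorm E) ≤ o * divNorm F * o :=
    calc z * divNorm F * (z * divNorm E) ≤ hZero F * o * (z * divNorm E) :=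
          mul_le_mul_of_nonneg_right h5 (mul_pos hz hE0).le
      _ ≤ hOne (E - F) * o * (z * divNorm E) := by gcongr
      _ = o * divNorm F * o := by rw [← h6]; ring
  refine le_of_mul_le_mul_right ?_ hF0
  linarith

/-- Any two differentials are proportional. -/
theorem exists_mulShift_eq {φ ψ : AddChar (NonarchAdeleRing K) Circle} (hφ : IsDifferential φ)
    (hψ : IsDifferential ψ) {E : NonarchPlace K →₀ ℤ} (hEφ : ∀ a ∈ divSubgroup E, φ a = 1)
    (hEψ : ∀ a ∈ divSubgroup E, ψ a = 1) : ∃ x : K, φ = ψ.mulShift (principal x) := by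
  by_contra! hcon
  have hind : ∀ x y : K, φ.mulShift (principal x) = ψ.mulShift (principal y) → x = 0 := by
    intro x y h
    by_contra hx
    refine hcon (y * x⁻¹) (DFunLike.ext _ _ fun a ↦ ?_)
    have h1 := DFunLike.congr_fun h (principal x⁻¹ * a)
    rw [AddChar.mulShift_apply, AddChar.mulShift_apply, ← mul_assoc, ← mul_assoc, ← map_mul,
      ← map_mul, mul_inv_cancel₀ hx, map_one, one_mul] at h1
    rw [h1, AddChar.mulShift_apply]
  -- Independent φ and ψ would make pairs of sections inject. The left side grows like the square of
  -- the norm of F, the right side only linearly.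
  have key : ∀ F : NonarchPlace K →₀ ℤ, hZero F * hZero F ≤ hOne (E - F) := by
    intro F
    obtain ⟨h1, h2⟩ := natCard_differentials (E - F)
    rw [← hφ.natCard_eq_hZero, ← h2, ← Nat.card_prod]
    refine Nat.card_le_card_of_injective
      (fun p ↦ ⟨φ.mulShift (principal p.1.1) * ψ.mulShift (principal p.2.1), fun a ha ↦ by
        rw [AddChar.mul_apply, mulShift_eq_one_of_mem hφ.map_principal hEφ p.1.2 ha,
          mulShift_eq_one_of_mem hψ.map_principal hEψ p.2.2 ha, mul_one]⟩) ?_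
    rintro ⟨x, y⟩ ⟨x', y'⟩ h
    have h3 : φ.mulShift (principal x.1) * ψ.mulShift (principal y.1) =
        φ.mulShift (principal x'.1) * ψ.mulShift (principal y'.1) := Subtype.ext_iff.1 h
    have h4 : φ.mulShift (principal (x.1 - x'.1)) = ψ.mulShift (principal (y'.1 - y.1)) := by
      ext1 a
      have h5 := DFunLike.congr_fun h3 a
      simp only [AddChar.mul_apply, AddChar.mulShift_apply] at h5
      rw [AddChar.mulShift_apply, AddChar.mulShift_apply, map_sub, map_sub, sub_mul, sub_mul,
        AddChar.map_sub_eq_div, AddChar.map_sub_eq_div, div_eq_div_iff_mul_eq_mul, h5, mul_comm]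
    have h5 := hind _ _ h4
    rw [h5, map_zero, AddChar.mulShift_zero] at h4
    have h6 := hψ.eq_zero_of_mulShift_eq_one h4.symm
    exact Prod.ext (Subtype.ext (sub_eq_zero.1 h5)) (Subtype.ext (sub_eq_zero.1 h6).symm)
  have := hφ.nontrivial_ring
  have hE0 := divNorm_pos E
  have hz := hZero_zero_pos (K := K)
  have ho := hOne_pos (0 : NonarchPlace K →₀ ℤ)
  set z : ℝ := (hZero (0 : NonarchPlace K →₀ ℤ) : ℝ)
  set o : ℝ := (hOne (0 : NonarchPlace K →₀ ℤ) : ℝ)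
  -- The first bound kills the sections of E - F; the second contradicts the inequality z³ N(F)²
  -- N(E) ≤ o³ N(F) obtained below, with N = `divNorm`.
  obtain ⟨F, hF⟩ := exists_lt_divNorm (K := K) (max (divNorm E) (o ^ 3 / (z ^ 3 * divNorm E)))
  have hF1 := (le_max_left _ _).trans_lt hF
  have hF2 := (le_max_right _ _).trans_lt hF
  have hF0 := divNorm_pos F
  have h1 : (hZero F : ℝ) * hZero F ≤ hOne (E - F) := by exact_mod_cast key F
  have h2 := hZero_eq F
  have h3 := hZero_eq (E - F)
  rw [hZero_eq_one (by rwa [divNorm_sub, div_lt_one hF0]), Nat.cast_one, one_mul, divNorm_sub] at h3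
  have h4 : (1 : ℝ) ≤ hOne F := by exact_mod_cast Nat.one_le_iff_ne_zero.2 (hOne_ne_zero F)
  have h5 : z * divNorm F ≤ hZero F * o := by
    rw [h2]
    nlinarith [mul_pos hz hF0]
  have h6 : (hOne (E - F) : ℝ) * (z * divNorm E) = o * divNorm F := by
    change o = z * _ at h3
    rw [h3]
    field_simp
  rw [div_lt_iff₀ (by positivity)] at hF2
  have h7 : (z * divNorm F) ^ 2 * (z * divNorm E) ≤ o * divNorm F * o ^ 2 :=
    calc (z * divNorm F) ^ 2 * (z * divNorm E) ≤ (hZero F * o) ^ 2 * (z * divNorm E) := by gcongr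
      _ = hZero F * hZero F * o ^ 2 * (z * divNorm E) := by ring
      _ ≤ hOne (E - F) * o ^ 2 * (z * divNorm E) := by gcongr
      _ = o * divNorm F * o ^ 2 := by rw [← h6]; ring
  have h8 : divNorm F * (divNorm F * (z ^ 3 * divNorm E)) ≤ divNorm F * o ^ 3 := by linarith
  have h9 := le_of_mul_le_mul_left h8 hF0
  linarith

/-- The divisor of a differential. -/
theorem IsDifferential.exists_divisor {φ : AddChar (NonarchAdeleRing K) Circle} (hφ : IsDifferential φ)
    (hc : Continuous φ) : ∃ κ : NonarchPlace K →₀ ℤ,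
      (∀ E, (∀ a ∈ divSubgroup E, φ a = 1) ↔ E ≤ κ) := by
  obtain ⟨D, -, hD⟩ := exists_divSubgroup_le_ker hc
  -- The divisor of φ is found by maximizing the index over the ball of D; the degree bound keeps
  -- these indices bounded.
  let S : Set ℕ := {n | ∃ E, D ≤ E ∧ (∀ a ∈ divSubgroup E, φ a = 1) ∧
    (divSubgroup D).relIndex (divSubgroup E) = n}
  have hS : S.Nonempty := ⟨_, D, le_rfl, hD, rfl⟩
  have hz := hZero_zero_pos (K := K)
  have hbd : BddAbove S := by
    obtain ⟨N, hN⟩ := exists_nat_gt ((hOne (0 : NonarchPlace K →₀ ℤ) : ℝ) ^ 2 /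
      (divNorm D * (hZero (0 : NonarchPlace K →₀ ℤ) : ℝ) ^ 2))
    refine ⟨N, ?_⟩
    rintro n ⟨E, hDE, hE, rfl⟩
    have h1 := divNorm_le_of_trivial hφ hE
    rw [← divSubgroup_relIndex hDE, mul_assoc, ← le_div_iff₀ (mul_pos (divNorm_pos D) (pow_pos hz 2))] at h1
    exact_mod_cast h1.trans hN.le
  obtain ⟨κ, hDκ, hκ, hr⟩ := Nat.sSup_mem hS hbd
  refine ⟨κ, fun E ↦ ⟨fun hE ↦ ?_, fun h a ha ↦ hκ a (divSubgroup_mono h ha)⟩⟩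
  -- The divisors on whose ball φ is trivial are closed under suprema, so a maximal one is the
  -- largest.
  have h1 : ∀ a ∈ divSubgroup (κ ⊔ E), φ a = 1 := by
    intro a ha
    obtain ⟨b, hb, c, hc, rfl⟩ := exists_mem_divSubgroup_add ha
    rw [φ.map_add_eq_mul, hκ b hb, hE c hc, mul_one]
  have h2 := le_csSup hbd ⟨κ ⊔ E, hDκ.trans le_sup_left, h1, rfl⟩
  rw [← hr, ← AddSubgroup.relIndex_mul_relIndex _ _ _ (divSubgroup_mono hDκ)
    (divSubgroup_mono (le_sup_left : κ ≤ κ ⊔ E))] at h2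
  have h3 := divSubgroup_relIndex_ne_zero hDκ
  have h4 := divSubgroup_relIndex_ne_zero (le_sup_left : κ ≤ κ ⊔ E)
  have h5 : (divSubgroup κ).relIndex (divSubgroup (κ ⊔ E)) = 1 := by
    have h6 : (divSubgroup κ).relIndex (divSubgroup (κ ⊔ E)) ≤ 1 := by
      refine Nat.le_of_mul_le_mul_left ?_ (Nat.pos_of_ne_zero h3)
      rwa [mul_one]
    omega
  rw [AddSubgroup.relIndex_eq_one, divSubgroup_le_iff] at h5
  exact le_sup_right.trans h5

/-- The converse half of duality: a character trivial on K and on the ball of D is φ multiplied by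
some x, and maximality of κ forces x to be a section of κ - D. -/
theorem IsDifferential.hOne_le_hZero {φ : AddChar (NonarchAdeleRing K) Circle} (hφ : IsDifferential φ)
    {κ : NonarchPlace K →₀ ℤ} (hκ : ∀ E, (∀ a ∈ divSubgroup E, φ a = 1) ↔ E ≤ κ)
    (D : NonarchPlace K →₀ ℤ) : hOne D ≤ hZero (κ - D) := by
  obtain ⟨h1, h2⟩ := natCard_differentials D
  have hfin : Finite {x : K // principal x ∈ divSubgroup (κ - D)} :=
    Nat.finite_of_card_ne_zero (by rw [hφ.natCard_eq_hZero]; exact hZero_ne_zero _)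
  rw [← hφ.natCard_eq_hZero, ← h2]
  have h3 : ∀ χ : Differentials D, ∃ x : {x : K // principal x ∈ divSubgroup (κ - D)},
      χ.1 = φ.mulShift (principal x.1) := by
    intro χ
    by_cases hχ : χ.1 = 1
    · exact ⟨⟨0, by rw [map_zero]; exact zero_mem _⟩, by rw [hχ, map_zero, AddChar.mulShift_zero]⟩
    · have hχ' : IsDifferential χ.1 :=
        ⟨hχ, fun x ↦ χ.2 _ (AddSubgroup.mem_sup_left (principal_mem_principalSubgroup x))⟩
      have hχ0 : ∀ a ∈ divSubgroup D, χ.1 a = 1 :=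
        fun a ha ↦ χ.2 _ (AddSubgroup.mem_sup_right ha)
      obtain ⟨x, hx⟩ := exists_mulShift_eq hχ' hφ (E := D ⊓ κ)
        (fun a ha ↦ hχ0 a (divSubgroup_mono inf_le_left ha)) ((hκ _).2 inf_le_right)
      have hx0 : x ≠ 0 := by
        rintro rfl
        rw [map_zero, AddChar.mulShift_zero] at hx
        exact hχ hx
      refine ⟨⟨x, ?_⟩, hx⟩
      let x' : Kˣ := Units.mk0 x hx0
      have h4 : ideleDiv (principalIdele x') + D ≤ κ := by
        rw [← hκ]
        intro a ha
        obtain ⟨b, rfl⟩ := (mulEquiv x').surjective a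
        have h5 := hχ0 b ((principal_mul_mem_divSubgroup_iff x' _ _).1 ha)
        rwa [hx] at h5
      rw [principal_mem_divSubgroup]
      intro v
      have h6 := le_sub_iff_add_le.2 h4 v
      rwa [← WithZero.exp_le_exp, exp_ideleDiv_principalIdele] at h6
  choose f hf using h3
  refine Nat.card_le_card_of_injective f fun χ χ' h ↦ Subtype.ext ?_
  rw [hf χ, hf χ', h]

/-- The degree of the divisor of a differential. -/
theorem IsDifferential.divNorm_eq {φ : AddChar (NonarchAdeleRing K) Circle} (hφ : IsDifferential φ)
    {κ : NonarchPlace K →₀ ℤ} (hκ : ∀ E, (∀ a ∈ divSubgroup E, φ a = 1) ↔ E ≤ κ) :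
    divNorm κ * (hZero (0 : NonarchPlace K →₀ ℤ) : ℝ) ^ 2 = (hOne (0 : NonarchPlace K →₀ ℤ) : ℝ) ^ 2 := by
  refine le_antisymm (divNorm_le_of_trivial hφ ((hκ κ).2 le_rfl)) ?_
  -- Duality at D = 0 and at D = κ bounds both sides of the Riemann–Roch identity for κ.
  have h1 : (hOne (0 : NonarchPlace K →₀ ℤ) : ℝ) ≤ hZero κ := by
    have := hφ.hOne_le_hZero hκ 0
    rw [sub_zero] at this
    exact_mod_cast this
  have h2 : (hOne κ : ℝ) ≤ hZero (0 : NonarchPlace K →₀ ℤ) := by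
    have := hφ.hOne_le_hZero hκ κ
    rw [sub_self] at this
    exact_mod_cast this
  have h3 := hZero_eq κ
  have hz := hZero_zero_pos (K := K)
  have ho := hOne_pos (0 : NonarchPlace K →₀ ℤ)
  have hk := divNorm_pos κ
  calc (hOne (0 : NonarchPlace K →₀ ℤ) : ℝ) ^ 2
      ≤ hZero κ * hOne (0 : NonarchPlace K →₀ ℤ) := by
        rw [sq]
        exact mul_le_mul_of_nonneg_right h1 ho.le
    _ = hZero (0 : NonarchPlace K →₀ ℤ) * (divNorm κ * hOne κ) := h3
    _ ≤ hZero (0 : NonarchPlace K →₀ ℤ) * (divNorm κ * hZero (0 : NonarchPlace K →₀ ℤ)) := by gcongr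
    _ = divNorm κ * (hZero (0 : NonarchPlace K →₀ ℤ) : ℝ) ^ 2 := by ring

/-- The ball of the divisor of a differential is its own dual. -/
theorem IsDifferential.forall_mul_eq_one_iff {φ : AddChar (NonarchAdeleRing K) Circle}
    {κ : NonarchPlace K →₀ ℤ} (hκ : ∀ E, (∀ a ∈ divSubgroup E, φ a = 1) ↔ E ≤ κ)
    (y : NonarchAdeleRing K) :
    (∀ u ∈ divSubgroup (0 : NonarchPlace K →₀ ℤ), φ (u * y) = 1) ↔ y ∈ divSubgroup κ := by
  classical
  have hκ0 := (hκ κ).2 le_rfl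
  constructor
  · intro h v
    by_contra hv
    rw [v.mem_ball, not_le] at hv
    have hy0 : Valued.v (y v) ≠ 0 := fun h0 ↦ by
      rw [h0] at hv
      exact not_lt_zero hv
    let n := WithZero.log (Valued.v (y v))
    have hn : WithZero.exp n = Valued.v (y v) := WithZero.exp_log hy0
    -- If y exceeded κ at v, raise the coefficient of κ at v to the size of y. Each element of the
    -- enlarged ball is an integral multiple of y plus an element of the ball of κ, so φ is trivial
    -- on it, against maximality.
    have h1 : Finsupp.single v n + κ.erase v ≤ κ := by
      rw [← hκ]
      intro a ha
      have hav : Valued.v (a v) ≤ WithZero.exp n := by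
        have := v.mem_ball.1 (ha v)
        rwa [Finsupp.add_apply, Finsupp.single_eq_same, Finsupp.erase_same, add_zero] at this
      let u : NonarchAdeleRing K := single v (a v * (y v)⁻¹)
      have hu : u ∈ divSubgroup (0 : NonarchPlace K →₀ ℤ) := by
        intro w
        rcases eq_or_ne w v with rfl | hw
        · rw [w.mem_ball, single_same, map_mul, map_inv₀, ← hn, Finsupp.coe_zero, Pi.zero_apply,
            WithZero.exp_zero, ← div_eq_mul_inv, div_le_one₀ (by simp)]
          exact hav
        · rw [single_of_ne hw _]
          exact zero_mem _
      have h2 : a - u * y ∈ divSubgroup κ := by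
        intro w
        rw [NonarchAdeleRing.sub_apply, NonarchAdeleRing.mul_apply]
        rcases eq_or_ne w v with rfl | hw
        · rw [single_same, inv_mul_cancel_right₀ ((Valuation.ne_zero_iff _).1 hy0), sub_self]
          exact zero_mem _
        · rw [single_of_ne hw _, zero_mul, sub_zero]
          have := ha w
          rwa [Finsupp.add_apply, Finsupp.single_eq_of_ne hw, Finsupp.erase_ne hw, zero_add] at this
      rw [← sub_add_cancel a (u * y), φ.map_add_eq_mul, hκ0 _ h2, h u hu, mul_one]
    have h2 := h1 v
    rw [Finsupp.add_apply, Finsupp.single_eq_same, Finsupp.erase_same, add_zero] at h2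
    rw [← hn, WithZero.exp_lt_exp] at hv
    omega
  · intro hy u hu
    have := mul_mem_divSubgroup hu hy
    rw [zero_add] at this
    exact hκ0 _ this

end

end GlobalField

/-! ### The genus and the degree of a canonical divisor -/

namespace GlobalField

open NonarchAdeleRing

/-- The cardinality of a vector space over a finite integral domain. -/
theorem natCard_eq_pow_finrank_of_isDomain (R V : Type*) [CommRing R] [IsDomain R] [Finite R]
    [AddCommGroup V] [Module R V] [Finite V] :
    Nat.card V = Nat.card R ^ Module.finrank R V := by
  have := Fintype.ofFinite R
  classical
  let : Field R := Fintype.fieldOfDomain R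
  exact Module.natCard_eq_pow_finrank

theorem zpow_finsuppSum {ι : Type*} {q : ℝ} (hq : q ≠ 0) (D : ι →₀ ℤ) (f : ι → ℤ → ℤ) :
    q ^ D.sum f = D.prod fun i n ↦ q ^ f i n := by
  classical
  rw [Finsupp.sum, Finsupp.prod]
  induction D.support using Finset.induction_on with
  | empty => simp
  | insert i s hi ih => rw [Finset.sum_insert hi, Finset.prod_insert hi, zpow_add₀ hq, ih]

variable {K : Type*} [Field K] [HasFinitePoles K]

theorem mem_constants_iff {x : K} :
    x ∈ constants K ↔ principal x ∈ divSubgroup (0 : NonarchPlace K →₀ ℤ) := by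
  rw [constants, Subring.mem_iInf, principal_mem_divSubgroup]
  exact forall_congr' fun v ↦ (v.valuation_le_one_iff x).symm

theorem mem_riemannRochSpace_iff {x : K} {D : NonarchPlace K →₀ ℤ} :
    x ∈ riemannRochSpace D ↔ principal x ∈ divSubgroup D :=
  principal_mem_divSubgroup.symm

variable [HasFiniteCohomology K] [∀ v : NonarchPlace K, Finite v.ResidueField]
  {φ : AddChar (NonarchAdeleRing K) Circle}

theorem IsDifferential.natCard_constants (hφ : IsDifferential φ) :
    Nat.card (constants K) = hZero (0 : NonarchPlace K →₀ ℤ) := by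
  rw [← hφ.natCard_eq_hZero]
  exact Nat.card_congr (Equiv.subtypeEquivRight fun x ↦ mem_constants_iff)

theorem IsDifferential.finite_constants (hφ : IsDifferential φ) : Finite (constants K) :=
  Nat.finite_of_card_ne_zero (by rw [hφ.natCard_constants]; exact hZero_ne_zero _)

theorem IsDifferential.hZero_eq_pow_finrank (hφ : IsDifferential φ) (D : NonarchPlace K →₀ ℤ) :
    hZero D = Nat.card (constants K) ^ Module.finrank (constants K) (riemannRochSpace D) := by
  have := hφ.finite_constants
  have h : Nat.card (riemannRochSpace D) = hZero D := by
    rw [← hφ.natCard_eq_hZero]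
    exact Nat.card_congr (Equiv.subtypeEquivRight fun x ↦ mem_riemannRochSpace_iff)
  have : Finite (riemannRochSpace D) :=
    Nat.finite_of_card_ne_zero (by rw [h]; exact hZero_ne_zero _)
  rw [← h, natCard_eq_pow_finrank_of_isDomain (constants K)]

theorem IsDifferential.natCard_residueField_eq_pow (hφ : IsDifferential φ) (v : NonarchPlace K) :
    Nat.card v.ResidueField = Nat.card (constants K) ^ placeDegree v := by
  have := hφ.finite_constants
  let := (constantsToResidueField v).toAlgebra
  exact natCard_eq_pow_finrank_of_isDomain (constants K) v.ResidueField

theorem IsDifferential.one_lt_natCard_constants (hφ : IsDifferential φ) :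
    1 < Nat.card (constants K) := by
  have := hφ.finite_constants
  exact Finite.one_lt_card

theorem IsDifferential.divNorm_eq_zpow (hφ : IsDifferential φ) (D : NonarchPlace K →₀ ℤ) :
    divNorm D = (Nat.card (constants K) : ℝ) ^ divisorDegree D := by
  have hq : (Nat.card (constants K) : ℝ) ≠ 0 := by
    exact_mod_cast (zero_lt_one.trans hφ.one_lt_natCard_constants).ne'
  rw [divisorDegree, zpow_finsuppSum hq, divNorm]
  refine Finsupp.prod_congr fun v _ ↦ ?_
  rw [hφ.natCard_residueField_eq_pow, Nat.cast_pow, ← zpow_natCast, ← zpow_mul, mul_comm]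

/-- `hZero_eq` in powers of q; the exponent is the quantity whose maximum defines the genus. -/
theorem IsDifferential.zpow_mul_hOne (hφ : IsDifferential φ) (D : NonarchPlace K →₀ ℤ) :
    (Nat.card (constants K) : ℝ) ^ (divisorDegree D + 1 -
      (Module.finrank (constants K) (riemannRochSpace D) : ℤ)) * hOne D =
        hOne (0 : NonarchPlace K →₀ ℤ) := by
  have hq : (Nat.card (constants K) : ℝ) ≠ 0 := by
    exact_mod_cast (zero_lt_one.trans hφ.one_lt_natCard_constants).ne'
  have h := hZero_eq D
  rw [← hφ.natCard_constants, hφ.divNorm_eq_zpow, hφ.hZero_eq_pow_finrank D, Nat.cast_pow] at h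
  rw [zpow_sub₀ hq, zpow_add₀ hq, zpow_one, zpow_natCast, div_mul_eq_mul_div,
    div_eq_iff (pow_ne_zero _ hq)]
  linear_combination -h

/-- The size of `H¹(0)` is `q ^ g`. -/
theorem IsDifferential.pow_genus (hφ : IsDifferential φ) :
    (Nat.card (constants K) : ℝ) ^ genus K = hOne (0 : NonarchPlace K →₀ ℤ) := by
  have hq : (1 : ℝ) < Nat.card (constants K) := by exact_mod_cast hφ.one_lt_natCard_constants
  -- Here `hOne D` = 1, its least value, so the exponent is maximal at this D.
  obtain ⟨D, hD⟩ := exists_principalSubgroup_sup_eq_top K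
  have h1 := hφ.zpow_mul_hOne D
  rw [hOne, hD, AddSubgroup.index_top, Nat.cast_one, mul_one] at h1
  have h2 : 0 ≤ divisorDegree D + 1 -
      (Module.finrank (constants K) (riemannRochSpace D) : ℤ) := by
    rw [← one_le_zpow_iff_right₀ hq, h1]
    exact_mod_cast Nat.one_le_iff_ne_zero.2 (hOne_ne_zero _)
  obtain ⟨n, hn⟩ := Int.eq_ofNat_of_zero_le h2
  rw [hn, zpow_natCast] at h1
  have hg : genus K = n := by
    refine IsGreatest.csSup_eq ⟨⟨D, hn.symm⟩, ?_⟩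
    rintro m ⟨E, hE⟩
    have h3 := hφ.zpow_mul_hOne E
    rw [← hE, zpow_natCast, ← h1] at h3
    rw [← pow_le_pow_iff_right₀ hq, ← h3]
    exact le_mul_of_one_le_right (by positivity)
      (by exact_mod_cast Nat.one_le_iff_ne_zero.2 (hOne_ne_zero _))
  rw [hg, h1]

/-- The degree of a canonical divisor is `2 g - 2`. -/
theorem IsDifferential.divNorm_eq_genus (hφ : IsDifferential φ) {κ : NonarchPlace K →₀ ℤ}
    (hκ : ∀ E, (∀ a ∈ divSubgroup E, φ a = 1) ↔ E ≤ κ) :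
    divNorm κ = (Nat.card (constants K) : ℝ) ^ (2 * (genus K : ℤ) - 2) := by
  have hq : (Nat.card (constants K) : ℝ) ≠ 0 := by
    exact_mod_cast (zero_lt_one.trans hφ.one_lt_natCard_constants).ne'
  have h := hφ.divNorm_eq hκ
  rw [← hφ.natCard_constants, ← hφ.pow_genus] at h
  rw [zpow_sub₀ hq, eq_div_iff (zpow_ne_zero _ hq), mul_comm 2, zpow_mul, zpow_natCast]
  exact_mod_cast h

end GlobalField

namespace GlobalField

open NonarchAdeleRing Polynomial

/-! ### Rational subrings of a rational function field -/

section Rational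

variable {k : Type*} [Field k]

instance [Finite k] : Ring.HasFiniteQuotients k[X] where
  finiteQuotient {I} hI := by
    obtain ⟨g, rfl⟩ := Submodule.IsPrincipal.principal I
    have hg : g ≠ 0 := by rintro rfl; simp at hI
    have : Module.Finite k (AdjoinRoot g) := (AdjoinRoot.powerBasis hg).finite
    exact Module.finite_of_finite k (M := AdjoinRoot g)

variable {F : Type*} [Field F] [Algebra k F]

/-- `t` generates `F` as a rational function field over `k`. -/
structure IsRationalGenerator (k : Type*) {F : Type*} [Field k] [Field F] [Algebra k F] (t : F) :
    Prop where
  injective : Function.Injective (aeval t : k[X] →ₐ[k] F)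
  exists_div (x : F) : ∃ f g : k[X], g ≠ 0 ∧ x = aeval t f / aeval t g

variable (k) in
/-- The ring `k[t]` inside `F`. -/
abbrev polyRing (t : F) : Subalgebra k F := (aeval t : k[X] →ₐ[k] F).range

variable {t : F}

theorem IsRationalGenerator.aeval_ne_zero (ht : IsRationalGenerator k t) {g : k[X]} (hg : g ≠ 0) :
    aeval t g ≠ 0 :=
  (map_ne_zero_iff _ ht.injective).2 hg

theorem IsRationalGenerator.isPrincipalIdealRing (ht : IsRationalGenerator k t) :
    IsPrincipalIdealRing (polyRing k t) :=
  IsPrincipalIdealRing.of_surjective (AlgEquiv.ofInjective _ ht.injective).toRingEquiv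
    (AlgEquiv.ofInjective _ ht.injective).surjective

theorem IsRationalGenerator.isFractionRing (ht : IsRationalGenerator k t) :
    IsFractionRing (polyRing k t) F := by
  refine IsFractionRing.of_field _ _ fun x ↦ ?_
  obtain ⟨f, g, -, rfl⟩ := ht.exists_div x
  exact ⟨⟨_, f, rfl⟩, ⟨_, g, rfl⟩, rfl⟩

theorem hasFiniteQuotients_polyRing [Finite k] (t : F) :
    Ring.HasFiniteQuotients (polyRing k t) := by
  let f : k[X] →+* polyRing k t := (aeval t : k[X] →ₐ[k] F).rangeRestrict
  let := f.toAlgebra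
  have : Module.Finite k[X] (polyRing k t) :=
    Module.Finite.of_surjective (Algebra.linearMap k[X] (polyRing k t))
      (AlgHom.rangeRestrict_surjective _)
  exact Ring.HasFiniteQuotients.of_module_finite k[X] _

theorem aeval_inv_reverse_mul {t : F} (ht : t ≠ 0) (f : k[X]) :
    aeval t⁻¹ f.reverse * t ^ f.natDegree = aeval t f := by
  have := invertibleOfNonzero ht
  have h := eval₂_reverse_mul_pow (algebraMap k F) t f
  rwa [invOf_eq_inv] at h

/-- Reversing polynomials exchanges t and t⁻¹ up to powers of t. -/
theorem IsRationalGenerator.inv (ht : IsRationalGenerator k t) : IsRationalGenerator k t⁻¹ := by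
  have h0 : t ≠ 0 := by
    have := ht.aeval_ne_zero (X_ne_zero (R := k))
    rwa [aeval_X] at this
  refine ⟨?_, fun x ↦ ?_⟩
  · rw [injective_iff_map_eq_zero]
    intro f hf
    have h := aeval_inv_reverse_mul (inv_ne_zero h0) f
    rw [hf, inv_inv, mul_eq_zero, or_iff_left (pow_ne_zero _ (inv_ne_zero h0)),
      map_eq_zero_iff _ ht.injective, reverse_eq_zero] at h
    exact h
  · obtain ⟨f, g, hg, rfl⟩ := ht.exists_div x
    refine ⟨f.reverse * X ^ g.natDegree, g.reverse * X ^ f.natDegree, ?_, ?_⟩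
    · exact mul_ne_zero (by rwa [ne_eq, reverse_eq_zero]) (pow_ne_zero _ X_ne_zero)
    · rw [← aeval_inv_reverse_mul h0 f, ← aeval_inv_reverse_mul h0 g, map_mul, map_mul, map_pow,
        map_pow, aeval_X]
      rw [inv_pow, inv_pow, mul_div_mul_comm, mul_div_mul_comm, inv_div_inv]

/-- A polynomial in `t` that becomes a polynomial in `t⁻¹` after multiplication by a positive
power of `t` vanishes. -/
theorem IsRationalGenerator.eq_zero_of_mul_pow_mem (ht : IsRationalGenerator k t) {y : F}
    (hy : y ∈ polyRing k t) {n : ℕ} (hn : 0 < n) (hy' : t ^ n * y ∈ polyRing k t⁻¹) : y = 0 := by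
  obtain ⟨f, rfl⟩ := hy
  obtain ⟨g, hg⟩ := hy'
  have h0 : t ≠ 0 := by
    have := ht.aeval_ne_zero (X_ne_zero (R := k))
    rwa [aeval_X] at this
  have h1 := aeval_inv_reverse_mul (inv_ne_zero h0) g
  change aeval t⁻¹ g = t ^ n * aeval t f at hg
  change aeval t f = 0
  rw [hg, inv_inv, inv_pow, mul_inv_eq_iff_eq_mul₀ (pow_ne_zero _ h0)] at h1
  have h2 : g.reverse = X ^ n * f * X ^ g.natDegree := ht.injective (by simpa using h1)
  by_contra hf
  have hf0 : f ≠ 0 := by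
    rintro rfl
    simp at hf
  -- The right side has degree greater than `g.natDegree`, as n > 0; a reversal of g cannot.
  have h3 := congrArg natDegree h2
  rw [natDegree_mul (mul_ne_zero (pow_ne_zero _ X_ne_zero) hf0) (pow_ne_zero _ X_ne_zero),
    natDegree_mul (pow_ne_zero _ X_ne_zero) hf0, natDegree_X_pow, natDegree_X_pow] at h3
  have := reverse_natDegree_le g
  omega

/-- Every element of `F` is the sum of a polynomial in `t` and of a proper fraction. -/
theorem IsRationalGenerator.exists_eq_add_div (ht : IsRationalGenerator k t) (x : F) :
    ∃ f r g : k[X], g ≠ 0 ∧ r.degree < g.degree ∧ x = aeval t f + aeval t r / aeval t g := by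
  obtain ⟨a, g, hg, rfl⟩ := ht.exists_div x
  refine ⟨a / g, a % g, g, hg, EuclideanDomain.mod_lt a hg, ?_⟩
  nth_rw 1 [← EuclideanDomain.div_add_mod a g]
  have := ht.aeval_ne_zero hg
  rw [map_add, map_mul]
  field_simp

theorem isRationalGenerator_X : IsRationalGenerator k (RatFunc.X : RatFunc k) := by
  have h : ∀ f : k[X], aeval (RatFunc.X : RatFunc k) f = algebraMap k[X] (RatFunc k) f := by
    intro f
    rw [← RatFunc.algebraMap_X, aeval_algebraMap_apply, aeval_X_left_apply]
  refine ⟨fun f g hfg ↦ ?_, fun x ↦ ?_⟩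
  · rw [h, h] at hfg
    exact IsFractionRing.injective k[X] (RatFunc k) hfg
  · obtain ⟨f, g, hg, rfl⟩ := IsFractionRing.div_surjective (A := k[X]) x
    exact ⟨f, g, nonZeroDivisors.ne_zero hg, by rw [h, h]⟩

end Rational

end GlobalField

/-! ### Finiteness for finite separable extensions of a rational function field -/

namespace GlobalField

open NonarchAdeleRing Polynomial

variable {k F K : Type*} [Field k] [Field F] [Field K] [Algebra k F] [Algebra F K] {t : F}

variable (k K) in
/-- The integral closure of `k[t]` in `K`. -/
abbrev intRing (t : F) : Subalgebra (polyRing k t) K := integralClosure (polyRing k t) K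

section

variable [FiniteDimensional F K] [Algebra.IsSeparable F K]

theorem IsRationalGenerator.isDedekindDomain_intRing (ht : IsRationalGenerator k t) :
    IsDedekindDomain (intRing k K t) :=
  have := ht.isPrincipalIdealRing
  have := ht.isFractionRing
  integralClosure.isDedekindDomain (polyRing k t) F K

theorem IsRationalGenerator.isFractionRing_intRing (ht : IsRationalGenerator k t) :
    IsFractionRing (intRing k K t) K :=
  have := ht.isFractionRing
  integralClosure.isFractionRing_of_finite_extension F K

theorem IsRationalGenerator.hasFiniteQuotients_intRing [Finite k] (ht : IsRationalGenerator k t) :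
    Ring.HasFiniteQuotients (intRing k K t) :=
  have := ht.isPrincipalIdealRing
  have := ht.isFractionRing
  have := hasFiniteQuotients_polyRing (k := k) t
  have : Module.Finite (polyRing k t) (intRing k K t) :=
    IsIntegralClosure.finite (polyRing k t) F K (intRing k K t)
  Ring.HasFiniteQuotients.of_module_finite (polyRing k t) _

end

variable [Algebra k K] [IsScalarTower k F K] [Finite k]

theorem NonarchPlace.algebraMap_mem (v : NonarchPlace K) (c : k) : algebraMap k K c ∈ v.ring :=
  (v.valuation_le_one_iff _).1 (Valuation.IsTrivialOn.valuation_algebraMap_le_one _ c)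

theorem NonarchPlace.algebraMap_mem_of_mem_intRing (v : NonarchPlace K) (hv : algebraMap F K t ∈ v.ring)
    (r : intRing k K t) : algebraMap (intRing k K t) K r ∈ v.ring := by
  refine v.mem_ring_of_isIntegral (S := polyRing k t) ?_ r.2
  rintro ⟨_, f, rfl⟩
  change algebraMap F K (aeval t f) ∈ v.ring
  rw [← aeval_algebraMap_apply, aeval_eq_sum_range]
  refine sum_mem fun i _ ↦ ?_
  rw [Algebra.smul_def]
  exact mul_mem (v.algebraMap_mem _) (pow_mem hv _)

variable [FiniteDimensional F K] [Algebra.IsSeparable F K]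

theorem IsRationalGenerator.finite_residueField_of_mem (ht : IsRationalGenerator k t)
    (v : NonarchPlace K) (hv : algebraMap F K t ∈ v.ring) : Finite v.ResidueField := by
  have := ht.isDedekindDomain_intRing (K := K)
  have := ht.isFractionRing_intRing (K := K)
  have := ht.hasFiniteQuotients_intRing (K := K)
  have h : v.LiesOver (intRing k K t) := v.algebraMap_mem_of_mem_intRing hv
  exact h.finite_residueField

/-- Every place makes t or t⁻¹ integral, hence lies over the integral closure of k[t] or of k[t⁻¹].
-/
theorem IsRationalGenerator.finite_residueField (ht : IsRationalGenerator k t)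
    (v : NonarchPlace K) : Finite v.ResidueField := by
  rcases v.ring.mem_or_inv_mem (algebraMap F K t) with h | h
  · exact ht.finite_residueField_of_mem v h
  · rw [← map_inv₀] at h
    exact ht.inv.finite_residueField_of_mem v h

theorem IsRationalGenerator.finite_one_lt_of_mem (ht : IsRationalGenerator k t) (x : K) :
    {v : NonarchPlace K | algebraMap F K t ∈ v.ring ∧ 1 < v.prime.valuation K x}.Finite := by
  have := ht.isDedekindDomain_intRing (K := K)
  have := ht.isFractionRing_intRing (K := K)
  refine (NonarchPlace.LiesOver.finite_one_lt (R := intRing k K t) x).subset ?_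
  rintro v ⟨hv, hx⟩
  exact ⟨v.algebraMap_mem_of_mem_intRing hv, hx⟩

theorem IsRationalGenerator.hasFinitePoles (ht : IsRationalGenerator k t) : HasFinitePoles K where
  finite_one_lt x := by
    refine ((ht.finite_one_lt_of_mem x).union (ht.inv.finite_one_lt_of_mem x)).subset ?_
    intro v hx
    rcases v.ring.mem_or_inv_mem (algebraMap F K t) with h | h
    · exact Or.inl ⟨h, hx⟩
    · rw [← map_inv₀] at h
      exact Or.inr ⟨h, hx⟩

theorem exists_nonneg_valuation_le [HasFinitePoles K] (x : K) :
    ∃ D : NonarchPlace K →₀ ℤ, 0 ≤ D ∧ ∀ v, v.prime.valuation K x ≤ WithZero.exp (D v) := by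
  rcases eq_or_ne x 0 with rfl | hx
  · exact ⟨0, le_rfl, fun v ↦ by simp⟩
  · refine ⟨ideleDiv (principalIdele (Units.mk0 x hx)) ⊔ 0, le_sup_right, fun v ↦ ?_⟩
    have := exp_ideleDiv_principalIdele (Units.mk0 x hx) v
    rw [Units.val_mk0] at this
    rw [← this, WithZero.exp_le_exp, Finsupp.sup_apply]
    exact le_sup_left

/-- At a pole of t the leading power dominates, so a proper fraction in t has no pole. -/
theorem NonarchPlace.valuation_aeval_div_le_one {v : NonarchPlace K} {t : K} (ht : 1 < v.prime.valuation K t)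
    {r g : k[X]} (h : r.degree < g.degree) : v.prime.valuation K (aeval t r / aeval t g) ≤ 1 := by
  rcases eq_or_ne r 0 with rfl | hr
  · simp
  have hg : g ≠ 0 := by
    rintro rfl
    simp at h
  rw [map_div₀, valuation_aeval_eq_valuation_X_pow_natDegree_of_one_lt_valuation_X t ht hr,
    valuation_aeval_eq_valuation_X_pow_natDegree_of_one_lt_valuation_X t ht hg,
    div_le_one₀ (pow_pos (zero_lt_one.trans ht) _)]
  exact pow_le_pow_right₀ ht.le (natDegree_le_natDegree h.le)

/-- Every element of `K` is the sum of an element that is integral over `k[t]` and of an element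
whose poles above `∞` are bounded. -/
theorem IsRationalGenerator.exists_sub_le [HasFinitePoles K] (ht : IsRationalGenerator k t) :
    ∃ D : NonarchPlace K →₀ ℤ, 0 ≤ D ∧ ∀ y : K, ∃ z : intRing k K t, ∀ v : NonarchPlace K,
      algebraMap F K t ∉ v.ring → v.prime.valuation K (y - z) ≤ WithZero.exp (D v) := by
  have := ht.isPrincipalIdealRing
  have := ht.isFractionRing
  obtain ⟨s, b, hb⟩ := FiniteDimensional.exists_is_basis_integral (polyRing k t) F K
  choose E hE0 hE using fun i ↦ exists_nonneg_valuation_le (b i)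
  refine ⟨∑ i, E i, Finset.sum_nonneg fun i _ ↦ hE0 i, fun y ↦ ?_⟩
  -- The polynomial parts of the coordinates in an integral basis make up z; the proper fractions
  -- are bounded at the poles of t, so only the poles of the basis remain.
  choose f r g hg hrg hfrg using fun i ↦ ht.exists_eq_add_div (b.repr y i)
  let z : intRing k K t := ∑ i, algebraMap (polyRing k t) (intRing k K t) ⟨_, f i, rfl⟩ * ⟨b i, hb i⟩
  have hz : (z : K) = ∑ i, algebraMap F K (aeval t (f i)) * b i := by
    simp only [z, AddSubmonoidClass.coe_finsetSum, MulMemClass.coe_mul]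
    rfl
  refine ⟨z, fun v hv ↦ ?_⟩
  have ht1 : 1 < v.prime.valuation K (algebraMap F K t) := by
    rw [← not_le, v.valuation_le_one_iff]
    exact hv
  have hyz : y - z = ∑ i, (aeval (algebraMap F K t) (r i) / aeval (algebraMap F K t) (g i)) * b i := by
    nth_rw 1 [← b.sum_repr y]
    rw [hz, ← Finset.sum_sub_distrib]
    refine Finset.sum_congr rfl fun i _ ↦ ?_
    rw [hfrg, Algebra.smul_def, map_add, add_mul, add_sub_cancel_left, map_div₀,
      aeval_algebraMap_apply, aeval_algebraMap_apply]
  rw [hyz]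
  refine Valuation.map_sum_le _ fun i _ ↦ ?_
  rw [map_mul]
  refine (mul_le_of_le_one_left' (NonarchPlace.valuation_aeval_div_le_one ht1 (hrg i))).trans
    ((hE i v).trans ?_)
  rw [WithZero.exp_le_exp]
  exact Finset.single_le_sum (f := E) (fun j _ ↦ hE0 j) (Finset.mem_univ i) v

/-- First x approximates a where t is integral, then y approximates the remainder where t⁻¹ is
integral. Replacing y by the nearby element z, integral over k[t], keeps the first approximation and
costs only D at the poles of t. -/
theorem IsRationalGenerator.exists_sub_mem [HasFinitePoles K] (ht : IsRationalGenerator k t) :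
    ∃ D : NonarchPlace K →₀ ℤ, ∀ a : NonarchAdeleRing K, ∃ x : K,
      a - principal x ∈ divSubgroup D := by
  have := ht.isDedekindDomain_intRing (K := K)
  have := ht.isFractionRing_intRing (K := K)
  have := ht.inv.isDedekindDomain_intRing (K := K)
  have := ht.inv.isFractionRing_intRing (K := K)
  obtain ⟨D, hD, h⟩ := ht.exists_sub_le (K := K)
  refine ⟨D, fun a ↦ ?_⟩
  obtain ⟨x, hx⟩ := exists_sub_mem_ball_of_liesOver (intRing k K t) a 0
  obtain ⟨y, hy⟩ := exists_sub_mem_ball_of_liesOver (intRing k K t⁻¹) (a - principal x) 0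
  obtain ⟨z, hz⟩ := h y
  have hball : ∀ v : NonarchPlace K, v.ball ((0 : NonarchPlace K →₀ ℤ) v) ≤ v.ball (D v) := fun v b hb ↦ by
    rw [v.mem_ball] at hb ⊢
    exact hb.trans (WithZero.exp_le_exp.2 (hD v))
  refine ⟨x + z, fun v ↦ ?_⟩
  rw [map_add, ← sub_sub, NonarchAdeleRing.sub_apply, NonarchAdeleRing.sub_apply, principal_apply,
    principal_apply]
  by_cases hv : algebraMap F K t ∈ v.ring
  · have hv' : v.LiesOver (intRing k K t) := v.algebraMap_mem_of_mem_intRing hv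
    refine hball v (sub_mem (hx v hv') ?_)
    rw [v.mem_ball, v.valued_coe, Finsupp.coe_zero, Pi.zero_apply, WithZero.exp_zero,
      v.valuation_le_one_iff]
    exact hv' z
  · have hv' : v.LiesOver (intRing k K t⁻¹) := v.algebraMap_mem_of_mem_intRing <| by
      rw [map_inv₀]
      exact (v.ring.mem_or_inv_mem _).resolve_left hv
    have h1 := hball v (hy v hv')
    have h2 : ((y - z : K) : v.Completion) ∈ v.ball (D v) := by
      rw [v.mem_ball, v.valued_coe]
      exact hz v hv
    rw [v.coe_sub] at h2
    have h3 := add_mem h1 h2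
    rwa [NonarchAdeleRing.sub_apply, principal_apply, sub_add_sub_cancel] at h3

/-- D bounds the poles of t, so a section x of -D is regular everywhere and so is tx. The norm of x
is then a polynomial in t, and t^n times it, with n the degree of K over F, is a polynomial in t⁻¹;
this forces the norm to vanish. -/
theorem IsRationalGenerator.exists_eq_zero [HasFinitePoles K] (ht : IsRationalGenerator k t) :
    ∃ D : NonarchPlace K →₀ ℤ, ∀ x : K, principal x ∈ divSubgroup D → x = 0 := by
  have := ht.isPrincipalIdealRing
  have := ht.isFractionRing
  have := ht.inv.isPrincipalIdealRing
  have := ht.inv.isFractionRing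
  have key : ∀ {s : F}, IsRationalGenerator k s → ∀ x : K,
      (∀ v : NonarchPlace K, x ∈ v.ring) → Algebra.norm F x ∈ polyRing k s := by
    intro s hs x hx
    have := hs.isPrincipalIdealRing
    have := hs.isFractionRing
    have := hs.isDedekindDomain_intRing (K := K)
    have := hs.isFractionRing_intRing (K := K)
    obtain ⟨z, rfl⟩ := HeightOneSpectrum.mem_integers_of_valuation_le_one (R := intRing k K s) K x
      fun P ↦ by
        obtain ⟨v, -, hv⟩ := exists_place (K := K) P
        rw [← hv, v.valuation_le_one_iff]
        exact hx v
    obtain ⟨y, hy⟩ := IsIntegrallyClosed.isIntegral_iff.1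
      (Algebra.isIntegral_norm (R := polyRing k s) F z.2)
    change Algebra.norm F (z : K) ∈ _
    rw [← hy]
    exact y.2
  obtain ⟨D, hD, h⟩ := exists_nonneg_valuation_le (algebraMap F K t)
  refine ⟨-D, fun x hx ↦ ?_⟩
  rw [principal_mem_divSubgroup] at hx
  have h1 : ∀ v : NonarchPlace K, x ∈ v.ring := fun v ↦ by
    rw [← v.valuation_le_one_iff]
    refine (hx v).trans ?_
    rw [← WithZero.exp_zero, WithZero.exp_le_exp]
    exact neg_nonpos.2 (hD v)
  have h2 : ∀ v : NonarchPlace K, algebraMap F K t * x ∈ v.ring := fun v ↦ by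
    rw [← v.valuation_le_one_iff, map_mul]
    refine (mul_le_mul' (h v) (hx v)).trans ?_
    rw [← WithZero.exp_add, Finsupp.neg_apply, add_neg_cancel, WithZero.exp_zero]
  have h3 := key ht.inv _ h2
  rw [map_mul, Algebra.norm_algebraMap] at h3
  rw [← Algebra.norm_eq_zero_iff (R := F)]
  exact ht.eq_zero_of_mul_pow_mem (key ht x h1) Module.finrank_pos h3

theorem IsRationalGenerator.hasFiniteCohomology [HasFinitePoles K] (ht : IsRationalGenerator k t) :
    HasFiniteCohomology K := ⟨ht.exists_sub_mem, ht.exists_eq_zero⟩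

end GlobalField

/-! ### The conductor of a character of a function field -/

namespace GlobalField

open NumberField

section FunctionField

variable {K : Type*} [Field K]

theorem isEmpty_infinitePlace_of_charP (K : Type*) [Field K] (p : ℕ) [CharP K p] (hp : p ≠ 0) :
    IsEmpty (InfinitePlace K) := by
  refine ⟨fun v ↦ hp ?_⟩
  have h := congrArg v.embedding (CharP.cast_eq_zero K p)
  rw [map_natCast, map_zero] at h
  exact_mod_cast h

/-- The conductor of a global character of a field without archimedean places. -/
theorem exists_isConductor_of_isEmpty [IsEmpty (InfinitePlace K)] [HasFinitePoles K]
    [HasFiniteCohomology K] [∀ v : NonarchPlace K, Finite v.ResidueField]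
    {ψ : AddChar (AdeleRing K) Circle} (hψ : IsGlobalCharacter ψ) :
    ∃ κ : (AdeleRing K)ˣ, IsConductor ψ κ ∧
      ideleNorm κ = (Nat.card (constants K) : ℝ) ^ (2 * (genus K : ℤ) - 2) := by
  have hsub : Subsingleton (InfiniteAdeleRing K) := ⟨fun a b ↦ funext fun v ↦ isEmptyElim v⟩
  let φ : AddChar (NonarchAdeleRing K) Circle := ψ.compAddMonoidHom (AddMonoidHom.inr _ _)
  have hφ : ∀ x, φ x = ψ (0, x) := fun _ ↦ rfl
  have hdiff : IsDifferential φ := by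
    refine ⟨fun h ↦ hψ.nontrivial (DFunLike.ext _ _ fun u ↦ ?_), fun x ↦ ?_⟩
    · rw [← Prod.mk.eta (p := u), Subsingleton.elim u.1 0, ← hφ, h]
      rfl
    · exact hψ.trivial_on_principal _ ⟨x, fun v ↦ isEmptyElim v, fun v ↦ rfl⟩
  obtain ⟨D, hD⟩ := hdiff.exists_divisor (hψ.continuous.comp (Continuous.prodMk_right 0))
  obtain ⟨β, hβ⟩ := exists_ideleDiv_eq D
  let κ : (AdeleRing K)ˣ := MulEquiv.prodUnits.symm (1, β)
  have hκ : nonarchPart κ = β := rfl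
  refine ⟨κ, ⟨fun y ↦ ?_, fun x ↦ ?_⟩, ?_⟩
  · rw [hκ, hβ]
    exact IsDifferential.forall_mul_eq_one_iff hD y
  · rw [Subsingleton.elim x 0, Prod.mk_zero_zero, ψ.map_zero_eq_one, mul_zero, infTrace, finsum_of_isEmpty,
      mul_zero, Circle.exp_zero]
  · rw [ideleNorm_eq, hκ, hβ, archNorm, finprod_of_isEmpty, one_mul, hdiff.divNorm_eq_genus hD]

end FunctionField

end GlobalField

end

/-! ### Assembly of the two cases -/

theorem mainTheorem2 (K : Type*) [Field K] (hK : GlobalField.IsGlobalField K)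
    [MeasurableSpace (GlobalField.AdeleRing K)] [BorelSpace (GlobalField.AdeleRing K)]
    (ψ : AddChar (GlobalField.AdeleRing K) Circle) (hψ : GlobalField.IsGlobalCharacter ψ)
    (μ : MeasureTheory.Measure (GlobalField.AdeleRing K)) [μ.IsAddHaarMeasure]
    (hμ : GlobalField.IsSelfDual ψ μ) (α : (GlobalField.AdeleRing K)ˣ) :
    MeasureTheory.Integrable (GlobalField.adelicFun α) μ ∧
    0 < ∫ u, GlobalField.adelicFun α u ∂μ ∧
    0 < GlobalField.ideleNorm α ∧
    0 < GlobalField.absDiscr K ∧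
    GlobalField.eulerChar μ α =
      Real.log (GlobalField.ideleNorm α) - 1 / 2 * Real.log (GlobalField.absDiscr K) ∧
    (∀ κ : (GlobalField.AdeleRing K)ˣ,
      GlobalField.ideleNorm κ = GlobalField.absDiscr K ^ (-(1 / 2) : ℝ) →
        GlobalField.eulerChar μ α =
          Real.log (GlobalField.ideleNorm α) + Real.log (GlobalField.ideleNorm κ)) ∧
    (∀ κ : (GlobalField.AdeleRing K)ˣ, GlobalField.IsCanonicalIdele ψ μ κ →
      GlobalField.ideleNorm κ = GlobalField.absDiscr K ∧
        GlobalField.eulerChar μ α =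
          Real.log (GlobalField.ideleNorm α) - 1 / 2 * Real.log (GlobalField.ideleNorm κ)) ∧
    GlobalField.eulerChar μ α - GlobalField.eulerChar μ 1 =
      Real.log (GlobalField.ideleNorm α) := by
  rcases hK with hK | ⟨p, hp, hA, hfin, hsep⟩
  · obtain ⟨κ, hκ, hd⟩ := GlobalField.exists_isConductor_of_numberField hψ
    rw [← show GlobalField.absDiscr K = |((NumberField.discr K : ℤ) : ℝ)| from dif_pos hK] at hd
    exact GlobalField.main_of_isConductor hκ μ hμ hd α
  -- The prime field acts through the rational function field, so that the scalar tower holds by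
  -- definition.
  · let : Algebra (ZMod p) K :=
      ((algebraMap (RatFunc (ZMod p)) K).comp (algebraMap (ZMod p) (RatFunc (ZMod p)))).toAlgebra
    have : IsScalarTower (ZMod p) (RatFunc (ZMod p)) K := IsScalarTower.of_algebraMap_eq fun _ ↦ rfl
    have : CharP K p := charP_of_injective_algebraMap (algebraMap (ZMod p) K).injective p
    have := GlobalField.isEmpty_infinitePlace_of_charP K p hp.out.ne_zero
    have ht := GlobalField.isRationalGenerator_X (k := ZMod p)
    have := ht.hasFinitePoles (K := K)
    have := ht.hasFiniteCohomology (K := K)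
    have := ht.finite_residueField (K := K)
    have hnf : ¬ NumberField K := fun h ↦
      hp.out.ne_zero (CharP.eq K (inferInstance : CharP K p) (CharP.ofCharZero K))
    obtain ⟨κ, hκ, hd⟩ := GlobalField.exists_isConductor_of_isEmpty hψ
    rw [← show GlobalField.absDiscr K = _ from dif_neg hnf] at hd
    exact GlobalField.main_of_isConductor hκ μ hμ hd α
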